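/- **Setting.** Let $\mathbb K$ be a field of characteristic $0$, $(\mathbb I,\cdot)$ a (finite) Cartan datum, and $(Y,X,\langle\cdot,\cdot\rangle,(h_i),(\alpha_i))$ an $X$- and $Y$-regular root datum of this type with $Y=(\oplus_i\mathbb Z h_i)\oplus Y'$. Put $a_{ij}=\langle h_i,\alpha_j\rangle$, $\epsilon_i=\frac{i\cdot i}{2}$, $q_i=q^{\epsilon_i}$, $[n]_i=\frac{q_i^n-q_i^{-n}}{q_i-q_i^{-1}}$, $[m]_i!=\prod_{l=1}^m[l]_i$, and $x^{(m)}=x^m/[m]_i!$ for ordinary divided powers (for the index $i$ in question). Let $\widetilde{\mathbf U}$ be the Drinfeld double: the $\mathbb K(q)$-algebra generated by $E_i,F_i$ ($i\in\mathbb I$) and $K_h,K'_h$ ($h\in Y$), where all $K_h,K'_{h'}$ commute, $K_0=K'_0=1$, $K_{h+h'}=K_hK_{h'}$, $K'_{h+h'}=K'_hK'_{h'}$, and $$K_hE_i=q^{\langle h,\alpha_i\rangle}E_iK_h,\quad K_hF_i=q^{-\langle h,\alpha_i\rangle}F_iK_h,\quad K'_hE_i=q^{-\langle h,\alpha_i\rangle}E_iK'_h,\quad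 K'_hF_i=q^{\langle h,\alpha_i\rangle}F_iK'_h,$$ $[E_i,F_j]=\delta_{ij}\frac{\widetilde K_i-\widetilde K_i'}{q_i-q_i^{-1}}$ with $\widetilde K_i=K_{h_i}^{\epsilon_i}$, $\widetilde K'_i=(K'_{h_i})^{\epsilon_i}$, together with the $q$-Serre relations for the $E_i$ and for the $F_i$. Let $(\mathbb I_\bullet,\tau)$ be an admissible pair: $\tau$ is an involution of the Cartan datum (possibly trivial), $\mathbb I_\bullet\subset\mathbb I$ is of finite type, $\tau(\mathbb I_\bullet)=\mathbb I_\bullet$, $\tau$ acts on $\mathbb I_\bullet$ as $-w_\bullet$ with $w_\bullet$ the longest element of $W_{\mathbb I_\bullet}$, and $\langle\rho^\vee_\bullet,\alpha_j\rangle\in\mathbb Z$ whenever $\tau j=j\in\mathbb I_\circ=\mathbb I\setminus\mathbb I_\bullet$, where $\rho^\vee_\bullet$ is half the sum of the positive coroots of $\mathbb I_\bullet$. Let $\mathbf T_w$ ($w\in W_{\mathbb I_\bullet}$) be Lusztig's symmetries $T''_{w,+1}$ of $\widetilde{\mathbf U}$: $\mathbf T_w=\mathbf T_{s_{k_1}}\cdots\mathbf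 T_{s_{k_l}}$ for each reduced expression of $w$, where $\mathbf T_{s_k}(K_h)=K_{s_kh}$, $\mathbf T_{s_k}(K'_h)=K'_{s_kh}$, $\mathbf T_{s_k}(E_k)=-F_k(\widetilde K_k')^{-1}$, $\mathbf T_{s_k}(F_k)=-\widetilde K_k^{-1}E_k$ and, for $l\ne k$, $$\mathbf T_{s_k}(E_l)=\sum_{r+s=-a_{kl}}(-1)^rq_k^{-r}E_k^{(s)}E_lE_k^{(r)},\qquad \mathbf T_{s_k}(F_l)=\sum_{r+s=-a_{kl}}(-1)^rq_k^{r}F_k^{(r)}F_lF_k^{(s)}.$$ For $j\in\mathbb I_\circ$ put $B_j=F_j+\mathbf T_{w_\bullet}(E_{\tau j})\widetilde K_j'$ and $\widetilde k_j=\widetilde K_j\widetilde K'_{\tau j}$; for $j\in\mathbb I_\bullet$ put $B_j=F_j$. We write $w_\bullet j=j$ for $w_\bullet(\alpha_j)=\alpha_j$. **$\imath$divided powers.** For $n\ge0$ and $\overline t\in\mathbb Z/2$, the element $B_{j,\overline t}^{(n)}$ is defined as follows (only case (i) depends on $\overline t$). (i) If $\tau j=j=w_\bullet j$ (so that $j\in\mathbb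 I_\circ$): $[n]_j!\,B^{(n)}_{j,\overline t}$ equals, with $k=\lfloor n/2\rfloor$, - $B_j^{\,n-2k}\prod_{l=1}^k\big(B_j^2-q_j\widetilde k_j[2l-1]_j^2\big)$ if $\overline t=\overline 1$; - $B_j\prod_{l=1}^k\big(B_j^2-q_j\widetilde k_j[2l]_j^2\big)$ if $\overline t=\overline 0$ and $n$ is odd; - $\prod_{l=1}^k\big(B_j^2-q_j\widetilde k_j[2l-2]_j^2\big)$ if $\overline t=\overline 0$ and $n$ is even. (ii) If $\tau j\neq j$ or $j\in\mathbb I_\bullet$: $B^{(n)}_{j,\overline t}=B_j^n/[n]_j!$. (iii) If $j\in\mathbb I_\circ$ and $\tau j=j\ne w_\bullet j$: with $$b_j^{(n)}=\sum_{a=0}^nq_j^{-a(n-a)}\big(\mathbf T_{w_\bullet}(E_j)\widetilde K'_j\big)^{(a)}F_j^{(n-a)},\qquad Z_j=\frac{r_j(\mathbf T_{w_\bullet}(E_j))}{q_j^{-1}-q_j},$$ $$B^{(n)}_{j,\overline t}=b_j^{(n)}+\frac{q}{q-q^{-1}}\sum_{1\le k\le n/2}q_j^{k(k+1)/2}\big(Z_j\widetilde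 K_j\widetilde K_j'\big)^{(k)}b_j^{(n-2k)},$$ where $r_j$ is the linear endomorphism of the subalgebra $\widetilde{\mathbf U}^+$ generated by the $E_i$ with $r_j(1)=0$, $r_j(E_k)=\delta_{jk}$ and $r_j(xx')=x\,r_j(x')+q^{j\cdot\mu'}r_j(x)x'$ for $x'$ homogeneous of weight $\mu'$. **Proposition.** Let $i\ne j$ in $\mathbb I$ with $\tau i=i=w_\bullet i$, and let $\overline p,\overline t\in\mathbb Z/2$. Then the following two families of identities in $\widetilde{\mathbf U}$ (equivalently, in the universal $\imath$quantum group $\widetilde{\mathbf U}^\imath\subset\widetilde{\mathbf U}$) are equivalent, i.e. the first holds for all $n\ge0$ if and only if the second holds for all $n\ge0$: $$\sum_{r+s=1-na_{ij}}(-1)^rB^{(r)}_{i,\overline p}\,B_j^n\,B^{(s)}_{i,\overline p+\overline{na_{ij}}}=0\qquad(n\ge0),$$ $$\sum_{r+s=1-na_{ij}}(-1)^rB^{(r)}_{i,\overline p}\,B_{j,\overline t}^{(n)}\,B^{(s)}_{i,\overline p+\overline{na_{ij}}}=0\qquad(n\ge0).$$ -/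

import Mathlib

open scoped BigOperators

noncomputable section

/-! ### Root data, Weyl groups, admissible pairs -/

/-- A Cartan datum `(I, ·)` together with an `X`-regular and `Y`-regular root datum
`(Y, X, ⟨·,·⟩, h, α)` of that type such that `Y = (⊕ ℤ hᵢ) ⊕ Y'`. -/
structure QRootDatum (I Y X : Type*) [AddCommGroup Y] [AddCommGroup X] where
  /-- the symmetric form `i · j` of the Cartan datum -/
  form : I → I → ℤ
  form_symm : ∀ i j, form i j = form j i
  form_pos : ∀ i, 0 < form i i
  form_even : ∀ i, Even (form i i)
  form_nonpos : ∀ i j, i ≠ j → form i j ≤ 0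
  freeY : Module.Free ℤ Y
  finiteY : Module.Finite ℤ Y
  freeX : Module.Free ℤ X
  finiteX : Module.Finite ℤ X
  /-- the perfect pairing `⟨·,·⟩ : Y × X → ℤ` -/
  pair : Y →ₗ[ℤ] X →ₗ[ℤ] ℤ
  perfect : pair.IsPerfPair
  /-- the simple coroots -/
  h : I → Y
  /-- the simple roots -/
  α : I → X
  indep_h : LinearIndependent ℤ h
  indep_α : LinearIndependent ℤ α
  /-- `⟨hᵢ, αⱼ⟩ = 2 (i · j) / (i · i)` -/
  pair_simple : ∀ i j, form i i * pair (h i) (α j) = 2 * form i j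
  split : ∃ Y' : Submodule ℤ Y, IsCompl (Submodule.span ℤ (Set.range h)) Y'

namespace QRootDatum

variable {I Y X : Type*} [AddCommGroup Y] [AddCommGroup X] (R : QRootDatum I Y X)

/-- The entry `aᵢⱼ = ⟨hᵢ, αⱼ⟩` of the generalized Cartan matrix. -/
def a (i j : I) : ℤ := R.pair (R.h i) (R.α j)

/-- `εᵢ = (i · i) / 2`, a positive integer. -/
def eps (i : I) : ℕ := (R.form i i / 2).toNat

theorem a_self (i : I) : R.pair (R.h i) (R.α i) = 2 := by
  have h1 := R.pair_simple i i
  have h2 := R.form_pos i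
  have h3 : R.form i i * R.pair (R.h i) (R.α i) = R.form i i * 2 := by rw [h1]; ring
  exact mul_left_cancel₀ h2.ne' h3

/-- The simple reflection `λ ↦ λ - ⟨hₖ, λ⟩ αₖ` of `X`. -/
def s (k : I) : X ≃ₗ[ℤ] X := Module.reflection (R.a_self k)

/-- The simple reflection `y ↦ y - ⟨y, αₖ⟩ hₖ` of `Y`. -/
def sY (k : I) : Y ≃ₗ[ℤ] Y :=
  Module.reflection (x := R.h k) (f := R.pair.flip (R.α k)) (R.a_self k)

/-- The parabolic Weyl group `W_J`, `J ⊆ I`, as a group of automorphisms of `X`. -/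
def weyl (J : Set I) : Subgroup (X ≃ₗ[ℤ] X) := Subgroup.closure (R.s '' J)

/-- The length function of `W_J`. -/
def len (J : Set I) (w : X ≃ₗ[ℤ] X) : ℕ :=
  sInf {n | ∃ l : List I, (∀ k ∈ l, k ∈ J) ∧ (l.map R.s).prod = w ∧ l.length = n}

/-- `w` is the longest element of `W_J`. -/
def IsLongest (J : Set I) (w : X ≃ₗ[ℤ] X) : Prop :=
  w ∈ R.weyl J ∧ ∀ v ∈ R.weyl J, R.len J v ≤ R.len J w

/-- The (real) coroots of the subdatum `J`: the Weyl group orbits of its simple coroots. -/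
inductive IsCoroot (J : Set I) : Y → Prop
  | simple (k : I) (hk : k ∈ J) : IsCoroot J (R.h k)
  | refl (k : I) (hk : k ∈ J) (y : Y) (hy : IsCoroot J y) : IsCoroot J (R.sY k y)

/-- The positive coroots of the subdatum `J`. -/
def posCoroots (J : Set I) : Set Y :=
  {y | R.IsCoroot J y ∧ y ∈ AddSubmonoid.closure (R.h '' J)}

/-- An admissible pair `(I_•, τ)`. The field `w0` is the longest element `w_•` of `W_{I_•}`. -/
structure AdmissiblePair where
  /-- the set `I_•` -/
  black : Set I
  /-- the involution `τ` of the Cartan datum -/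
  τ : I → I
  τ_invol : ∀ i, τ (τ i) = i
  τ_form : ∀ i j, R.form (τ i) (τ j) = R.form i j
  /-- `I_•` is of finite type, that is, its Weyl group is finite -/
  finite_type : (R.weyl black : Set (X ≃ₗ[ℤ] X)).Finite
  /-- the longest element `w_•` -/
  w0 : X ≃ₗ[ℤ] X
  longest : R.IsLongest black w0
  τ_black : τ '' black = black
  τ_w0 : ∀ k ∈ black, R.α (τ k) = - w0 (R.α k)
  /-- `⟨ρ_•^∨, αⱼ⟩ ∈ ℤ`, where `2ρ_•^∨` is the sum of the positive coroots of `I_•` -/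
  rho : ∀ j, j ∉ black → τ j = j →
    Even (R.pair (∑ᶠ y ∈ R.posCoroots black, y) (R.α j))

/-! ### The ground field `𝕂(q)` and `q`-numbers -/

section qnumbers

variable (𝕜 : Type*) [Field 𝕜]

/-- `qᵢ = q ^ εᵢ` in `𝕂(q)`, with `q = RatFunc.X`. -/
def qi (i : I) : RatFunc 𝕜 := (RatFunc.X : RatFunc 𝕜) ^ R.eps i

/-- `[n]ᵢ`. -/
def qint (i : I) (n : ℤ) : RatFunc 𝕜 :=
  (R.qi 𝕜 i ^ n - R.qi 𝕜 i ^ (-n)) / (R.qi 𝕜 i - (R.qi 𝕜 i)⁻¹)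

/-- `[m]ᵢ!`. -/
def qfact (i : I) (m : ℕ) : RatFunc 𝕜 := ∏ l ∈ Finset.range m, R.qint 𝕜 i (l + 1)

/-- The `q`-binomial coefficient `[n][n-1]⋯[n-d+1] / [d]!` at `qᵢ`. -/
def qbinom (i : I) (n : ℤ) (d : ℕ) : RatFunc 𝕜 :=
  (∏ l ∈ Finset.range d, R.qint 𝕜 i (n - l)) / R.qfact 𝕜 i d

end qnumbers

/-! ### The Drinfeld double -/

/-- The generators `Eᵢ`, `Fᵢ`, `K_h`, `K'_h` of the Drinfeld double. -/
inductive Gen (I Y : Type*)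
  | E (i : I)
  | F (i : I)
  | K (y : Y)
  | Kp (y : Y)

section double

variable (𝕜 : Type*) [Field 𝕜]

/-- The free `𝕂(q)`-algebra on the generators. -/
abbrev Free (𝕜 I Y : Type*) [Field 𝕜] := FreeAlgebra (RatFunc 𝕜) (Gen I Y)

/-- A generator inside the free algebra. -/
abbrev gen {I Y : Type*} (g : Gen I Y) : Free 𝕜 I Y := FreeAlgebra.ι (RatFunc 𝕜) g

/-- The `q`-Serre polynomial `Sᵢⱼ(x, y) = ∑ᵣ (-1)ʳ [1-aᵢⱼ choose r]ᵢ xʳ y x^(1-aᵢⱼ-r)`. -/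
def serrePoly {A : Type*} [Ring A] [Algebra (RatFunc 𝕜) A] (i j : I) (x y : A) : A :=
  ∑ rs ∈ Finset.HasAntidiagonal.antidiagonal (1 - R.a i j).toNat,
    ((-1) ^ rs.1 * R.qbinom 𝕜 i (1 - R.a i j) rs.1) • (x ^ rs.1 * y * x ^ rs.2)

open Gen in
/-- The defining relations of the Drinfeld double. Here `K` and `K'` are multiplicative in `h`,
so that they are invertible. -/
inductive Rel : Free 𝕜 I Y → Free 𝕜 I Y → Prop
  | K_zero : Rel (gen 𝕜 (K 0)) 1
  | K_add (x y : Y) : Rel (gen 𝕜 (K (x + y))) (gen 𝕜 (K x) * gen 𝕜 (K y))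
  | Kp_zero : Rel (gen 𝕜 (Kp 0)) 1
  | Kp_add (x y : Y) : Rel (gen 𝕜 (Kp (x + y))) (gen 𝕜 (Kp x) * gen 𝕜 (Kp y))
  | K_K (x y : Y) : Rel (gen 𝕜 (K x) * gen 𝕜 (K y)) (gen 𝕜 (K y) * gen 𝕜 (K x))
  | K_Kp (x y : Y) : Rel (gen 𝕜 (K x) * gen 𝕜 (Kp y)) (gen 𝕜 (Kp y) * gen 𝕜 (K x))
  | Kp_Kp (x y : Y) : Rel (gen 𝕜 (Kp x) * gen 𝕜 (Kp y)) (gen 𝕜 (Kp y) * gen 𝕜 (Kp x))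
  | K_E (y : Y) (i : I) : Rel (gen 𝕜 (K y) * gen 𝕜 (E i))
      ((RatFunc.X : RatFunc 𝕜) ^ R.pair y (R.α i) • (gen 𝕜 (E i) * gen 𝕜 (K y)))
  | K_F (y : Y) (i : I) : Rel (gen 𝕜 (K y) * gen 𝕜 (F i))
      ((RatFunc.X : RatFunc 𝕜) ^ (-R.pair y (R.α i)) • (gen 𝕜 (F i) * gen 𝕜 (K y)))
  | Kp_E (y : Y) (i : I) : Rel (gen 𝕜 (Kp y) * gen 𝕜 (E i))
      ((RatFunc.X : RatFunc 𝕜) ^ (-R.pair y (R.α i)) • (gen 𝕜 (E i) * gen 𝕜 (Kp y)))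
  | Kp_F (y : Y) (i : I) : Rel (gen 𝕜 (Kp y) * gen 𝕜 (F i))
      ((RatFunc.X : RatFunc 𝕜) ^ R.pair y (R.α i) • (gen 𝕜 (F i) * gen 𝕜 (Kp y)))
  | E_F_same (i : I) : Rel (gen 𝕜 (E i) * gen 𝕜 (F i) - gen 𝕜 (F i) * gen 𝕜 (E i))
      ((R.qi 𝕜 i - (R.qi 𝕜 i)⁻¹)⁻¹ •
        (gen 𝕜 (K (R.h i)) ^ R.eps i - gen 𝕜 (Kp (R.h i)) ^ R.eps i))
  | E_F_diff (i j : I) (hij : i ≠ j) :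
      Rel (gen 𝕜 (E i) * gen 𝕜 (F j) - gen 𝕜 (F j) * gen 𝕜 (E i)) 0
  | serre_E (i j : I) (hij : i ≠ j) : Rel (R.serrePoly 𝕜 i j (gen 𝕜 (E i)) (gen 𝕜 (E j))) 0
  | serre_F (i j : I) (hij : i ≠ j) : Rel (R.serrePoly 𝕜 i j (gen 𝕜 (F i)) (gen 𝕜 (F j))) 0

/-- The Drinfeld double `Ũ` over `𝕂(q)`. -/
abbrev Double := RingQuot (R.Rel 𝕜)

/-- The image of a generator in `Ũ`. -/
def cls (g : Gen I Y) : R.Double 𝕜 := RingQuot.mkAlgHom (RatFunc 𝕜) (R.Rel 𝕜) (gen 𝕜 g)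

/-- `Eᵢ`. -/
def E (i : I) : R.Double 𝕜 := R.cls 𝕜 (Gen.E i)
/-- `Fᵢ`. -/
def F (i : I) : R.Double 𝕜 := R.cls 𝕜 (Gen.F i)
/-- `K_h`. -/
def K (y : Y) : R.Double 𝕜 := R.cls 𝕜 (Gen.K y)
/-- `K'_h`. -/
def Kp (y : Y) : R.Double 𝕜 := R.cls 𝕜 (Gen.Kp y)
/-- `K̃ᵢ = K_{hᵢ} ^ εᵢ`. -/
def Kt (i : I) : R.Double 𝕜 := R.K 𝕜 (R.h i) ^ R.eps i
/-- `K̃ᵢ' = K'_{hᵢ} ^ εᵢ`. -/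
def Ktp (i : I) : R.Double 𝕜 := R.Kp 𝕜 (R.h i) ^ R.eps i
/-- The inverse of `K̃ᵢ`. -/
def KtInv (i : I) : R.Double 𝕜 := R.K 𝕜 (-R.h i) ^ R.eps i
/-- The inverse of `K̃ᵢ'`. -/
def KtpInv (i : I) : R.Double 𝕜 := R.Kp 𝕜 (-R.h i) ^ R.eps i

/-- The divided power `x ^ m / [m]ᵢ!`. -/
def dp (i : I) (x : R.Double 𝕜) (m : ℕ) : R.Double 𝕜 := (R.qfact 𝕜 i m)⁻¹ • x ^ m

/-! ### The skew derivations `rⱼ` of `Ũ⁺` -/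

/-- `Ũ⁺`, the subalgebra generated by the `Eᵢ`. -/
def UPlus : Subalgebra (RatFunc 𝕜) (R.Double 𝕜) :=
  Algebra.adjoin (RatFunc 𝕜) (Set.range (R.E 𝕜))

/-- The homogeneous component `Ũ⁺_μ`, spanned by the monomials in the `Eᵢ` of weight `μ`;
an element of `ℤ_{≥0} I` is represented as a multiset. -/
def UPlusWt (μ : Multiset I) : Submodule (RatFunc 𝕜) (R.Double 𝕜) :=
  Submodule.span (RatFunc 𝕜)
    {x | ∃ l : List I, (l : Multiset I) = μ ∧ x = (l.map (R.E 𝕜)).prod}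

/-- The properties that determine `rⱼ : Ũ⁺ → Ũ⁺`: `rⱼ(1) = 0`, `rⱼ(Eₖ) = δⱼₖ` and
`rⱼ(x x') = x rⱼ(x') + q^{j · μ'} rⱼ(x) x'` for `x'` homogeneous of weight `μ'`. -/
structure IsSkewDer (j : I) (r : R.UPlus 𝕜 →ₗ[RatFunc 𝕜] R.UPlus 𝕜) : Prop where
  one : r 1 = 0
  same : ∀ x : R.UPlus 𝕜, (x : R.Double 𝕜) = R.E 𝕜 j → r x = 1
  diff : ∀ k, k ≠ j → ∀ x : R.UPlus 𝕜, (x : R.Double 𝕜) = R.E 𝕜 k → r x = 0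
  mul : ∀ (μ : Multiset I) (x x' : R.UPlus 𝕜), (x' : R.Double 𝕜) ∈ R.UPlusWt 𝕜 μ →
    r (x * x') = x * r x' + (RatFunc.X : RatFunc 𝕜) ^ (μ.map (R.form j)).sum • (r x * x')

open scoped Classical in
/-- Lusztig's map `rⱼ`, the unique map as in `IsSkewDer`, applied to an element of `Ũ⁺`
(and `0` outside `Ũ⁺`). -/
def skewDer (j : I) (x : R.Double 𝕜) : R.Double 𝕜 :=
  if h : (∃ r, R.IsSkewDer 𝕜 j r) ∧ x ∈ R.UPlus 𝕜 then
    (h.1.choose ⟨x, h.2⟩ : R.Double 𝕜) else 0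

/-! ### Lusztig's symmetries `T_w = T''_{w,+1}` -/

/-- `T` is Lusztig's symmetry `T''_{k,+1}` of `Ũ`: its values on all generators. -/
structure IsSimpleSymm (k : I) (T : R.Double 𝕜 →ₐ[RatFunc 𝕜] R.Double 𝕜) : Prop where
  K : ∀ y, T (R.K 𝕜 y) = R.K 𝕜 (R.sY k y)
  Kp : ∀ y, T (R.Kp 𝕜 y) = R.Kp 𝕜 (R.sY k y)
  E_same : T (R.E 𝕜 k) = -(R.F 𝕜 k * R.KtpInv 𝕜 k)
  F_same : T (R.F 𝕜 k) = -(R.KtInv 𝕜 k * R.E 𝕜 k)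
  E_diff : ∀ l, l ≠ k → T (R.E 𝕜 l) =
    ∑ rs ∈ Finset.HasAntidiagonal.antidiagonal (-R.a k l).toNat,
      ((-1) ^ rs.1 * R.qi 𝕜 k ^ (-(rs.1 : ℤ))) •
        (R.dp 𝕜 k (R.E 𝕜 k) rs.2 * R.E 𝕜 l * R.dp 𝕜 k (R.E 𝕜 k) rs.1)
  F_diff : ∀ l, l ≠ k → T (R.F 𝕜 l) =
    ∑ rs ∈ Finset.HasAntidiagonal.antidiagonal (-R.a k l).toNat,
      ((-1) ^ rs.1 * R.qi 𝕜 k ^ (rs.1 : ℤ)) •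
        (R.dp 𝕜 k (R.F 𝕜 k) rs.1 * R.F 𝕜 l * R.dp 𝕜 k (R.F 𝕜 k) rs.2)

/-- The family `(T_w)`, `w ∈ W_J`, of Lusztig symmetries: `T_{s_k} = T''_{k,+1}` and
`T_w = T_{s_{k₁}} ⋯ T_{s_{kₗ}}` for every reduced expression `w = s_{k₁} ⋯ s_{kₗ}` in `W_J`. -/
structure IsSymmFamily (J : Set I)
    (T : (X ≃ₗ[ℤ] X) → (R.Double 𝕜 →ₐ[RatFunc 𝕜] R.Double 𝕜)) : Prop where
  simple : ∀ k ∈ J, R.IsSimpleSymm 𝕜 k (T (R.s k))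
  reduced : ∀ l : List I, (∀ k ∈ l, k ∈ J) → R.len J (l.map R.s).prod = l.length →
    T (l.map R.s).prod = (l.map fun k => T (R.s k)).foldr AlgHom.comp (AlgHom.id _ _)

open scoped Classical in
/-- The element `T_w(x)` of `Ũ`, for `w ∈ W_J`. The family `(T_w)`, `w ∈ W_J`, exists and is
unique by Lusztig's theorem for `J` of finite type; the `else` value is a formal default. -/
def lusztigSymm (J : Set I) (w : X ≃ₗ[ℤ] X) (x : R.Double 𝕜) : R.Double 𝕜 :=
  if h : ∃ T, R.IsSymmFamily 𝕜 J T then h.choose w x else 0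

end double

/-! ### `ı`-divided powers in the universal `ı`-quantum group -/

namespace AdmissiblePair

variable {R} (A : R.AdmissiblePair) (𝕜 : Type*) [Field 𝕜]

/-- `T_{w_•}(E_{τ j})`. -/
def TE (j : I) : R.Double 𝕜 := R.lusztigSymm 𝕜 A.black A.w0 (R.E 𝕜 (A.τ j))

open scoped Classical in
/-- The generator `Bⱼ = Fⱼ + T_{w_•}(E_{τ j}) K̃ⱼ'` for `j ∈ I_∘`; by the usual convention
`Bⱼ = Fⱼ` for `j ∈ I_•`. -/
def B (j : I) : R.Double 𝕜 :=
  if j ∈ A.black then R.F 𝕜 j else R.F 𝕜 j + A.TE 𝕜 j * R.Ktp 𝕜 j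

/-- `k̃ⱼ = K̃ⱼ K̃'_{τ j}`. -/
def kt (j : I) : R.Double 𝕜 := R.Kt 𝕜 j * R.Ktp 𝕜 (A.τ j)

/-- The factor `Bⱼ² - qⱼ k̃ⱼ [c]ⱼ²`. -/
def factor (j : I) (c : ℤ) : R.Double 𝕜 :=
  A.B 𝕜 j ^ 2 - (R.qi 𝕜 j * R.qint 𝕜 j c ^ 2) • A.kt 𝕜 j

/-- The `ı`-divided power of parity `t` when `τ j = j = w_• j`. -/
def idpSplit (j : I) (t : ZMod 2) (m : ℕ) : R.Double 𝕜 :=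
  (R.qfact 𝕜 j m)⁻¹ •
    if t = 1 then
      if Odd m then
        A.B 𝕜 j * ((List.range (m / 2)).map fun l => A.factor 𝕜 j (2 * (l + 1) - 1)).prod
      else ((List.range (m / 2)).map fun l => A.factor 𝕜 j (2 * (l + 1) - 1)).prod
    else
      if Odd m then
        A.B 𝕜 j * ((List.range (m / 2)).map fun l => A.factor 𝕜 j (2 * (l + 1))).prod
      else ((List.range (m / 2)).map fun l => A.factor 𝕜 j (2 * (l + 1) - 2)).prod

/-- `Zⱼ = (qⱼ⁻¹ - qⱼ)⁻¹ rⱼ(T_{w_•}(Eⱼ))` when `τ j = j ≠ w_• j`. -/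
def Z (j : I) : R.Double 𝕜 :=
  ((R.qi 𝕜 j)⁻¹ - R.qi 𝕜 j)⁻¹ • R.skewDer 𝕜 j (R.lusztigSymm 𝕜 A.black A.w0 (R.E 𝕜 j))

/-- `bⱼ⁽ⁿ⁾ = ∑ₐ qⱼ^{-a(n-a)} (T_{w_•}(Eⱼ) K̃ⱼ')⁽ᵃ⁾ Fⱼ⁽ⁿ⁻ᵃ⁾` when `τ j = j ≠ w_• j`. -/
def b (j : I) (n : ℕ) : R.Double 𝕜 :=
  ∑ ac ∈ Finset.HasAntidiagonal.antidiagonal n, (R.qi 𝕜 j ^ (-((ac.1 : ℤ) * ac.2))) •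
    (R.dp 𝕜 j (R.lusztigSymm 𝕜 A.black A.w0 (R.E 𝕜 j) * R.Ktp 𝕜 j) ac.1 * R.dp 𝕜 j (R.F 𝕜 j) ac.2)

/-- The `ı`-divided power when `τ j = j ≠ w_• j`:
`bⱼ⁽ⁿ⁾ + q/(q - q⁻¹) ∑_{1 ≤ k ≤ n/2} qⱼ^{k(k+1)/2} (Zⱼ K̃ⱼ K̃ⱼ')⁽ᵏ⁾ bⱼ⁽ⁿ⁻²ᵏ⁾`. -/
def idpNonsplit (j : I) (n : ℕ) : R.Double 𝕜 :=
  A.b 𝕜 j n + ((RatFunc.X : RatFunc 𝕜) / (RatFunc.X - RatFunc.X⁻¹)) •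
    ∑ k ∈ Finset.Icc 1 (n / 2), (R.qi 𝕜 j ^ (k * (k + 1) / 2)) •
      (R.dp 𝕜 j (A.Z 𝕜 j * R.Kt 𝕜 j * R.Ktp 𝕜 j) k * A.b 𝕜 j (n - 2 * k))

open scoped Classical in
/-- The `ı`-divided power `B_{j,t}⁽ⁿ⁾` in all cases; the parity `t` matters only when
`τ j = j = w_• j`. For `j ∈ I_•` it is the usual divided power of `Bⱼ = Fⱼ`. -/
def idp (j : I) (t : ZMod 2) (n : ℕ) : R.Double 𝕜 :=
  if j ∈ A.black ∨ A.τ j ≠ j then R.dp 𝕜 j (A.B 𝕜 j) n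
  else if A.w0 (R.α j) = R.α j then A.idpSplit 𝕜 j t n
  else A.idpNonsplit 𝕜 j n

end AdmissiblePair

end QRootDatum

end

/-! Write S_n(x) for the sum of (-1)^r B_i^(r) x B_i^(s) over r + s = 1 - n a_ij, with the stated
parities. The two families are triangular transforms of each other, by two facts. (a) B_j^(n) = c
B_j^n + a combination of terms w B_j^(n-2k) with c ≠ 0, k ≥ 1, and w commuting with B_i and B_j
(`exists_idp_sub_mem_lowerSpan`). (b) S_n(x) = 0 implies S_(n+2k)(x) = 0 (`serreSum_shift`). Since w
commutes with B_i it leaves the sum, S_n(w B_j^(n-2k)) = w S_n(B_j^(n-2k)), and (b) kills this term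
as soon as S_(n-2k)(B_j^(n-2k)) = 0. So S_n(B_j^(n)) = c S_n(B_j^n) modulo lower degrees, and
induction on n concludes (`serreSum_pow_iff`).

For (b): the ıdivided powers of b = B_i obey b u_r = [r+1] u_(r+1) + θ_r [r] κ u_(r-1), with κ
central and θ_r in {0,1} alternating. The operator x ↦ b²x + xb² - (q^(N+1) + q^(-N-1)) bxb - [N+1]²
κx turns the sum of order N into [N+1][N+2] times the sum of order N + 2
(`serreSum_eq_zero_add_two`), and these quantum integers are nonzero.

For (a): ordinary divided powers need nothing, and the split case follows from the recursion above.
In case (iii) put y = T_{w_•}(E_j) K̃'_j. A relation F_j y = q_j^(-2) y F_j + w makes the b_j^(n)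
satisfy a recursion with coefficient w (`add_mul_binomSeq`). Up to the central factor K̃_j K̃'_j,
both w and the correction term Z_j K̃_j K̃'_j come from elements of weight w_•α_j - α_j in the
algebra generated by the E_k, k ∈ I_•. Such elements commute with F_j because j ∉ I_•, with B_i
because i is orthogonal to I_•, and with y because w_• is an isometry (`commute_longest`). That w
has this shape (`hasHalfComm`) rests on Lusztig's positivity of T_w(E_k) when s_k is not a right
descent of w (`map_E_mem_posPart`), which is reduced to rank two.

Neither the existence of the Lusztig symmetries or skew derivations nor the nonvanishing of the E_k
is needed: the default value 0 satisfies every claim, and a vanishing E_k makes its relation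
trivial. -/

noncomputable section

/-! ### Quantum integers -/

section QuantumIntegers

variable {𝔽 : Type*} [Field 𝔽]

/-- The quantum integer `[n]` at `q`. -/
def qn (q : 𝔽) (n : ℤ) : 𝔽 := (q ^ n - q ^ (-n)) / (q - q⁻¹)

@[simp] theorem qn_zero (q : 𝔽) : qn q 0 = 0 := by simp [qn]

theorem qn_neg (q : 𝔽) (n : ℤ) : qn q (-n) = -qn q n := by
  simp only [qn, neg_neg]; ring

theorem qn_add (q : 𝔽) (hq : q ≠ 0) (a b : ℤ) :
    qn q (a + b) = q ^ b * qn q a + q ^ (-a) * qn q b := by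
  simp only [qn, neg_add, zpow_add₀ hq, zpow_neg]
  have ha := zpow_ne_zero a hq
  have hb := zpow_ne_zero b hq
  field_simp
  ring

/-- With a + b = N + 2, this is what makes all coefficients of the raised Serre sum equal to the
single constant [N+1][N+2]. -/
theorem qn_mul_add_mul (q : 𝔽) (hq : q ≠ 0) (a b : ℤ) :
    qn q (a - 1) * qn q a + qn q (b - 1) * qn q b +
      (q ^ (a + b - 1) + q ^ (-(a + b - 1))) * (qn q a * qn q b) =
      qn q (a + b - 1) * qn q (a + b) := by
  by_cases h : q - q⁻¹ = 0
  · simp [qn, h]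
  simp only [qn, neg_add, zpow_add₀ hq, zpow_neg, neg_sub, zpow_sub₀ hq, zpow_one]
  have ha := zpow_ne_zero a hq
  have hb := zpow_ne_zero b hq
  set d := q - q⁻¹ with hd
  field_simp
  ring

/-- With a + b = N + 1, this cancels the terms containing κ when a Serre sum is raised by two. -/
theorem qn_sq_add_sq (q : 𝔽) (hq : q ≠ 0) (a b : ℤ) :
    qn q a ^ 2 + qn q b ^ 2 + (q ^ (a + b) + q ^ (-(a + b))) * (qn q a * qn q b) =
      qn q (a + b) ^ 2 := by
  by_cases h : q - q⁻¹ = 0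
  · simp [qn, h]
  simp only [qn, neg_add, zpow_add₀ hq, zpow_neg]
  have ha := zpow_ne_zero a hq
  have hb := zpow_ne_zero b hq
  set d := q - q⁻¹ with hd
  field_simp
  ring

/-- The induction step for the structure constants [r][n-r+1] of a quantum sl₂ string. -/
theorem qn_step (q : 𝔽) (hq : q ≠ 0) (r n : ℤ) :
    qn q r * qn q (n - r + 1) + qn q (n - 2 * r) = qn q (r + 1) * qn q (n - r) := by
  by_cases h : q - q⁻¹ = 0
  · simp [qn, h]
  have e : n - 2 * r = n - r - r := by ring
  rw [e]
  simp only [qn, neg_add, zpow_add₀ hq, zpow_neg, neg_sub, zpow_sub₀ hq, zpow_one]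
  have ha := zpow_ne_zero r hq
  have hb := zpow_ne_zero n hq
  have hd : q ^ 2 - 1 ≠ 0 := by
    intro h'
    apply h
    field_simp
    rw [h', mul_zero]
  field_simp
  ring

/-- The condition that no positive quantum integer vanishes. -/
def QGeneric (q : 𝔽) : Prop := q ≠ 0 ∧ ∀ n : ℕ, qn q (n + 1) ≠ 0

/-- The quantum factorial. -/
def qfac (q : 𝔽) (m : ℕ) : 𝔽 := ∏ l ∈ Finset.range m, qn q (l + 1)

theorem qfac_succ (q : 𝔽) (m : ℕ) : qfac q (m + 1) = qfac q m * qn q (m + 1) := by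
  simp [qfac, Finset.prod_range_succ]

@[simp] theorem qfac_zero (q : 𝔽) : qfac q 0 = 1 := by simp [qfac]

theorem QGeneric.qfac_ne_zero {q : 𝔽} (h : QGeneric q) (m : ℕ) : qfac q m ≠ 0 :=
  Finset.prod_ne_zero_iff.2 fun l _ => h.2 l

theorem QGeneric.qn_one {q : 𝔽} (h : QGeneric q) : qn q 1 = 1 := by
  have := h.2 0
  simp only [qn, Nat.cast_zero, zero_add, zpow_one, zpow_neg] at this ⊢
  exact div_self (fun h0 => this (by simp [h0]))

end QuantumIntegers

/-! ### Sums over antidiagonals -/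

section Antidiagonal

open Finset

variable {M : Type*} [AddCommMonoid M]

theorem sum_antidiagonal_shift_right (n : ℕ) (G : ℕ → ℕ → M) (h : G (n + 1) 0 = 0) :
    ∑ x ∈ antidiagonal n, G x.1 (x.2 + 1) = ∑ x ∈ antidiagonal (n + 1), G x.1 x.2 := by
  rw [Finset.Nat.sum_antidiagonal_succ' (f := fun x => G x.1 x.2)]
  simp [h]

theorem sum_antidiagonal_shift_left (n : ℕ) (G : ℕ → ℕ → M) (h : G 0 (n + 1) = 0) :
    ∑ x ∈ antidiagonal n, G (x.1 + 1) x.2 = ∑ x ∈ antidiagonal (n + 1), G x.1 x.2 := by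
  rw [Finset.Nat.sum_antidiagonal_succ (f := fun x => G x.1 x.2)]
  simp [h]

/-- Moves one unit from the first index to the second; the vanishing at both ends means that no
boundary term is left over. -/
theorem sum_antidiagonal_rotate (n : ℕ) (G G' : ℕ → ℕ → M) (h : ∀ b, G 0 b = 0)
    (h' : ∀ a, G' a 0 = 0) (hG : ∀ a b, G (a + 1) b = G' a (b + 1)) :
    ∑ x ∈ antidiagonal n, G x.1 x.2 = ∑ x ∈ antidiagonal n, G' x.1 x.2 := by
  cases n with
  | zero => simp [h, h']
  | succ n =>
    rw [← sum_antidiagonal_shift_left n G (h _), ← sum_antidiagonal_shift_right n G' (h' _)]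
    exact Finset.sum_congr rfl fun x _ => hG _ _

end Antidiagonal

/-! ### Raising the order of a Serre-type relation -/

section SerreShift

open Finset

variable {𝔽 A : Type*} [Field 𝔽] [Ring A] [Algebra 𝔽 A]

/-- The recursion `b uᵣ = [r+1] uᵣ₊₁ + θᵣ [r] κ uᵣ₋₁` of a family of `ı`-divided powers. -/
structure DividedRec (q : 𝔽) (b κ : A) (θ : ℕ → 𝔽) (u : ℕ → A) : Prop where
  step : ∀ r, b * u r = qn q (r + 1) • u (r + 1) + (θ r * qn q r) • (κ * u (r - 1))
  comm : ∀ r, Commute b (u r)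

/-- The sum `∑ (-1)ʳ uᵣ x vₛ` over `r + s = N`. -/
def serreSum (u v : ℕ → A) (N : ℕ) (x : A) : A :=
  ∑ rs ∈ antidiagonal N, (-1 : A) ^ rs.1 * u rs.1 * x * v rs.2

/-- Two applications of the recursion. The κ² term carries θ_(r+1) θ_r = 0, so only u_(r+2) and κ
u_r survive. At r = 0 the truncated index r - 1 is harmless, since its coefficient contains [0]. -/
theorem DividedRec.sq {q : 𝔽} {b κ : A} {θ : ℕ → 𝔽} {u : ℕ → A} (h : DividedRec q b κ θ u)
    (hκb : Commute κ b) (hθ : ∀ r, θ (r + 1) = 1 - θ r) (hθ' : ∀ r, θ r * (1 - θ r) = 0) (r : ℕ) :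
    b * (b * u r) = (qn q (r + 1) * qn q (r + 2)) • u (r + 2) +
      ((1 - θ r) * qn q (r + 1) ^ 2 + θ r * qn q r ^ 2) • (κ * u r) := by
  have h2 := h.step (r + 1)
  rw [Nat.add_sub_cancel, hθ] at h2
  have e : ((r + 1 : ℕ) : ℤ) + 1 = r + 2 := by push_cast; ring
  rw [e] at h2
  rw [h.step r, mul_add, mul_smul_comm, mul_smul_comm, h2, ← mul_assoc b κ, ← hκb.eq, mul_assoc]
  rcases r with _ | r
  · simp only [Nat.cast_zero, qn_zero, mul_zero, zero_smul, add_zero, zero_add, Nat.cast_one,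
      smul_add, smul_smul]
    congr 2
    ring
  · have h0 := h.step r
    have h3 : θ (r + 1) * θ r = 0 := by rw [hθ, mul_comm]; exact hθ' r
    rw [Nat.add_sub_cancel, h0, mul_add, smul_add, smul_add, mul_smul_comm, mul_smul_comm,
      smul_smul, smul_smul, smul_smul, smul_smul]
    have e2 : θ (r + 1) * qn q ((r + 1 : ℕ) : ℤ) * (θ r * qn q r) = 0 := by
      linear_combination (qn q ((r + 1 : ℕ) : ℤ) * qn q r) * h3
    rw [e2, zero_smul, add_zero, add_assoc, ← add_smul]
    congr 2
    push_cast
    ring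

theorem neg_one_pow_smul_mul {u x v : A} (r : ℕ) :
    (-1 : A) ^ r * u * x * v = (-1 : 𝔽) ^ r • (u * x * v) := by
  rcases Nat.even_or_odd r with h | h <;> simp [h.neg_one_pow]

/-- Apply b²x + xb² - c bxb - [N+1]² κx with c = q^(N+1) + q^(-N-1) to the vanishing sum of order N.
After reindexing, the κ terms cancel and what remains is [N+1][N+2] times the sum of order N + 2. -/
theorem serreSum_eq_zero_add_two {q : 𝔽} (hq : QGeneric q) {b κ : A} {θ θ' : ℕ → 𝔽} {u v : ℕ → A}
    (hu : DividedRec q b κ θ u) (hv : DividedRec q b κ θ' v) (hκ : ∀ y : A, Commute κ y)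
    (hθ : ∀ r, θ (r + 1) = 1 - θ r) (hθ0 : ∀ r, θ r * (1 - θ r) = 0)
    (hθ' : ∀ r, θ' (r + 1) = 1 - θ' r) (hθ0' : ∀ r, θ' r * (1 - θ' r) = 0)
    (N : ℕ) (hθθ : ∀ r s, r + s = N → θ' s = 1 - θ r) {x : A} (hx : serreSum u v N x = 0) :
    serreSum u v (N + 2) x = 0 := by
  set g : ℕ → ℕ → A := fun r s => (-1 : 𝔽) ^ r • (u r * x * v s) with hg
  have hsum : ∀ N, serreSum u v N x = ∑ rs ∈ antidiagonal N, g rs.1 rs.2 := fun N =>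
    Finset.sum_congr rfl fun rs _ => neg_one_pow_smul_mul rs.1
  set c : 𝔽 := q ^ ((N : ℤ) + 1) + q ^ (-((N : ℤ) + 1)) with hc
  have hpt : ∀ r s : ℕ, r + s = N →
      b * (b * g r s) + g r s * b * b - c • (b * g r s * b) -
        (qn q (N + 1) ^ 2) • (κ * g r s) =
      (qn q (r + 1) * qn q (r + 2)) • g (r + 2) s + (qn q (s + 1) * qn q (s + 2)) • g r (s + 2) +
      (c * (qn q (r + 1) * qn q (s + 1))) • g (r + 1) (s + 1) +
      (((1 - θ r) * qn q (r + 1) ^ 2 + θ r * qn q r ^ 2 + θ r * qn q (s + 1) ^ 2 +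
        (1 - θ r) * qn q s ^ 2 - qn q (N + 1) ^ 2) • (κ * g r s) +
      ((c * (θ r * qn q r * qn q (s + 1))) • (κ * g (r - 1) (s + 1)) +
      (c * ((1 - θ r) * qn q (r + 1) * qn q s)) • (κ * g (r + 1) (s - 1)))) := by
    intro r s hrs
    have h1 : b * (b * (u r * x * v s)) = (b * (b * u r)) * x * v s := by simp only [mul_assoc]
    have h2 : u r * x * v s * b * b = u r * x * (b * (b * v s)) := by
      rw [mul_assoc _ b, mul_assoc _ (v s), ← mul_assoc (v s), ← (hv.comm s).eq, mul_assoc b,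
        ← (hv.comm s).eq]
    have h3 : b * (u r * x * v s) * b = (b * u r) * x * (b * v s) := by
      rw [(hv.comm s).eq]; simp only [mul_assoc]
    have hθs := hθθ r s hrs
    have hκ' : ∀ y z : A, y * (κ * z) = κ * (y * z) := fun y z => by
      rw [← mul_assoc, ← (hκ y).eq, mul_assoc]
    rw [show g r s = (-1 : 𝔽) ^ r • (u r * x * v s) from rfl]
    simp only [mul_smul_comm, smul_mul_assoc]
    rw [h1, h2, h3, hu.sq (hκ b) hθ hθ0, hv.sq (hκ b) hθ' hθ0', hu.step, hv.step, hθs]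
    have hr : ∀ y : A, (θ r * qn q r) • ((-1 : 𝔽) ^ (r - 1) • y) =
        -((θ r * qn q r * (-1 : 𝔽) ^ r) • y) := by
      intro y
      rcases r with _ | r
      · simp
      · rw [Nat.add_sub_cancel, pow_succ, smul_smul, ← neg_smul]; congr 1; ring
    have hg1 : (c * (θ r * qn q r * qn q (s + 1))) • (κ * g (r - 1) (s + 1)) =
        -((c * (θ r * qn q r * qn q (s + 1)) * (-1) ^ r) •
          (κ * (u (r - 1) * x * v (s + 1)))) := by
      rw [show c * (θ r * qn q r * qn q (s + 1)) = (c * qn q (s + 1)) * (θ r * qn q r) by ring,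
        mul_smul, hg, mul_smul_comm, hr, smul_neg, smul_smul, mul_assoc (c * qn q (s + 1))]
    rw [hg1]
    simp only [hg, pow_succ, mul_add, add_mul, mul_smul_comm, smul_mul_assoc, smul_add,
      smul_smul, mul_assoc, hκ']
    -- The only κ² term comes from bxb and has coefficient θ_r θ'_s = θ_r (1 - θ_r).
    have h4 : θ r * (1 - θ r) = 0 := hθ0 r
    have h5 : (1 - (1 - θ r)) = θ r := by ring
    simp only [h5]
    have h6 : ∀ y : A, (c * ((-1) ^ r * ((1 - θ r) * (qn q s * (θ r * qn q r))))) • y = 0 := by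
      intro y
      rw [show c * ((-1) ^ r * ((1 - θ r) * (qn q s * (θ r * qn q r)))) =
        c * (-1) ^ r * qn q s * qn q r * (θ r * (1 - θ r)) by ring, h4, mul_zero, zero_smul]
    rw [h6]
    module
  have hQ : (qn q (N + 1) * qn q (N + 2)) • serreSum u v (N + 2) x = 0 := by
    have hS : b * (b * serreSum u v N x) + serreSum u v N x * b * b -
        c • (b * serreSum u v N x * b) - (qn q (N + 1) ^ 2) • (κ * serreSum u v N x) = 0 := by
      simp [hx]
    rw [hsum N] at hS
    simp only [Finset.mul_sum, Finset.sum_mul, Finset.smul_sum] at hS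
    rw [← Finset.sum_add_distrib, ← Finset.sum_sub_distrib, ← Finset.sum_sub_distrib] at hS
    rw [Finset.sum_congr rfl fun rs hrs => hpt rs.1 rs.2 (by simpa using hrs)] at hS
    simp only [Finset.sum_add_distrib] at hS
    -- The two off-diagonal families of κ terms are moved to the index (r, s), so that all κ terms
    -- can be collected.
    rw [sum_antidiagonal_rotate N
      (fun r s => (c * (θ r * qn q r * qn q (s + 1))) • (κ * g (r - 1) (s + 1)))
      (fun r s => (c * ((1 - θ r) * qn q (r + 1) * qn q s)) • (κ * g r s)) (by simp) (by simp)
      (fun r s => by simp [hθ]),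
      ← sum_antidiagonal_rotate N
      (fun r s => (c * (θ r * qn q r * qn q (s + 1))) • (κ * g r s))
      (fun r s => (c * ((1 - θ r) * qn q (r + 1) * qn q s)) • (κ * g (r + 1) (s - 1)))
      (by simp) (by simp) (fun r s => by simp [hθ]),
      ← Finset.sum_add_distrib, ← Finset.sum_add_distrib, ← Finset.sum_add_distrib,
      ← Finset.sum_add_distrib] at hS
    -- As θ_r weighs the two cases, the coefficient is a combination of `qn_sq_add_sq` at (r, s+1)
    -- and at (r+1, s).
    have hE : ∀ x ∈ antidiagonal N,
        ((1 - θ x.1) * qn q (x.1 + 1) ^ 2 + θ x.1 * qn q x.1 ^ 2 + θ x.1 * qn q (x.2 + 1) ^ 2 +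
        (1 - θ x.1) * qn q x.2 ^ 2 - qn q (N + 1) ^ 2) • (κ * g x.1 x.2) +
        ((c * ((1 - θ x.1) * qn q (x.1 + 1) * qn q x.2)) • (κ * g x.1 x.2) +
        (c * (θ x.1 * qn q x.1 * qn q (x.2 + 1))) • (κ * g x.1 x.2)) = 0 := by
      rintro ⟨r, s⟩ hrs
      have hrs' : r + s = N := by simpa using hrs
      have e1 := qn_sq_add_sq q hq.1 r (s + 1)
      have e2 := qn_sq_add_sq q hq.1 (r + 1) s
      have hN : (N : ℤ) = r + s := by rw [← hrs']; push_cast; ring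
      rw [show (r : ℤ) + (s + 1) = N + 1 by rw [hN]; ring] at e1
      rw [show (r : ℤ) + 1 + s = N + 1 by rw [hN]; ring] at e2
      rw [← hc] at e1 e2
      rw [← add_smul, ← add_smul]
      convert zero_smul 𝔽 (κ * g r s) using 2
      linear_combination θ r * e1 + (1 - θ r) * e2
    rw [Finset.sum_eq_zero hE, add_zero] at hS
    -- The three remaining families are extended to r + s = N + 2; the added boundary terms contain
    -- [0].
    have s1 := sum_antidiagonal_shift_left N
      (fun r s => (qn q r * qn q (r + 1)) • g (r + 1) s) (by simp)
    have s1' := sum_antidiagonal_shift_left (N + 1)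
      (fun r s => (qn q (r - 1) * qn q r) • g r s) (by simp)
    have s2 := sum_antidiagonal_shift_right N
      (fun r s => (qn q s * qn q (s + 1)) • g r (s + 1)) (by simp)
    have s2' := sum_antidiagonal_shift_right (N + 1)
      (fun r s => (qn q (s - 1) * qn q s) • g r s) (by simp)
    have s3 := sum_antidiagonal_shift_left N
      (fun r s => (c * (qn q r * qn q (s + 1))) • g r (s + 1)) (by simp)
    have s3' := sum_antidiagonal_shift_right (N + 1)
      (fun r s => (c * (qn q r * qn q s)) • g r s) (by simp)
    simp only [Nat.cast_add, Nat.cast_one, add_sub_cancel_right, add_assoc, one_add_one_eq_two,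
      Finset.sum_add_distrib] at s1 s1' s2 s2' s3 s3' hS
    rw [s1, s1', s2, s2', s3, s3', ← Finset.sum_add_distrib, ← Finset.sum_add_distrib] at hS
    rw [hsum, Finset.smul_sum, ← hS]
    refine Finset.sum_congr rfl ?_
    rintro ⟨r, s⟩ hrs
    have hrs' : r + s = N + 2 := by simpa using hrs
    have e1 := qn_mul_add_mul q hq.1 r s
    have hN : (r : ℤ) + s = N + 2 := by exact_mod_cast hrs'
    rw [hN, show (N : ℤ) + 2 - 1 = N + 1 by ring, ← hc] at e1
    rw [← e1]
    module
  exact (smul_eq_zero.1 hQ).resolve_left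
    (mul_ne_zero (hq.2 N) (by have := hq.2 (N + 1); push_cast at this; rwa [add_assoc] at this))

end SerreShift

noncomputable section

/-! ### Divided powers and ladder recursions -/

section Ladder

open Finset

variable {𝔽 A : Type*} [Field 𝔽] [Ring A] [Algebra 𝔽 A]

/-- The divided power `x ^ m / [m]!`. -/
def dpow (q : 𝔽) (x : A) (m : ℕ) : A := (qfac q m)⁻¹ • x ^ m

@[simp] theorem dpow_zero (q : 𝔽) (x : A) : dpow q x 0 = 1 := by simp [dpow]

theorem mul_dpow {q : 𝔽} (hq : QGeneric q) (x : A) (m : ℕ) :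
    x * dpow q x m = qn q (m + 1) • dpow q x (m + 1) := by
  have h1 := hq.qfac_ne_zero m
  have h2 := hq.2 m
  rw [dpow, dpow, mul_smul_comm, ← pow_succ', smul_smul, qfac_succ]
  congr 1
  field_simp

theorem commute_dpow (q : 𝔽) {x y : A} (h : Commute x y) (m : ℕ) : Commute x (dpow q y m) :=
  (h.pow_right m).smul_right _

theorem dpow_mul {q : 𝔽} (hq : QGeneric q) (x : A) (m : ℕ) :
    dpow q x m * x = qn q (m + 1) • dpow q x (m + 1) := by
  rw [← mul_dpow hq, (commute_dpow q (Commute.refl x) m).eq]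

/-- The span of the elements `w b ^ m` with `w ∈ C` and `m = n - 2, n - 4, …`. -/
def lowerSpan (C : Subalgebra 𝔽 A) (b : A) (n : ℕ) : Submodule 𝔽 A :=
  Submodule.span 𝔽 {y | ∃ w ∈ C, ∃ m k : ℕ, m + 2 * (k + 1) = n ∧ y = w * b ^ m}

theorem mul_mem_lowerSpan_of_mem (C : Subalgebra 𝔽 A) (b : A) {w : A} (hw : w ∈ C) {n : ℕ} {y : A}
    (hy : y ∈ lowerSpan C b n) (k : ℕ) : w * y ∈ lowerSpan C b (n + 2 * k) := by
  induction hy using Submodule.span_induction with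
  | mem y hy =>
    obtain ⟨w', hw', m, l, hml, rfl⟩ := hy
    exact Submodule.subset_span ⟨w * w', C.mul_mem hw hw', m, l + k, by omega, by rw [mul_assoc]⟩
  | zero => simp
  | add y z _ _ hy hz => rw [mul_add]; exact add_mem hy hz
  | smul c y _ hy => rw [mul_smul_comm]; exact Submodule.smul_mem _ _ hy

theorem mul_mem_lowerSpan_succ (C : Subalgebra 𝔽 A) (b : A) (hb : ∀ w ∈ C, Commute b w) {n : ℕ}
    {y : A} (hy : y ∈ lowerSpan C b n) : b * y ∈ lowerSpan C b (n + 1) := by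
  induction hy using Submodule.span_induction with
  | mem y hy =>
    obtain ⟨w', hw', m, l, hml, rfl⟩ := hy
    refine Submodule.subset_span ⟨w', hw', m + 1, l, by omega, ?_⟩
    rw [← mul_assoc, (hb w' hw').eq, mul_assoc, pow_succ']
  | zero => simp
  | add y z _ _ hy hz => rw [mul_add]; exact add_mem hy hz
  | smul c y _ hy => rw [mul_smul_comm]; exact Submodule.smul_mem _ _ hy

/-- Degree drops in steps of two, so the leading term c b^n itself becomes a lower term in degree n
+ 2(k+1). -/
theorem mul_mem_lowerSpan_of_sub_mem (C : Subalgebra 𝔽 A) (b : A) {w : A} (hw : w ∈ C) {n : ℕ}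
    {y : A} {c : 𝔽} (hy : y - c • b ^ n ∈ lowerSpan C b n) (k : ℕ) :
    w * y ∈ lowerSpan C b (n + 2 * (k + 1)) := by
  have h := mul_mem_lowerSpan_of_mem C b hw hy (k + 1)
  rw [mul_sub] at h
  have h' : w * c • b ^ n ∈ lowerSpan C b (n + 2 * (k + 1)) := by
    rw [mul_smul_comm]
    exact Submodule.smul_mem _ _ (Submodule.subset_span ⟨w, hw, n, k, rfl, rfl⟩)
  simpa using add_mem h h'

/-- Solve the recursion for D (n+1): the leading coefficient is divided by [n+1], and w_n D_(n-1)
has degree two less. The assumption w 0 = 0 covers the truncated index at n = 0. -/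
theorem ladder_sub_mem_lowerSpan {q : 𝔽} (hq : QGeneric q) (C : Subalgebra 𝔽 A) {b : A}
    (hb : ∀ w ∈ C, Commute b w) {D w : ℕ → A} (hD : D 0 = 1) (hw : ∀ n, w n ∈ C) (hw0 : w 0 = 0)
    (hstep : ∀ n, b * D n = qn q (n + 1) • D (n + 1) + w n * D (n - 1)) (n : ℕ) :
    D n - (qfac q n)⁻¹ • b ^ n ∈ lowerSpan C b n := by
  have key : ∀ n, (b * D n - (qfac q n)⁻¹ • b ^ (n + 1) ∈ lowerSpan C b (n + 1)) →
      (w n * D (n - 1) ∈ lowerSpan C b (n + 1)) →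
      D (n + 1) - (qfac q (n + 1))⁻¹ • b ^ (n + 1) ∈ lowerSpan C b (n + 1) := by
    intro n h1 h2
    have h3 := Submodule.smul_mem _ (qn q (n + 1))⁻¹ (sub_mem h1 h2)
    convert h3 using 1
    have hn := hq.2 n
    rw [hstep n, qfac_succ, mul_inv, add_sub_assoc, add_sub_assoc,
      show w n * D (n - 1) - (qfac q n)⁻¹ • b ^ (n + 1) - w n * D (n - 1) =
        -((qfac q n)⁻¹ • b ^ (n + 1)) by abel, smul_add, smul_smul, inv_mul_cancel₀ hn, one_smul,
      smul_neg, smul_smul, mul_comm (qfac q n)⁻¹, sub_eq_add_neg]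
  have hmul : ∀ n, D n - (qfac q n)⁻¹ • b ^ n ∈ lowerSpan C b n →
      b * D n - (qfac q n)⁻¹ • b ^ (n + 1) ∈ lowerSpan C b (n + 1) := by
    intro n h
    have := mul_mem_lowerSpan_succ C b hb h
    rwa [mul_sub, mul_smul_comm, ← pow_succ'] at this
  induction n using Nat.strong_induction_on with
  | _ n ih =>
    rcases n with _ | _ | n
    · simp [hD]
    · exact key 0 (hmul 0 (ih 0 (by omega))) (by simp [hw0])
    · refine key (n + 1) (hmul _ (ih _ (by omega))) ?_
      exact mul_mem_lowerSpan_of_sub_mem C b (hw _) (ih n (by omega)) 0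

/-- The iterated `q`-commutators `x₀ = x`, `xₘ₊₁ = e xₘ - q ^ (2m - n) xₘ e`. -/
def qad (q : 𝔽) (n : ℤ) (e x : A) : ℕ → A
  | 0 => x
  | m + 1 => e * qad q n e x m - q ^ (2 * (m : ℤ) - n) • (qad q n e x m * e)

/-- At m = n the exponent r(m-1-n) is -r, which is Lusztig's formula for T(E_l). The induction is
the q-Pascal rule [r+s] = q^s [r] + q^(-r) [s]. -/
theorem qad_eq_sum {q : 𝔽} (hq : QGeneric q) (n : ℤ) (e x : A) (m : ℕ) :
    qad q n e x m = qfac q m • ∑ rs ∈ antidiagonal m,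
      ((-1) ^ rs.1 * q ^ ((rs.1 : ℤ) * (m - 1 - n))) • (dpow q e rs.2 * x * dpow q e rs.1) := by
  induction m with
  | zero => simp [qad]
  | succ m ih =>
    rw [qad, ih, qfac_succ, mul_smul, mul_smul_comm, smul_mul_assoc, smul_comm (q ^ _) (qfac q m),
      ← smul_sub]
    congr 1
    rw [Finset.mul_sum, Finset.sum_mul, Finset.smul_sum, Finset.smul_sum]
    set G : ℕ → ℕ → A := fun r s => dpow q e s * x * dpow q e r with hG
    have h1 := sum_antidiagonal_shift_right m
      (fun r s => ((-1) ^ r * q ^ ((r : ℤ) * (m - 1 - n)) * qn q s) • G r s) (by simp)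
    have h2 := sum_antidiagonal_shift_left m
      (fun r s => (q ^ (2 * (m : ℤ) - n) * ((-1) ^ (r - 1) * q ^ ((r - 1 : ℤ) * (m - 1 - n)) *
        qn q r)) • G r s) (by simp)
    have e1 : ∀ r s : ℕ, e * ((-1) ^ r * q ^ ((r : ℤ) * (m - 1 - n))) • G r s =
        ((-1) ^ r * q ^ ((r : ℤ) * (m - 1 - n)) * qn q (s + 1 : ℕ)) • G r (s + 1) := by
      intro r s
      rw [mul_smul_comm, hG]
      simp only
      rw [← mul_assoc, ← mul_assoc, mul_dpow hq, smul_mul_assoc, smul_mul_assoc, smul_smul]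
      push_cast; rfl
    have e2 : ∀ r s : ℕ, q ^ (2 * (m : ℤ) - n) • (((-1) ^ r * q ^ ((r : ℤ) * (m - 1 - n))) •
        G r s * e) = (q ^ (2 * (m : ℤ) - n) * ((-1) ^ (r + 1 - 1) *
          q ^ (((r + 1 : ℕ) - 1 : ℤ) * (m - 1 - n)) * qn q (r + 1 : ℕ))) • G (r + 1) s := by
      intro r s
      rw [smul_mul_assoc, hG]
      simp only
      rw [mul_assoc _ _ e, dpow_mul hq, mul_smul_comm, smul_smul, smul_smul]
      push_cast
      rw [add_sub_cancel_right, mul_assoc, mul_assoc, mul_assoc]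
    rw [(Finset.sum_congr rfl fun rs _ => e1 rs.1 rs.2).trans h1,
      (Finset.sum_congr rfl fun rs _ => e2 rs.1 rs.2).trans h2, ← Finset.sum_sub_distrib]
    refine Finset.sum_congr rfl ?_
    rintro ⟨r, s⟩ hrs
    have hrs' : r + s = m + 1 := by simpa using hrs
    have hm : (m : ℤ) = s + r - 1 := by omega
    rw [← sub_smul, smul_smul]
    simp only
    congr 1
    have ha := qn_add q hq.1 r s
    rw [show (m : ℤ) + 1 = r + s by omega, ha]
    rcases r with _ | r
    · simp
    · simp only [Nat.add_sub_cancel, pow_succ]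
      have z1 : q ^ (2 * (m : ℤ) - n) * q ^ (((r + 1 : ℕ) - 1 : ℤ) * (m - 1 - n)) =
          q ^ (((r + 1 : ℕ) : ℤ) * (((m + 1 : ℕ) : ℤ) - 1 - n)) * q ^ (s : ℤ) := by
        rw [← zpow_add₀ hq.1, ← zpow_add₀ hq.1]
        congr 1
        push_cast at hm ⊢
        rw [hm]
        ring
      have z2 : q ^ (((r + 1 : ℕ) : ℤ) * (m - 1 - n)) =
          q ^ (((r + 1 : ℕ) : ℤ) * (((m + 1 : ℕ) : ℤ) - 1 - n)) * q ^ (-((r + 1 : ℕ) : ℤ)) := by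
        rw [← zpow_add₀ hq.1]
        congr 1
        push_cast at hm ⊢
        ring
      linear_combination (-1) ^ r * -1 * qn q s * z2 - (-1) ^ r * qn q ((r + 1 : ℕ) : ℤ) * z1

/-- The elements `∑ q ^ (-ac) y⁽ᵃ⁾ f⁽ᶜ⁾` over `a + c = n`. -/
def binomSeq (q : 𝔽) (y f : A) (n : ℕ) : A :=
  ∑ ac ∈ antidiagonal n, q ^ (-((ac.1 : ℤ) * ac.2)) • (dpow q y ac.1 * dpow q f ac.2)

/-- Moving f through y^a yields one w at each position; as w commutes with y these add up to a
quantum integer, absorbed by the divided power. -/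
theorem mul_dpow_of_qcommute {q : 𝔽} (hq : QGeneric q) {f y w : A}
    (h : f * y = q ^ (-2 : ℤ) • (y * f) + w) (hwy : Commute w y) (a : ℕ) :
    f * dpow q y a = q ^ (-2 * (a : ℤ)) • (dpow q y a * f) +
      (if a = 0 then 0 else q ^ (1 - (a : ℤ))) • (w * dpow q y (a - 1)) := by
  induction a with
  | zero => simp
  | succ a ih =>
    have hn := hq.2 a
    have h3 : qn q (a + 1) • (f * dpow q y (a + 1)) = q ^ (-2 * ((a : ℤ) + 1)) •
        (qn q (a + 1) • (dpow q y (a + 1) * f)) + (qn q (a + 1) * q ^ (-(a : ℤ))) •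
          (w * dpow q y a) := by
      rw [← smul_mul_assoc _ _ f, ← mul_smul_comm _ f, ← mul_dpow hq, ← mul_assoc, h, add_mul,
        smul_mul_assoc, mul_assoc y, ih, mul_add, mul_smul_comm, smul_add, smul_smul, add_assoc,
        mul_smul_comm, ← mul_assoc y w, ← hwy.eq, mul_assoc w, mul_assoc y]
      congr 1
      · rw [← zpow_add₀ hq.1]; congr 2; ring
      · have ha := qn_add q hq.1 1 a
        rw [hq.qn_one, add_comm (1 : ℤ)] at ha
        rcases a with _ | a
        · simp [hq.qn_one]
        · have hadd : ∀ (c : 𝔽) (z : A), c • z + z = (c + 1) • z := fun c z => by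
            rw [add_smul, one_smul]
          simp only [Nat.succ_ne_zero, if_false, Nat.add_sub_cancel]
          rw [mul_dpow hq, mul_smul_comm, smul_smul, smul_smul, hadd, ha]
          congr 1
          have e1 : q ^ (-2 : ℤ) * q ^ (1 - ((a + 1 : ℕ) : ℤ)) =
            q ^ (-1 : ℤ) * q ^ (-((a + 1 : ℕ) : ℤ)) := by
            rw [← zpow_add₀ hq.1, ← zpow_add₀ hq.1]; congr 1; ring
          have e2 : q ^ (((a + 1 : ℕ) : ℤ)) * q ^ (-((a + 1 : ℕ) : ℤ)) = 1 := by
            rw [← zpow_add₀ hq.1]; simp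
          rw [e1]
          push_cast at e2 ⊢
          linear_combination -e2
    have h4 := congrArg (fun z => (qn q (a + 1))⁻¹ • z) h3
    simp only [smul_add, smul_smul, inv_mul_cancel₀ hn, one_smul] at h4
    rw [h4]
    congr 1
    · congr 1
      push_cast
      field_simp
    · simp [hn]

/-- For w = 0 this is the q-binomial theorem for the q-commuting pair y, f. The term w contributes a
multiple of the same sequence two degrees lower, since the powers of q combine to q^(1-n)
independently of the summand. -/
theorem add_mul_binomSeq {q : 𝔽} (hq : QGeneric q) {f y w : A}
    (h : f * y = q ^ (-2 : ℤ) • (y * f) + w) (hwy : Commute w y) (n : ℕ) :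
    (f + y) * binomSeq q y f n = qn q (n + 1) • binomSeq q y f (n + 1) +
      ((if n = 0 then 0 else q ^ (1 - (n : ℤ))) • w) * binomSeq q y f (n - 1) := by
  set G : ℕ → ℕ → A := fun a c => dpow q y a * dpow q f c with hG
  have e1 : ∀ a c : ℕ, y * q ^ (-((a : ℤ) * c)) • G a c =
      (q ^ (-(((a + 1 : ℕ) - 1 : ℤ) * c)) * qn q (a + 1 : ℕ)) • G (a + 1) c := by
    intro a c
    rw [mul_smul_comm, hG]
    simp only
    rw [← mul_assoc, mul_dpow hq, smul_mul_assoc, smul_smul]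
    push_cast
    rw [add_sub_cancel_right]
  have e2 : ∀ a c : ℕ, f * q ^ (-((a : ℤ) * c)) • G a c =
      (q ^ (-((a : ℤ) * ((c + 1 : ℕ) - 1 : ℤ)) - 2 * a) * qn q (c + 1 : ℕ)) • G a (c + 1) +
      (q ^ (-((a : ℤ) * c)) * (if a = 0 then 0 else q ^ (1 - (a : ℤ)))) • (w * G (a - 1) c) := by
    intro a c
    rw [mul_smul_comm, hG]
    simp only
    rw [← mul_assoc, mul_dpow_of_qcommute hq h hwy, add_mul, smul_mul_assoc, smul_mul_assoc,
      mul_assoc _ f, mul_dpow hq, mul_smul_comm, smul_add, smul_smul, smul_smul, smul_smul,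
      mul_assoc w]
    congr 2
    push_cast
    rw [add_sub_cancel_right, ← zpow_add₀ hq.1]
    congr 2
  have h1 := sum_antidiagonal_shift_left n
    (fun a c => (q ^ (-(((a : ℤ) - 1) * c)) * qn q a) • G a c) (by simp)
  have h2 := sum_antidiagonal_shift_right n
    (fun a c => (q ^ (-((a : ℤ) * ((c : ℤ) - 1)) - 2 * a) * qn q c) • G a c) (by simp)
  have h3 : ∑ x ∈ antidiagonal n, (q ^ (-((x.1 : ℤ) * x.2)) *
      (if x.1 = 0 then 0 else q ^ (1 - (x.1 : ℤ)))) • (w * G (x.1 - 1) x.2) =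
      ((if n = 0 then 0 else q ^ (1 - (n : ℤ))) • w) * binomSeq q y f (n - 1) := by
    rcases n with _ | n
    · simp
    · rw [Finset.Nat.sum_antidiagonal_succ]
      simp only [if_true, mul_zero, zero_smul, zero_add, Nat.succ_ne_zero, if_false,
        Nat.add_sub_cancel]
      rw [binomSeq, Finset.mul_sum]
      refine Finset.sum_congr rfl ?_
      rintro ⟨a, c⟩ hac
      have hac' : a + c = n := by simpa using hac
      rw [smul_mul_smul_comm, ← zpow_add₀ hq.1, ← zpow_add₀ hq.1, ← hac']
      congr 2
      push_cast
      ring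
  have E1 := (Finset.sum_congr rfl fun (x : ℕ × ℕ) _ => e1 x.1 x.2).trans h1
  have E2 := (Finset.sum_congr rfl fun (x : ℕ × ℕ) (_ : x ∈ antidiagonal n) => e2 x.1 x.2)
  rw [Finset.sum_add_distrib, h2, h3] at E2
  have hb : binomSeq q y f n = ∑ ac ∈ antidiagonal n, q ^ (-((ac.1 : ℤ) * ac.2)) • G ac.1 ac.2 :=
    rfl
  have hb' : binomSeq q y f (n + 1) =
    ∑ ac ∈ antidiagonal (n + 1), q ^ (-((ac.1 : ℤ) * ac.2)) • G ac.1 ac.2 := rfl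
  rw [add_mul, hb, Finset.mul_sum, Finset.mul_sum, E1, E2, hb', Finset.smul_sum,
    add_right_comm, ← Finset.sum_add_distrib]
  congr 1
  refine Finset.sum_congr rfl ?_
  rintro ⟨a, c⟩ hac
  have hac' : a + c = n + 1 := by simpa using hac
  rw [← add_smul, smul_smul]
  simp only
  congr 1
  rw [show (n : ℤ) + 1 = a + c by omega, qn_add q hq.1, add_mul, add_comm]
  have z1 : q ^ (-(((a : ℤ) - 1) * c)) = q ^ (c : ℤ) * q ^ (-((a : ℤ) * c)) := by
    rw [← zpow_add₀ hq.1]; congr 1; ring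
  have z2 : q ^ (-((a : ℤ) * ((c : ℤ) - 1)) - 2 * a) = q ^ (-(a : ℤ)) * q ^ (-((a : ℤ) * c)) := by
    rw [← zpow_add₀ hq.1]; congr 1; ring
  rw [z1, z2]
  ring

end Ladder

noncomputable section

namespace QRootDatum

variable {I Y X : Type*} [AddCommGroup Y] [AddCommGroup X] (R : QRootDatum I Y X)

/-! ### Reflections -/

theorem s_apply (k : I) (x : X) : R.s k x = x - R.pair (R.h k) x • R.α k := rfl

theorem sY_apply (k : I) (y : Y) : R.sY k y = y - R.pair y (R.α k) • R.h k := rfl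

theorem s_mul_self (k : I) : R.s k * R.s k = 1 := by
  ext x
  exact Module.involutive_reflection (R.a_self k) x

theorem s_α_self (k : I) : R.s k (R.α k) = -R.α k := by
  rw [s_apply, R.a_self]; module

theorem pair_sY (k : I) (y : Y) (x : X) : R.pair (R.sY k y) x = R.pair y (R.s k x) := by
  simp only [s_apply, sY_apply, map_sub, map_smul, LinearMap.sub_apply, LinearMap.smul_apply,
    smul_eq_mul]
  ring

theorem eps_cast (k : I) : 2 * (R.eps k : ℤ) = R.form k k := by
  have h1 := R.form_pos k
  obtain ⟨m, hm⟩ := R.form_even k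
  rw [eps, Int.toNat_of_nonneg (by omega)]
  omega

theorem eps_pos (k : I) : 0 < R.eps k := by
  have h1 := R.form_pos k
  have := R.eps_cast k
  omega

theorem eps_mul_a (k l : I) : (R.eps k : ℤ) * R.a k l = R.form k l := by
  have h1 := R.pair_simple k l
  rw [← R.eps_cast] at h1
  unfold a
  linarith

theorem eps_mul_a_comm (k l : I) : (R.eps k : ℤ) * R.a k l = R.eps l * R.a l k := by
  rw [eps_mul_a, eps_mul_a, R.form_symm]

theorem a_nonpos {k l : I} (h : k ≠ l) : R.a k l ≤ 0 := by
  have h1 := R.eps_mul_a k l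
  have h2 := R.form_nonpos k l h
  have h3 := R.eps_pos k
  by_contra! h4
  have : 0 < (R.eps k : ℤ) * R.a k l := by positivity
  omega

section double

variable {𝔽 : Type*} [Field 𝔽] (v : 𝔽)

/-- `qᵢ = v ^ εᵢ`. -/
def qv (i : I) : 𝔽 := v ^ R.eps i

theorem qv_zpow (k : I) (n : ℤ) : R.qv v k ^ n = v ^ ((R.eps k : ℤ) * n) := by
  rw [qv, zpow_mul, zpow_natCast]

/-- A vanishing [n+1] would make v a root of unity, as ε_k > 0. -/
theorem qv_generic {v : 𝔽} (h0 : v ≠ 0) (h1 : ∀ n : ℕ, n ≠ 0 → v ^ n ≠ 1) (k : I) :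
    QGeneric (R.qv v k) := by
  have hq : R.qv v k ≠ 0 := pow_ne_zero _ h0
  have key : ∀ n : ℕ, R.qv v k ^ ((n : ℤ) + 1) - R.qv v k ^ (-((n : ℤ) + 1)) ≠ 0 := by
    intro n h
    have h2 : R.qv v k ^ ((n : ℤ) + 1) * R.qv v k ^ ((n : ℤ) + 1) = 1 := by
      nth_rewrite 1 [sub_eq_zero.1 h]
      rw [← zpow_add₀ hq]
      simp
    rw [← zpow_add₀ hq, qv_zpow,
      show (R.eps k : ℤ) * (n + 1 + (n + 1)) = ((R.eps k * (n + 1 + (n + 1)) : ℕ) : ℤ) by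
        push_cast; ring, zpow_natCast] at h2
    have := R.eps_pos k
    exact h1 _ (by positivity) h2
  refine ⟨hq, fun n => div_ne_zero (key n) ?_⟩
  simpa using key 0

/-! ### Algebras with the relations of the Drinfeld double -/

variable (A : Type*) [Ring A] [Algebra 𝔽 A]

/-- Generators of an algebra that satisfy the relations of the Drinfeld double; of the Serre
relations only the commutation of orthogonal `Eᵢ` is recorded. -/
structure DoubleRep where
  v_ne_zero : v ≠ 0
  v_pow_ne_one : ∀ n : ℕ, n ≠ 0 → v ^ n ≠ 1
  /-- the elements `Eᵢ` -/
  E : I → A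
  /-- the elements `Fᵢ` -/
  F : I → A
  /-- the elements `K_h` -/
  K : Y → A
  /-- the elements `K'_h` -/
  Kp : Y → A
  K_zero : K 0 = 1
  Kp_zero : Kp 0 = 1
  K_add : ∀ x y, K (x + y) = K x * K y
  Kp_add : ∀ x y, Kp (x + y) = Kp x * Kp y
  K_comm : ∀ x y, Commute (K x) (K y)
  K_Kp_comm : ∀ x y, Commute (K x) (Kp y)
  Kp_comm : ∀ x y, Commute (Kp x) (Kp y)
  K_E : ∀ y i, K y * E i = v ^ R.pair y (R.α i) • (E i * K y)
  K_F : ∀ y i, K y * F i = v ^ (-R.pair y (R.α i)) • (F i * K y)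
  Kp_E : ∀ y i, Kp y * E i = v ^ (-R.pair y (R.α i)) • (E i * Kp y)
  Kp_F : ∀ y i, Kp y * F i = v ^ R.pair y (R.α i) • (F i * Kp y)
  E_mul_F_same : ∀ k, E k * F k = F k * E k +
    (R.qv v k - (R.qv v k)⁻¹)⁻¹ • (K (R.h k) ^ R.eps k - Kp (R.h k) ^ R.eps k)
  E_F_comm : ∀ {k l}, k ≠ l → Commute (E k) (F l)
  E_comm : ∀ {k l}, k ≠ l → R.a k l = 0 → Commute (E k) (E l)
  commute_of_gen : ∀ z, (∀ i, Commute z (E i)) → (∀ i, Commute z (F i)) →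
    (∀ y, Commute z (K y)) → (∀ y, Commute z (Kp y)) → ∀ x, Commute z x

namespace DoubleRep

variable {R v A} (D : R.DoubleRep v A)

theorem generic (D : R.DoubleRep v A) (k : I) : QGeneric (R.qv v k) :=
  R.qv_generic D.v_ne_zero D.v_pow_ne_one k

/-- `K̃ᵢ`. -/
def Kt (i : I) : A := D.K (R.h i) ^ R.eps i
/-- `K̃'ᵢ`. -/
def Ktp (i : I) : A := D.Kp (R.h i) ^ R.eps i
/-- The inverse of `K̃ᵢ`. -/
def KtInv (i : I) : A := D.K (-R.h i) ^ R.eps i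
/-- The inverse of `K̃'ᵢ`. -/
def KtpInv (i : I) : A := D.Kp (-R.h i) ^ R.eps i

theorem K_nsmul (n : ℕ) (y : Y) : D.K (n • y) = D.K y ^ n := by
  induction n with
  | zero => simp [K_zero]
  | succ n ih => rw [succ_nsmul, K_add, ih, pow_succ]

theorem Kp_nsmul (n : ℕ) (y : Y) : D.Kp (n • y) = D.Kp y ^ n := by
  induction n with
  | zero => simp [Kp_zero]
  | succ n ih => rw [succ_nsmul, Kp_add, ih, pow_succ]

theorem Kt_eq (k : I) : D.Kt k = D.K (R.eps k • R.h k) := by rw [K_nsmul]; rfl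

theorem Ktp_eq (k : I) : D.Ktp k = D.Kp (R.eps k • R.h k) := by rw [Kp_nsmul]; rfl

theorem KtpInv_eq (k : I) : D.KtpInv k = D.Kp (-(R.eps k • R.h k)) := by
  rw [← smul_neg, Kp_nsmul]; rfl

theorem Ktp_mul_KtpInv (k : I) : D.Ktp k * D.KtpInv k = 1 := by
  rw [Ktp_eq, KtpInv_eq, ← Kp_add, add_neg_cancel, Kp_zero]

/-! ### Weights -/

/-- `x` has weight `β` for the adjoint action of the `K_h` and `K'_h`. -/
structure HasWt (β : X) (x : A) : Prop where
  K : ∀ y, D.K y * x = v ^ R.pair y β • (x * D.K y)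
  Kp : ∀ y, D.Kp y * x = v ^ (-R.pair y β) • (x * D.Kp y)

theorem hasWt_E (i : I) : D.HasWt (R.α i) (D.E i) where
  K y := D.K_E y i
  Kp y := D.Kp_E y i

theorem hasWt_F (i : I) : D.HasWt (-R.α i) (D.F i) where
  K y := by
    rw [map_neg, D.K_F]
  Kp y := by
    rw [map_neg, neg_neg, D.Kp_F]

theorem hasWt_one : D.HasWt 0 1 where
  K y := by simp
  Kp y := by simp

theorem hasWt_K (y : Y) : D.HasWt 0 (D.K y) where
  K z := by simpa using (D.K_comm z y).eq
  Kp z := by simpa using (D.K_Kp_comm y z).eq.symm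

theorem hasWt_Kp (y : Y) : D.HasWt 0 (D.Kp y) where
  K z := by simpa using (D.K_Kp_comm z y).eq
  Kp z := by simpa using (D.Kp_comm z y).eq

variable {D}

theorem HasWt.mul {β γ : X} {x y : A} (hx : D.HasWt β x) (hy : D.HasWt γ y) :
    D.HasWt (β + γ) (x * y) where
  K z := by
    rw [← mul_assoc, hx.K, smul_mul_assoc, mul_assoc x, hy.K, mul_smul_comm, smul_smul, mul_assoc,
      ← zpow_add₀ D.v_ne_zero, map_add]
  Kp z := by
    rw [← mul_assoc, hx.Kp, smul_mul_assoc, mul_assoc x, hy.Kp, mul_smul_comm, smul_smul, mul_assoc,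
      ← zpow_add₀ D.v_ne_zero, map_add, neg_add]

theorem HasWt.add {β : X} {x y : A} (hx : D.HasWt β x) (hy : D.HasWt β y) :
    D.HasWt β (x + y) where
  K z := by rw [mul_add, hx.K, hy.K, add_mul, smul_add]
  Kp z := by rw [mul_add, hx.Kp, hy.Kp, add_mul, smul_add]

theorem HasWt.smul {β : X} {x : A} (hx : D.HasWt β x) (c : 𝔽) :
    D.HasWt β (c • x) where
  K z := by rw [mul_smul_comm, hx.K, smul_mul_assoc, smul_comm]
  Kp z := by rw [mul_smul_comm, hx.Kp, smul_mul_assoc, smul_comm]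

theorem HasWt.sub {β : X} {x y : A} (hx : D.HasWt β x) (hy : D.HasWt β y) :
    D.HasWt β (x - y) := by
  rw [sub_eq_add_neg, ← neg_one_smul 𝔽 y]
  exact hx.add (hy.smul _)

theorem HasWt.zero {β : X} : D.HasWt β 0 where
  K z := by simp
  Kp z := by simp

theorem HasWt.Kt_mul {β : X} {x : A} (hx : D.HasWt β x) (k : I) :
    D.Kt k * x = R.qv v k ^ R.pair (R.h k) β • (x * D.Kt k) := by
  rw [Kt_eq, hx.K, map_nsmul, LinearMap.smul_apply, nsmul_eq_mul, ← qv_zpow]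

theorem HasWt.Ktp_mul {β : X} {x : A} (hx : D.HasWt β x) (k : I) :
    D.Ktp k * x = R.qv v k ^ (-R.pair (R.h k) β) • (x * D.Ktp k) := by
  rw [Ktp_eq, hx.Kp, map_nsmul, LinearMap.smul_apply, nsmul_eq_mul, ← mul_neg, ← qv_zpow]

theorem HasWt.KtpInv_mul {β : X} {x : A} (hx : D.HasWt β x) (k : I) :
    D.KtpInv k * x = R.qv v k ^ R.pair (R.h k) β • (x * D.KtpInv k) := by
  rw [KtpInv_eq, hx.Kp, map_neg, map_nsmul, LinearMap.neg_apply, LinearMap.smul_apply, neg_neg,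
    nsmul_eq_mul, ← qv_zpow]

variable (D)

/-- K_y and K'_y act on each weight space by inverse scalars. -/
theorem K_mul_Kp_central (y : Y) (x : A) : Commute (D.K y * D.Kp y) x := by
  have key : ∀ (β : X) (x : A), D.HasWt β x → Commute (D.K y * D.Kp y) x := by
    intro β x hx
    rw [Commute, SemiconjBy, mul_assoc, hx.Kp, mul_smul_comm, ← mul_assoc, hx.K, smul_mul_assoc,
      smul_smul, ← zpow_add₀ D.v_ne_zero, neg_add_cancel, zpow_zero, one_smul, mul_assoc]
  exact D.commute_of_gen _ (fun i => key _ _ (D.hasWt_E i)) (fun i => key _ _ (D.hasWt_F i))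
    (fun z => key _ _ (D.hasWt_K z)) (fun z => key _ _ (D.hasWt_Kp z)) x

theorem Kt_mul_Ktp_central (k : I) (x : A) : Commute (D.Kt k * D.Ktp k) x := by
  rw [Kt_eq, Ktp_eq]
  exact D.K_mul_Kp_central _ x

/-! ### Homogeneous elements of the positive part -/

/-- The monomial in the `Eᵢ` given by a list of indices. -/
def monE (l : List I) : A := (l.map (D.E)).prod

/-- The weight `μ` part of the subalgebra generated by the `Eₖ`, `k ∈ J`. -/
def posPart (J : Set I) (μ : X) : Submodule 𝔽 (A) :=
  Submodule.span 𝔽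
    {x | ∃ l : List I, (∀ k ∈ l, k ∈ J) ∧ (l.map R.α).sum = μ ∧ x = D.monE l}

/-- The weight `β` part of `U⁺_J Eⱼ U⁺_J`. -/
def midPart (J : Set I) (j : I) (β : X) : Submodule 𝔽 (A) :=
  Submodule.span 𝔽
    {x | ∃ l l' : List I, (∀ k ∈ l, k ∈ J) ∧ (∀ k ∈ l', k ∈ J) ∧
      (l.map R.α).sum + R.α j + (l'.map R.α).sum = β ∧ x = D.monE l * D.E j * D.monE l'}

theorem monE_append (l l' : List I) : D.monE (l ++ l') = D.monE l * D.monE l' := by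
  simp [monE]

theorem hasWt_monE (l : List I) : D.HasWt (l.map R.α).sum (D.monE l) := by
  induction l with
  | nil => exact D.hasWt_one
  | cons k l ih => simpa [monE] using (D.hasWt_E k).mul ih

variable {D}

theorem hasWt_of_mem_posPart {J : Set I} {μ : X} {x : A} (hx : x ∈ D.posPart J μ) :
    D.HasWt μ x := by
  induction hx using Submodule.span_induction with
  | mem x hx => obtain ⟨l, -, rfl, rfl⟩ := hx; exact D.hasWt_monE l
  | zero => exact HasWt.zero
  | add x y _ _ hx hy => exact hx.add hy
  | smul c x _ hx => exact hx.smul c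

theorem E_mem_posPart {J : Set I} {k : I} (hk : k ∈ J) : D.E k ∈ D.posPart J (R.α k) :=
  Submodule.subset_span ⟨[k], by simpa using hk, by simp, by simp [monE]⟩

theorem one_mem_posPart (J : Set I) : (1 : A) ∈ D.posPart J 0 :=
  Submodule.subset_span ⟨[], by simp, by simp, by simp [monE]⟩

theorem E_mem_midPart (J : Set I) (j : I) : D.E j ∈ D.midPart J j (R.α j) :=
  Submodule.subset_span ⟨[], [], by simp, by simp, by simp, by simp [monE]⟩

theorem mul_mem_posPart {J : Set I} {μ ν : X} {x y : A} (hx : x ∈ D.posPart J μ)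
    (hy : y ∈ D.posPart J ν) : x * y ∈ D.posPart J (μ + ν) := by
  induction hx using Submodule.span_induction with
  | mem x hx =>
    obtain ⟨l, hl, rfl, rfl⟩ := hx
    induction hy using Submodule.span_induction with
    | mem y hy =>
      obtain ⟨l', hl', rfl, rfl⟩ := hy
      refine Submodule.subset_span ⟨l ++ l', fun k hk => ?_, by simp, by rw [monE_append]⟩
      exact (List.mem_append.1 hk).elim (hl k) (hl' k)
    | zero => simp
    | add y z _ _ hy hz => rw [mul_add]; exact add_mem hy hz
    | smul c y _ hy => rw [mul_smul_comm]; exact Submodule.smul_mem _ _ hy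
  | zero => simp
  | add x z _ _ hx hz => rw [add_mul]; exact add_mem hx hz
  | smul c x _ hx => rw [smul_mul_assoc]; exact Submodule.smul_mem _ _ hx

theorem mul_mem_midPart_left {J : Set I} {j : I} {μ ν : X} {x y : A}
    (hx : x ∈ D.posPart J μ) (hy : y ∈ D.midPart J j ν) :
    x * y ∈ D.midPart J j (μ + ν) := by
  induction hx using Submodule.span_induction with
  | mem x hx =>
    obtain ⟨l, hl, rfl, rfl⟩ := hx
    induction hy using Submodule.span_induction with
    | mem y hy =>
      obtain ⟨l', l'', hl', hl'', rfl, rfl⟩ := hy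
      refine Submodule.subset_span ⟨l ++ l', l'', fun k hk => ?_, hl'', by simp [add_assoc],
        by simp only [monE_append, mul_assoc]⟩
      exact (List.mem_append.1 hk).elim (hl k) (hl' k)
    | zero => simp
    | add y z _ _ hy hz => rw [mul_add]; exact add_mem hy hz
    | smul c y _ hy => rw [mul_smul_comm]; exact Submodule.smul_mem _ _ hy
  | zero => simp
  | add x z _ _ hx hz => rw [add_mul]; exact add_mem hx hz
  | smul c x _ hx => rw [smul_mul_assoc]; exact Submodule.smul_mem _ _ hx

theorem mul_mem_midPart_right {J : Set I} {j : I} {μ ν : X} {x y : A}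
    (hx : x ∈ D.posPart J μ) (hy : y ∈ D.midPart J j ν) :
    y * x ∈ D.midPart J j (ν + μ) := by
  induction hx using Submodule.span_induction with
  | mem x hx =>
    obtain ⟨l, hl, rfl, rfl⟩ := hx
    induction hy using Submodule.span_induction with
    | mem y hy =>
      obtain ⟨l', l'', hl', hl'', rfl, rfl⟩ := hy
      refine Submodule.subset_span ⟨l', l'' ++ l, hl', fun k hk => ?_, by simp [add_assoc],
        by simp only [monE_append, mul_assoc]⟩
      exact (List.mem_append.1 hk).elim (hl'' k) (hl k)
    | zero => simp
    | add y z _ _ hy hz => rw [add_mul]; exact add_mem hy hz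
    | smul c y _ hy => rw [smul_mul_assoc]; exact Submodule.smul_mem _ _ hy
  | zero => simp
  | add x z _ _ hx hz => rw [mul_add]; exact add_mem hx hz
  | smul c x _ hx => rw [mul_smul_comm]; exact Submodule.smul_mem _ _ hx

/-- An algebra map that sends generators into the positive part, compatibly with the action of `w`
on weights, preserves the positive part. -/
theorem map_mem_posPart {J J' : Set I} (T : A →ₐ[𝔽] A) (w : X ≃ₗ[ℤ] X)
    (h : ∀ k ∈ J, T (D.E k) ∈ D.posPart J' (w (R.α k))) {μ : X} {x : A}
    (hx : x ∈ D.posPart J μ) : T x ∈ D.posPart J' (w μ) := by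
  induction hx using Submodule.span_induction with
  | mem x hx =>
    obtain ⟨l, hl, rfl, rfl⟩ := hx
    induction l with
    | nil => simpa [monE] using one_mem_posPart J'
    | cons k l ih =>
      have h1 := mul_mem_posPart (h k (hl k (by simp))) (ih fun m hm => hl m (by simp [hm]))
      simpa [monE] using h1
  | zero => simp
  | add x y _ _ hx hy => rw [map_add]; exact add_mem hx hy
  | smul c x _ hx => rw [map_smul]; exact Submodule.smul_mem _ _ hx

end DoubleRep

end double

end QRootDatum

end

noncomputable section

namespace QRootDatum

variable {I Y X : Type*} [AddCommGroup Y] [AddCommGroup X] (R : QRootDatum I Y X)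

section double

variable {𝔽 : Type*} [Field 𝔽] {v : 𝔽} {A : Type*} [Ring A] [Algebra 𝔽 A]

namespace DoubleRep

variable {R} (D : R.DoubleRep v A)

/-! ### The operators `x ↦ [Fₖ, x] K̃'ₖ⁻¹` -/

/-- The operator `x ↦ [Fₖ, x] K̃'ₖ⁻¹`, adjoint to the `q`-commutator with `Eₖ`. -/
def fop (k : I) (x : A) : A :=
  (D.F k * x - x * D.F k) * D.KtpInv k

theorem fop_smul (k : I) (c : 𝔽) (x : A) : D.fop k (c • x) = c • D.fop k x := by
  simp only [fop, mul_smul_comm, smul_mul_assoc, ← smul_sub]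

theorem fop_E {k l : I} (h : k ≠ l) : D.fop k (D.E l) = 0 := by
  rw [fop, (D.E_F_comm h.symm).eq, sub_self, zero_mul]

/-- With the twist q^m, m being the weight of x, the K̃_k contributions of [E_k, F_k] cancel. Those
of K̃'_k add up to -[m] x K̃'_k, and the factor K̃'_k⁻¹ in `fop` removes the torus element. -/
theorem fop_qcomm {k : I} {β : X} {x : A} (hx : D.HasWt β x) {m : ℤ}
    (hm : R.pair (R.h k) β = m) :
    D.fop k (D.E k * x - R.qv v k ^ m • (x * D.E k)) =
      D.E k * D.fop k x - R.qv v k ^ (m - 2) • (D.fop k x * D.E k) - qn (R.qv v k) m • x := by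
  have hq := (D.generic k).1
  have hEF : D.E k * D.F k = D.F k * D.E k +
    (R.qv v k - (R.qv v k)⁻¹)⁻¹ • (D.Kt k - D.Ktp k) := D.E_mul_F_same k
  have hK := hx.Kt_mul k
  have hK' := hx.Ktp_mul k
  have hκ := (D.hasWt_E k).KtpInv_mul k
  have hinv := D.Ktp_mul_KtpInv k
  rw [hm] at hK hK'
  rw [R.a_self] at hκ
  unfold fop
  set e := D.E k
  set f := D.F k
  set κ := D.KtpInv k
  set q := R.qv v k
  set c := (q - q⁻¹)⁻¹ with hc
  have hκ' : e * κ = q ^ (-2 : ℤ) • (κ * e) := by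
    rw [hκ, smul_smul, ← zpow_add₀ hq]; simp
  have h1 : f * (e * x) - (e * x) * f = e * (f * x - x * f) -
      c • (q ^ m • (x * D.Kt k) - q ^ (-m) • (x * D.Ktp k)) := by
    rw [← hK, ← hK', ← sub_mul, ← smul_mul_assoc, ← sub_eq_iff_eq_add'.2 hEF]
    noncomm_ring
  have h2 : f * (x * e) - (x * e) * f = (f * x - x * f) * e -
      c • (x * D.Kt k - x * D.Ktp k) := by
    rw [← mul_sub, ← mul_smul_comm, ← sub_eq_iff_eq_add'.2 hEF]
    noncomm_ring
  have h3 : ∀ z, z * e * κ = q ^ (-2 : ℤ) • (z * κ * e) := fun z => by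
    rw [mul_assoc, hκ', mul_smul_comm, mul_assoc]
  have h4 : (f * (e * x - q ^ m • (x * e)) - (e * x - q ^ m • (x * e)) * f) =
      (f * (e * x) - (e * x) * f) - q ^ m • (f * (x * e) - (x * e) * f) := by
    rw [mul_sub, sub_mul, mul_smul_comm, smul_mul_assoc, smul_sub]; abel
  rw [h4, h1, h2]
  have h5 : x * D.Ktp k * κ = x := by rw [mul_assoc, hinv, mul_one]
  have h6 : q ^ (m - 2) = q ^ m * q ^ (-2 : ℤ) := by rw [← zpow_add₀ hq]; rfl
  simp only [sub_mul, smul_sub, smul_mul_assoc, h5, h3, mul_assoc (e : A)]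
  rw [h6, qn, div_eq_mul_inv, ← hc]
  simp only [sub_mul, mul_sub, mul_assoc]
  module

theorem hasWt_qad {k : I} {β : X} {x : A} (hx : D.HasWt β x) (q : 𝔽) (n : ℤ)
    (m : ℕ) : D.HasWt (β + (m : ℤ) • R.α k) (qad q n (D.E k) x m) := by
  induction m with
  | zero => simpa [qad] using hx
  | succ m ih =>
    have h1 := (D.hasWt_E k).mul ih
    have h2 := ih.mul (D.hasWt_E k)
    rw [add_comm] at h1
    have e : β + (m : ℤ) • R.α k + R.α k = β + ((m + 1 : ℕ) : ℤ) • R.α k := by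
      push_cast; module
    rw [e] at h1 h2
    exact h1.sub (h2.smul _)

/-- The iterated q-commutators form an sl₂ string starting at a vector x that is killed by `fop` and
has weight -n. -/
theorem fop_qad {k : I} {β : X} {x : A} (hx : D.HasWt β x) {n : ℤ}
    (hn : R.pair (R.h k) β = -n) (h0 : D.fop k x = 0) (m : ℕ) :
    D.fop k (qad (R.qv v k) n (D.E k) x (m + 1)) =
      (qn (R.qv v k) (m + 1) * qn (R.qv v k) (n - m)) • qad (R.qv v k) n (D.E k) x m := by
  have hq := D.generic k
  have hwt : ∀ m : ℕ, R.pair (R.h k) (β + (m : ℤ) • R.α k) = 2 * m - n := by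
    intro m
    rw [map_add, map_smul, hn, R.a_self, smul_eq_mul]; ring
  induction m with
  | zero =>
    have := D.fop_qcomm (D.hasWt_qad hx (R.qv v k) n 0) (hwt 0)
    refine Eq.trans this ?_
    simp only [qad, h0, mul_zero, zero_mul, smul_zero, sub_zero, Nat.cast_zero, zero_sub, zero_add]
    rw [qn_neg, hq.qn_one, one_mul, neg_smul, neg_neg]
  | succ m ih =>
    have := D.fop_qcomm (D.hasWt_qad hx (R.qv v k) n (m + 1)) (hwt (m + 1))
    rw [qad, this, ih]
    have h1 : D.E k * (qn (R.qv v k) (m + 1) * qn (R.qv v k) (n - m)) •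
        qad (R.qv v k) n (D.E k) x m - R.qv v k ^ (2 * ((m + 1 : ℕ) : ℤ) - n - 2) •
        ((qn (R.qv v k) (m + 1) * qn (R.qv v k) (n - m)) •
        qad (R.qv v k) n (D.E k) x m * D.E k) =
        (qn (R.qv v k) (m + 1) * qn (R.qv v k) (n - m)) •
          qad (R.qv v k) n (D.E k) x (m + 1) := by
      rw [qad, mul_smul_comm, smul_mul_assoc, smul_sub,
        smul_comm (R.qv v k ^ (2 * ((m + 1 : ℕ) : ℤ) - n - 2)),
        show 2 * ((m + 1 : ℕ) : ℤ) - n - 2 = 2 * (m : ℤ) - n by push_cast; ring]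
    rw [h1, ← sub_smul]
    congr 1
    have h2 := qn_step (R.qv v k) hq.1 ((m + 1 : ℕ) : ℤ) n
    rw [← h2, show 2 * ((m + 1 : ℕ) : ℤ) - n = -(n - 2 * ((m + 1 : ℕ) : ℤ)) by ring, qn_neg]
    push_cast
    rw [show n - ((m : ℤ) + 1) + 1 = n - m by ring]
    ring

/-! ### Lusztig's symmetries on `q`-commutators -/

/-- `T` is Lusztig's symmetry `T''_{k,+1}`, on all generators but the `Fₗ`, `l ≠ k`. -/
structure IsSimpleSymm (k : I) (T : A →ₐ[𝔽] A) : Prop where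
  K : ∀ y, T (D.K y) = D.K (R.sY k y)
  Kp : ∀ y, T (D.Kp y) = D.Kp (R.sY k y)
  E_same : T (D.E k) = -(D.F k * D.KtpInv k)
  F_same : T (D.F k) = -(D.KtInv k * D.E k)
  E_diff : ∀ l, l ≠ k → T (D.E l) =
    ∑ rs ∈ Finset.HasAntidiagonal.antidiagonal (-R.a k l).toNat,
      ((-1) ^ rs.1 * R.qv v k ^ (-(rs.1 : ℤ))) •
        (dpow (R.qv v k) (D.E k) rs.2 * D.E l * dpow (R.qv v k) (D.E k) rs.1)

variable {D}

theorem IsSimpleSymm.hasWt {k : I} {T : A →ₐ[𝔽] A}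
    (hT : D.IsSimpleSymm k T) {β : X} {x : A} (hx : D.HasWt β x) :
    D.HasWt (R.s k β) (T x) := by
  have hs : ∀ y, R.sY k (R.sY k y) = y := Module.involutive_reflection _
  constructor
  · intro y
    have h := congrArg T (hx.K (R.sY k y))
    rwa [map_mul, map_smul, map_mul, hT.K, hs, pair_sY] at h
  · intro y
    have h := congrArg T (hx.Kp (R.sY k y))
    rwa [map_mul, map_smul, map_mul, hT.Kp, hs, pair_sY] at h

theorem IsSimpleSymm.map_E {k l : I} {T : A →ₐ[𝔽] A}
    (hT : D.IsSimpleSymm k T) (hkl : l ≠ k) {n : ℕ} (hn : R.a k l = -n) :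
    T (D.E l) = (qfac (R.qv v k) n)⁻¹ • qad (R.qv v k) n (D.E k) (D.E l) n := by
  have hq := D.generic k
  rw [hT.E_diff l hkl, hn, neg_neg, Int.toNat_natCast, qad_eq_sum hq, smul_smul,
    inv_mul_cancel₀ (hq.qfac_ne_zero n), one_smul]
  refine Finset.sum_congr rfl fun rs _ => ?_
  congr 3
  ring

/-- T sends E_k to -F_k K̃'_k⁻¹, so it turns the q-commutator with E_k into the lowering operator
`fop`. This is how T_k is evaluated on the elements of a string. -/
theorem IsSimpleSymm.map_qcomm {k : I} {T : A →ₐ[𝔽] A}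
    (hT : D.IsSimpleSymm k T) {x : A} {γ : X} (hx : D.HasWt γ (T x)) {m : ℤ}
    (hm : R.pair (R.h k) γ = m) :
    T (D.E k * x - R.qv v k ^ m • (x * D.E k)) = -(R.qv v k ^ m • D.fop k (T x)) := by
  have h := hx.KtpInv_mul k
  rw [hm] at h
  rw [map_sub, map_smul, map_mul, map_mul, hT.E_same, neg_mul, mul_neg, mul_assoc, h, mul_smul_comm,
    fop, sub_mul, smul_sub]
  simp only [mul_assoc]
  module

/-- The composite of simple symmetries along a word. -/
def symmWord (R : QRootDatum I Y X) (T : (X ≃ₗ[ℤ] X) → (A →ₐ[𝔽] A)) (l : List I) :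
    A →ₐ[𝔽] A :=
  (l.map fun k => T (R.s k)).foldr AlgHom.comp (AlgHom.id _ _)

@[simp] theorem symmWord_nil (T : (X ≃ₗ[ℤ] X) → (A →ₐ[𝔽] A))
    (x : A) : symmWord R T [] x = x := rfl

@[simp] theorem symmWord_cons (T : (X ≃ₗ[ℤ] X) → (A →ₐ[𝔽] A)) (k : I)
    (l : List I) (x : A) : symmWord R T (k :: l) x = T (R.s k) (symmWord R T l x) := rfl

theorem symmWord_append (T : (X ≃ₗ[ℤ] X) → (A →ₐ[𝔽] A)) (l l' : List I)
    (x : A) : symmWord R T (l ++ l') x = symmWord R T l (symmWord R T l' x) := by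
  induction l with
  | nil => rfl
  | cons k l ih => simp [ih]

/-- The alternating word of length `p` in `k`, `t` that ends in `t`. -/
def altWord (k t : I) : ℕ → List I
  | 0 => []
  | p + 1 => (if Even p then t else k) :: altWord k t p

theorem E_mul_sub_mem_posPart {J : Set I} {β γ δ : X} {x y : A}
    (hx : x ∈ D.posPart J β) (hy : y ∈ D.posPart J γ) (h : β + γ = δ) (c : 𝔽) :
    x * y - c • (y * x) ∈ D.posPart J δ := by
  subst h
  refine sub_mem (mul_mem_posPart hx hy) (Submodule.smul_mem _ _ ?_)
  rw [add_comm]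
  exact mul_mem_posPart hy hx

/-! ### Rank two -/

section RankTwo

variable {k l : I} {S T : A →ₐ[𝔽] A}

/-- The element `zₘ = ad(Eₗ)ᵐ(Eₖ)`. -/
def adPow (k l : I) (n m : ℕ) : A := qad (R.qv v l) n (D.E l) (D.E k) m

theorem adPow_mem (k l : I) (n m : ℕ) :
    D.adPow k l n m ∈ D.posPart {k, l} ((1 : ℤ) • R.α k + (m : ℤ) • R.α l) := by
  induction m with
  | zero => simpa [adPow, qad] using E_mem_posPart (by simp)
  | succ m ih =>
    refine E_mul_sub_mem_posPart (E_mem_posPart (by simp)) ih ?_ _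
    push_cast
    module

theorem fop_adPow (hkl : k ≠ l) {n : ℕ} (hlk : R.a l k = -n) (m : ℕ) :
    D.fop l (D.adPow k l n (m + 1)) =
      (qn (R.qv v l) (m + 1) * qn (R.qv v l) (n - m)) • D.adPow k l n m :=
  D.fop_qad (D.hasWt_E k) hlk (D.fop_E hkl.symm) m

/-- Here a_kl = -1, so ε_k = n ε_l: throughout the rank-two computations k is the long index and l
the short one. -/
theorem qv_eq_pow {n : ℕ} (ha : R.a k l = -1) (hlk : R.a l k = -n) :
    R.qv v k = R.qv v l ^ (n : ℤ) := by
  have h := R.eps_mul_a_comm k l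
  rw [ha, hlk] at h
  have h' : R.eps k = R.eps l * n := by
    have : (R.eps k : ℤ) = R.eps l * n := by linarith
    exact_mod_cast this
  rw [qv, h', pow_mul, zpow_natCast]; rfl

theorem symm_long_short (hkl : k ≠ l) (hS : D.IsSimpleSymm k S) (ha : R.a k l = -1) :
    S (D.E l) = D.adPow l k 1 1 := by
  rw [hS.map_E hkl.symm (n := 1) (by simpa using ha)]
  simp [qfac_succ, (D.generic k).qn_one, adPow]

/-- The first q-commutator of E_l and E_k is, up to a scalar, also the one twisted for E_k. Hence
`map_qcomm` undoes the q-commutator that T_k creates from E_l. -/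
theorem symm_long_adPow_one (hkl : k ≠ l) (hS : D.IsSimpleSymm k S) {n : ℕ}
    (ha : R.a k l = -1) (hlk : R.a l k = -n) : S (D.adPow k l n 1) = D.E l := by
  have hq := D.generic k
  have h1 : D.adPow k l n 1 = -((R.qv v k)⁻¹ •
      (D.E k * D.E l - R.qv v k ^ (1 : ℤ) • (D.E l * D.E k))) := by
    rw [smul_sub, zpow_one, smul_smul, inv_mul_cancel₀ hq.1, one_smul, qv_eq_pow (v := v) ha hlk]
    simp [adPow, qad]
  have hw : D.HasWt (R.s k (R.α l)) (S (D.E l)) := hS.hasWt (D.hasWt_E l)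
  have hp : R.pair (R.h k) (R.s k (R.α l)) = 1 := by
    have : R.pair (R.h k) (R.α l) = -1 := ha
    rw [s_apply, map_sub, map_smul, R.a_self, this]; norm_num
  have h2 := fop_adPow (D := D) hkl.symm (n := 1) (by simpa using ha) 0
  simp only [zero_add, Nat.cast_one, Nat.cast_zero, sub_zero, hq.qn_one, mul_one, one_smul] at h2
  rw [h1, map_neg, map_smul, hS.map_qcomm hw hp, symm_long_short hkl hS ha, h2, smul_neg, neg_neg,
    smul_smul, zpow_one, inv_mul_cancel₀ hq.1, one_smul]
  rfl

/-- T_l(E_k) is the top of the E_l-string through E_k, and `map_qcomm` lowers it by one step. -/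
theorem symm_short_adPow (hkl : k ≠ l) (hT : D.IsSimpleSymm l T) {n : ℕ}
    (ha : R.a k l = -1) (hlk : R.a l k = -(n + 1 : ℕ)) :
    T (D.adPow l k 1 1) = (qfac (R.qv v l) n)⁻¹ • D.adPow k l (n + 1) n := by
  have hq := D.generic k
  have hql := D.generic l
  have h1 : D.adPow l k 1 1 = -((R.qv v k)⁻¹ •
      (D.E l * D.E k - R.qv v l ^ ((n + 1 : ℕ) : ℤ) • (D.E k * D.E l))) := by
    rw [← qv_eq_pow (v := v) ha hlk, smul_sub, smul_smul, inv_mul_cancel₀ hq.1, one_smul]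
    simp [adPow, qad]
  have hw : D.HasWt (R.s l (R.α k)) (T (D.E k)) := hT.hasWt (D.hasWt_E k)
  have hp : R.pair (R.h l) (R.s l (R.α k)) = (n + 1 : ℕ) := by
    have : R.pair (R.h l) (R.α k) = -(n + 1 : ℕ) := hlk
    rw [s_apply, map_sub, map_smul, R.a_self, this, smul_eq_mul]; ring
  have h2 := fop_adPow (D := D) hkl hlk n
  have h3 : ((n + 1 : ℕ) : ℤ) - n = 1 := by push_cast; ring
  rw [h3, hql.qn_one, mul_one] at h2
  rw [h1, map_neg, map_smul, hT.map_qcomm hw hp, ← qv_eq_pow (v := v) ha hlk,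
    hT.map_E hkl hlk, fop_smul]
  change -((R.qv v k)⁻¹ • -(R.qv v k • (qfac (R.qv v l) (n + 1))⁻¹ •
    D.fop l (D.adPow k l (n + 1) (n + 1)))) = _
  have h4 := hql.2 n
  have h5 := hql.qfac_ne_zero n
  rw [h2, smul_neg, neg_neg, smul_smul, inv_mul_cancel₀ hq.1, one_smul, smul_smul, qfac_succ]
  congr 1
  field_simp

end RankTwo

end DoubleRep

end double

end QRootDatum

end

/-! ### Rank two: positivity along alternating words -/

noncomputable section

namespace QRootDatum

variable {I Y X : Type*} [AddCommGroup Y] [AddCommGroup X] (R : QRootDatum I Y X)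

/-- The Weyl group element of a word. -/
def wordProd (l : List I) : X ≃ₗ[ℤ] X := (l.map R.s).prod

@[simp] theorem wordProd_nil : R.wordProd [] = 1 := rfl

theorem wordProd_cons (k : I) (l : List I) : R.wordProd (k :: l) = R.s k * R.wordProd l := by
  simp [wordProd]

theorem wordProd_append (l l' : List I) :
    R.wordProd (l ++ l') = R.wordProd l * R.wordProd l' := by
  simp [wordProd]

theorem s_comb (k l : I) (x : X) (c d : ℤ) :
    R.s k (x + c • R.α k + d • R.α l) =
      x + (-c - R.pair (R.h k) x - R.a k l * d) • R.α k + d • R.α l := by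
  rw [s_apply, map_add, map_add, map_smul, map_smul, R.a_self, a]
  simp only [smul_eq_mul]
  module

theorem s_comb' (k l : I) (x : X) (c d : ℤ) :
    R.s l (x + c • R.α k + d • R.α l) =
      x + c • R.α k + (-d - R.pair (R.h l) x - R.a l k * c) • R.α l := by
  rw [add_right_comm, s_comb, add_right_comm]

section double

variable {𝔽 : Type*} [Field 𝔽] {v : 𝔽} {A : Type*} [Ring A] [Algebra 𝔽 A]

namespace DoubleRep

variable {R} {D : R.DoubleRep v A} {k l : I} {S T : A →ₐ[𝔽] A}

theorem symm_qcomm_adPow (hkl : k ≠ l) (hT : D.IsSimpleSymm l T) {n : ℕ} (hlk : R.a l k = -n)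
    {x : A} {c : 𝔽} {r : ℕ} (hx : T x = c • D.adPow k l n (r + 1)) {m : ℤ}
    (hm : m = 2 * (r + 1) - n) :
    ∃ c' : 𝔽, T (D.E l * x - R.qv v l ^ m • (x * D.E l)) = c' • D.adPow k l n r := by
  have hw : D.HasWt (R.α k + ((r + 1 : ℕ) : ℤ) • R.α l) (T x) := by
    rw [hx]
    exact (D.hasWt_qad (D.hasWt_E k) _ _ _).smul c
  have hp : R.pair (R.h l) (R.α k + ((r + 1 : ℕ) : ℤ) • R.α l) = m := by
    have : R.pair (R.h l) (R.α k) = -n := hlk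
    rw [map_add, map_smul, R.a_self, this, hm, smul_eq_mul]
    push_cast
    ring
  rw [hT.map_qcomm hw hp, hx, fop_smul, fop_adPow hkl hlk, smul_smul, smul_smul, ← neg_smul]
  exact ⟨_, rfl⟩

/-- Positivity of the alternating words of length less than `m`. -/
def AltPos (D : R.DoubleRep v A) (T : (X ≃ₗ[ℤ] X) → (A →ₐ[𝔽] A)) (k l : I) (m : ℕ) : Prop :=
  ∀ p < m, symmWord R T (altWord k l p) (D.E k) ∈
    D.posPart {k, l} (R.wordProd (altWord k l p) (R.α k))

variable {T : (X ≃ₗ[ℤ] X) → (A →ₐ[𝔽] A)}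

theorem adPow_mem' (k l : I) (n m : ℕ) :
    D.adPow l k n m ∈ D.posPart {k, l} ((m : ℤ) • R.α k + (1 : ℤ) • R.α l) := by
  rw [add_comm, Set.pair_comm]
  exact adPow_mem l k n m

theorem E_mem_left (k l : I) : D.E k ∈ D.posPart {k, l} ((1 : ℤ) • R.α k + (0 : ℤ) • R.α l) := by
  simpa using E_mem_posPart (by simp)

theorem E_mem_right (k l : I) : D.E l ∈ D.posPart {k, l} ((0 : ℤ) • R.α k + (1 : ℤ) • R.α l) := by
  simpa using E_mem_posPart (by simp)

theorem wordProd_altWord_succ (k l : I) (p : ℕ) (x : X) :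
    R.wordProd (altWord k l (p + 1)) x =
      R.s (if Even p then l else k) (R.wordProd (altWord k l p) x) := by
  rw [altWord, wordProd_cons]; rfl

theorem symmWord_altWord_succ (k l : I) (p : ℕ) (x : A) :
    symmWord R T (altWord k l (p + 1)) x =
      T (R.s (if Even p then l else k)) (symmWord R T (altWord k l p) x) := rfl

theorem s_span (k l : I) (c d : ℤ) :
    R.s k (c • R.α k + d • R.α l) = (-c - R.a k l * d) • R.α k + d • R.α l := by
  simpa using R.s_comb k l 0 c d

theorem s_span' (k l : I) (c d : ℤ) :
    R.s l (c • R.α k + d • R.α l) = c • R.α k + (-d - R.a l k * c) • R.α l := by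
  simpa using R.s_comb' k l 0 c d

/-- A chain of elements and weights along an alternating word. -/
theorem altPos_of_chain {m : ℕ} (x : ℕ → A) (μ : ℕ → ℤ × ℤ) (hx0 : x 0 = D.E k)
    (hμ0 : μ 0 = (1, 0))
    (hx : ∀ p, p + 1 < m → ∃ c : 𝔽, T (R.s (if Even p then l else k)) (x p) = c • x (p + 1))
    (hμ : ∀ p, p + 1 < m → μ (p + 1) = if Even p then
      ((μ p).1, -(μ p).2 - R.a l k * (μ p).1) else (-(μ p).1 - R.a k l * (μ p).2, (μ p).2))
    (hmem : ∀ p < m, x p ∈ D.posPart {k, l} ((μ p).1 • R.α k + (μ p).2 • R.α l)) :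
    AltPos D T k l m := by
  have key : ∀ p, p < m → (∃ c : 𝔽, symmWord R T (altWord k l p) (D.E k) = c • x p) ∧
      R.wordProd (altWord k l p) (R.α k) = (μ p).1 • R.α k + (μ p).2 • R.α l := by
    intro p
    induction p with
    | zero =>
      intro _
      refine ⟨⟨1, by rw [one_smul, hx0]; rfl⟩, ?_⟩
      simp [hμ0, altWord]
    | succ p ih =>
      intro hp
      obtain ⟨⟨c, hc⟩, hw⟩ := ih (by omega)
      obtain ⟨c', hc'⟩ := hx p hp
      constructor
      · refine ⟨c * c', ?_⟩
        rw [symmWord_altWord_succ, hc, map_smul, hc', smul_smul]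
      · rw [wordProd_altWord_succ, hw, hμ p hp]
        split_ifs
        · rw [s_span']
        · rw [s_span]
  intro p hp
  obtain ⟨⟨c, hc⟩, hw⟩ := key p hp
  rw [hc, hw]
  exact Submodule.smul_mem _ _ (hmem p hp)

theorem altPos_of_orthogonal (hkl : k ≠ l) (hl : D.IsSimpleSymm l (T (R.s l)))
    (hlk : R.a l k = 0) : AltPos D T k l 2 := by
  refine altPos_of_chain (fun _ => D.E k) (fun _ => (1, 0)) rfl rfl ?_ ?_ ?_
  · intro p hp
    obtain rfl : p = 0 := by omega
    refine ⟨1, ?_⟩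
    simp [hl.map_E hkl (n := 0) (by simpa using hlk), qad]
  · intro p hp
    obtain rfl : p = 0 := by omega
    simp [hlk]
  · intro p _
    exact E_mem_left k l

theorem altPos_long_one (hkl : k ≠ l) (hk : D.IsSimpleSymm k (T (R.s k)))
    (hl : D.IsSimpleSymm l (T (R.s l))) (ha : R.a k l = -1) (hlk : R.a l k = -1) :
    AltPos D T k l 3 := by
  refine altPos_of_chain (fun p => if p = 0 then D.E k else if p = 1 then D.adPow k l 1 1 else
    D.E l) (fun p => if p = 0 then (1, 0) else if p = 1 then (1, 1) else (0, 1)) rfl rfl ?_ ?_ ?_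
  · intro p hp
    have hp' : p < 2 := by omega
    interval_cases p
    · exact ⟨_, hl.map_E hkl (n := 1) (by simpa using hlk)⟩
    · exact ⟨1, by simpa using symm_long_adPow_one hkl hk (n := 1) ha (by simpa using hlk)⟩
  · intro p hp
    have hp' : p < 2 := by omega
    interval_cases p <;> simp [ha, hlk]
  · intro p hp
    interval_cases p
    · exact E_mem_left k l
    · exact adPow_mem k l 1 1
    · exact E_mem_right k l

/-- Type B₂. With z_m = `adPow k l 2 m`, the two chains, up to scalars, are E_k → z₂ → E_l y - y E_l
→ E_k and E_l → y → z₁ → E_l, alternating the two symmetries. -/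
theorem altPos_long_two (hkl : k ≠ l) (hk : D.IsSimpleSymm k (T (R.s k)))
    (hl : D.IsSimpleSymm l (T (R.s l))) (ha : R.a k l = -1) (hlk : R.a l k = -2) :
    AltPos D T k l 4 ∧ AltPos D T l k 4 := by
  have h2 : R.a l k = -((2 : ℕ) : ℤ) := by simpa using hlk
  set y := D.adPow l k 1 1 with hy
  have hSE := symm_long_short hkl hk ha
  have hTy := symm_short_adPow hkl hl (n := 1) ha h2
  have hSz := symm_long_adPow_one hkl hk ha h2
  have hSz2 : T (R.s k) (D.adPow k l 2 2) = (-1 : 𝔽) • (D.E l * y - R.qv v l ^ (0 : ℤ) •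
      (y * D.E l)) := by
    change T (R.s k) (D.E l * D.adPow k l 2 1 - R.qv v l ^ (0 : ℤ) • (D.adPow k l 2 1 * D.E l)) = _
    rw [map_sub, map_smul, map_mul, map_mul, hSE, hSz]
    simp [hy]
  have hym : y ∈ D.posPart {k, l} ((1 : ℤ) • R.α k + (1 : ℤ) • R.α l) := adPow_mem' k l 1 1
  constructor
  · refine altPos_of_chain (fun p => if p = 0 then D.E k else if p = 1 then D.adPow k l 2 2 else
      if p = 2 then D.E l * y - R.qv v l ^ (0 : ℤ) • (y * D.E l) else D.E k)
      (fun p => if p = 0 then (1, 0) else if p = 1 then (1, 2) else if p = 2 then (1, 2) else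
        (1, 0)) rfl rfl ?_ ?_ ?_
    · intro p hp
      have hp' : p < 3 := by omega
      interval_cases p
      · exact ⟨_, hl.map_E hkl h2⟩
      · exact ⟨_, hSz2⟩
      · exact symm_qcomm_adPow hkl hl h2 hTy (r := 0) (by norm_num)
    · intro p hp
      have hp' : p < 3 := by omega
      interval_cases p <;> simp [ha, hlk]
    · intro p hp
      interval_cases p
      · exact E_mem_left k l
      · exact adPow_mem k l 2 2
      · exact E_mul_sub_mem_posPart (δ := (1 : ℤ) • R.α k + (2 : ℤ) • R.α l) (E_mem_right k l) hym
          (by module) _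
      · exact E_mem_left k l
  · refine altPos_of_chain (fun p => if p = 0 then D.E l else if p = 1 then y else
      if p = 2 then D.adPow k l 2 1 else D.E l)
      (fun p => if p = 0 then (1, 0) else if p = 1 then (1, 1) else if p = 2 then (1, 1) else
        (1, 0)) rfl rfl ?_ ?_ ?_
    · intro p hp
      have hp' : p < 3 := by omega
      interval_cases p
      · exact ⟨1, by simpa using hSE⟩
      · exact ⟨_, hTy⟩
      · exact ⟨1, by simpa using hSz⟩
    · intro p hp
      have hp' : p < 3 := by omega
      interval_cases p <;> simp [ha, hlk]
    · intro p hp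
      interval_cases p
      · exact E_mem_left l k
      · exact adPow_mem l k 1 1
      · exact adPow_mem' l k 2 1
      · exact E_mem_left l k

/-- Type G₂. With z_m = `adPow k l 3 m`, the short chain is E_l → y → z₂ → V → z₁ → E_l. The long
chain starts E_k → z₃ and ends at E_k, passing through the q-commutators of (y, V), of (z₂, z₁) and
of (E_l, V); its middle values follow from the short chain because each T is multiplicative. -/
theorem altPos_long_three (hkl : k ≠ l) (hk : D.IsSimpleSymm k (T (R.s k)))
    (hl : D.IsSimpleSymm l (T (R.s l))) (ha : R.a k l = -1) (hlk : R.a l k = -3) :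
    AltPos D T k l 6 ∧ AltPos D T l k 6 := by
  have h3 : R.a l k = -((3 : ℕ) : ℤ) := by simpa using hlk
  have hq := (D.generic l).1
  set q := R.qv v l with hqdef
  set y := D.adPow l k 1 1 with hy
  set V := D.E l * y - q ^ (1 : ℤ) • (y * D.E l) with hV
  have hSE := symm_long_short hkl hk ha
  have hTy := symm_short_adPow hkl hl (n := 2) ha h3
  have hSz := symm_long_adPow_one hkl hk ha h3
  have hSz2 : T (R.s k) (D.adPow k l 3 2) = (-q⁻¹) • V := by
    change T (R.s k) (D.E l * D.adPow k l 3 1 - q ^ (-1 : ℤ) • (D.adPow k l 3 1 * D.E l)) = _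
    rw [map_sub, map_smul, map_mul, map_mul, hSE, hSz, hV, neg_smul, smul_sub, smul_smul]
    simp [hq, hy]
  obtain ⟨c, hTV⟩ : ∃ c' : 𝔽, T (R.s l) V = c' • D.adPow k l 3 1 :=
    symm_qcomm_adPow hkl hl h3 hTy (r := 1) (by norm_num)
  obtain ⟨c', hTV'⟩ : ∃ c' : 𝔽, T (R.s l) (D.E l * V - q ^ (-1 : ℤ) • (V * D.E l)) =
      c' • D.adPow k l 3 0 := symm_qcomm_adPow hkl hl h3 hTV (r := 0) (by norm_num)
  have hSz3 : T (R.s k) (D.adPow k l 3 3) = (-q⁻¹) • (y * V - q • (V * y)) := by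
    change T (R.s k) (D.E l * D.adPow k l 3 2 - q ^ (1 : ℤ) • (D.adPow k l 3 2 * D.E l)) = _
    rw [map_sub, map_smul, map_mul, map_mul, hSE, hSz2, zpow_one]
    simp only [mul_smul_comm, smul_mul_assoc, smul_sub, smul_smul, mul_comm, hy]
  have hTyV : T (R.s l) (y * V - q • (V * y)) = ((qfac q 2)⁻¹ * c) •
      (D.adPow k l 3 2 * D.adPow k l 3 1 - q • (D.adPow k l 3 1 * D.adPow k l 3 2)) := by
    rw [map_sub, map_smul, map_mul, map_mul, hTV, hTy]
    simp only [mul_smul_comm, smul_mul_assoc, smul_sub, smul_smul]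
    congr 2 <;> ring
  have hSzz : T (R.s k) (D.adPow k l 3 2 * D.adPow k l 3 1 -
      q • (D.adPow k l 3 1 * D.adPow k l 3 2)) =
      (1 : 𝔽) • (D.E l * V - q ^ (-1 : ℤ) • (V * D.E l)) := by
    rw [map_sub, map_smul, map_mul, map_mul, hSz2, hSz]
    simp only [mul_smul_comm, smul_mul_assoc, smul_sub, smul_smul, zpow_neg, zpow_one, one_mul,
      one_smul, mul_neg, mul_inv_cancel₀ hq]
    module
  have hym : y ∈ D.posPart {k, l} ((1 : ℤ) • R.α k + (1 : ℤ) • R.α l) := adPow_mem' k l 1 1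
  have hVm : V ∈ D.posPart {k, l} ((1 : ℤ) • R.α k + (2 : ℤ) • R.α l) :=
    E_mul_sub_mem_posPart (E_mem_right k l) hym (by module) _
  constructor
  · refine altPos_of_chain (fun p => if p = 0 then D.E k else if p = 1 then D.adPow k l 3 3 else
      if p = 2 then y * V - q • (V * y) else if p = 3 then
        D.adPow k l 3 2 * D.adPow k l 3 1 - q • (D.adPow k l 3 1 * D.adPow k l 3 2) else
      if p = 4 then D.E l * V - q ^ (-1 : ℤ) • (V * D.E l) else D.E k)
      (fun p => if p = 0 then (1, 0) else if p = 1 then (1, 3) else if p = 2 then (2, 3) else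
        if p = 3 then (2, 3) else if p = 4 then (1, 3) else (1, 0)) rfl rfl ?_ ?_ ?_
    · intro p hp
      have hp' : p < 5 := by omega
      interval_cases p
      · exact ⟨_, hl.map_E hkl h3⟩
      · exact ⟨_, hSz3⟩
      · exact ⟨_, hTyV⟩
      · exact ⟨_, hSzz⟩
      · exact ⟨_, hTV'⟩
    · intro p hp
      have hp' : p < 5 := by omega
      interval_cases p <;> simp +decide [ha, hlk]
    · intro p hp
      interval_cases p
      · exact E_mem_left k l
      · exact adPow_mem k l 3 3
      · exact E_mul_sub_mem_posPart (δ := (2 : ℤ) • R.α k + (3 : ℤ) • R.α l) hym hVm (by module) _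
      · exact E_mul_sub_mem_posPart (δ := (2 : ℤ) • R.α k + (3 : ℤ) • R.α l) 
          (adPow_mem k l 3 2) (adPow_mem k l 3 1) (by
          push_cast; module) _
      · exact E_mul_sub_mem_posPart (δ := (1 : ℤ) • R.α k + (3 : ℤ) • R.α l) (E_mem_right k l) hVm
          (by module) _
      · exact E_mem_left k l
  · refine altPos_of_chain (fun p => if p = 0 then D.E l else if p = 1 then y else
      if p = 2 then D.adPow k l 3 2 else if p = 3 then V else if p = 4 then D.adPow k l 3 1 else
      D.E l)
      (fun p => if p = 0 then (1, 0) else if p = 1 then (1, 1) else if p = 2 then (2, 1) else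
        if p = 3 then (2, 1) else if p = 4 then (1, 1) else (1, 0)) rfl rfl ?_ ?_ ?_
    · intro p hp
      have hp' : p < 5 := by omega
      interval_cases p
      · exact ⟨1, by simpa using hSE⟩
      · exact ⟨_, hTy⟩
      · exact ⟨_, hSz2⟩
      · exact ⟨_, hTV⟩
      · exact ⟨1, hSz.trans (one_smul 𝔽 _).symm⟩
    · intro p hp
      have hp' : p < 5 := by omega
      interval_cases p <;> simp +decide [ha, hlk]
    · intro p hp
      interval_cases p
      · exact E_mem_left l k
      · exact adPow_mem l k 1 1
      · exact adPow_mem' l k 3 2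
      · rw [Set.pair_comm, add_comm]; exact hVm
      · exact adPow_mem' l k 3 1
      · exact E_mem_left l k

end DoubleRep

end double

end QRootDatum

end

noncomputable section

namespace QRootDatum

variable {I Y X : Type*} [AddCommGroup Y] [AddCommGroup X] (R : QRootDatum I Y X)

/-! ### Words and length in parabolic Weyl groups -/

theorem s_mem_weyl {J : Set I} {k : I} (hk : k ∈ J) : R.s k ∈ R.weyl J :=
  Subgroup.subset_closure ⟨k, hk, rfl⟩

theorem wordProd_mem_weyl {J : Set I} {l : List I} (hl : ∀ k ∈ l, k ∈ J) :
    R.wordProd l ∈ R.weyl J := by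
  refine Subgroup.list_prod_mem _ fun x hx => ?_
  obtain ⟨k, hk, rfl⟩ := List.mem_map.1 hx
  exact R.s_mem_weyl (hl k hk)

theorem s_inv (k : I) : (R.s k)⁻¹ = R.s k :=
  inv_eq_of_mul_eq_one_right (R.s_mul_self k)

theorem exists_word {J : Set I} {w : X ≃ₗ[ℤ] X} (hw : w ∈ R.weyl J) :
    ∃ l : List I, (∀ k ∈ l, k ∈ J) ∧ R.wordProd l = w := by
  induction hw using Subgroup.closure_induction_left with
  | one => exact ⟨[], by simp, rfl⟩
  | mul_left x hx y _ ih =>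
    obtain ⟨k, hk, rfl⟩ := hx
    obtain ⟨l, hl, rfl⟩ := ih
    exact ⟨k :: l, by simpa [hk] using hl, R.wordProd_cons k l⟩
  | inv_mul_cancel x hx y _ ih =>
    obtain ⟨k, hk, rfl⟩ := hx
    obtain ⟨l, hl, rfl⟩ := ih
    exact ⟨k :: l, by simpa [hk] using hl, by rw [R.wordProd_cons k l, s_inv]⟩

theorem len_wordProd_le {J : Set I} {l : List I} (hl : ∀ k ∈ l, k ∈ J) :
    R.len J (R.wordProd l) ≤ l.length :=
  Nat.sInf_le ⟨l, hl, rfl, rfl⟩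

theorem exists_reduced_word {J : Set I} {w : X ≃ₗ[ℤ] X} (hw : w ∈ R.weyl J) :
    ∃ l : List I, (∀ k ∈ l, k ∈ J) ∧ R.wordProd l = w ∧ l.length = R.len J w := by
  obtain ⟨l, hl, h⟩ := R.exists_word hw
  exact Nat.sInf_mem (s := {n | ∃ l : List I, (∀ k ∈ l, k ∈ J) ∧ (l.map R.s).prod = w ∧
    l.length = n}) ⟨l.length, l, hl, h, rfl⟩

theorem len_mul_le {J : Set I} {w w' : X ≃ₗ[ℤ] X} (hw : w ∈ R.weyl J) (hw' : w' ∈ R.weyl J) :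
    R.len J (w * w') ≤ R.len J w + R.len J w' := by
  obtain ⟨l, hl, rfl, h⟩ := R.exists_reduced_word hw
  obtain ⟨l', hl', rfl, h'⟩ := R.exists_reduced_word hw'
  rw [← h, ← h', ← wordProd_append, ← List.length_append]
  exact R.len_wordProd_le fun k hk => (List.mem_append.1 hk).elim (hl k) (hl' k)

theorem len_one (J : Set I) : R.len J 1 = 0 :=
  Nat.le_zero.1 (R.len_wordProd_le (J := J) (l := []) (by simp))

theorem len_s_le {J : Set I} {k : I} (hk : k ∈ J) : R.len J (R.s k) ≤ 1 := by
  simpa [wordProd] using R.len_wordProd_le (J := J) (l := [k]) (by simpa using hk)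

theorem len_le_len_mul_s_add_one {J : Set I} {w : X ≃ₗ[ℤ] X} (hw : w ∈ R.weyl J) {k : I}
    (hk : k ∈ J) : R.len J w ≤ R.len J (w * R.s k) + 1 := by
  have h := R.len_mul_le (mul_mem hw (R.s_mem_weyl hk)) (R.s_mem_weyl hk)
  rw [mul_assoc, s_mul_self, mul_one] at h
  exact h.trans (Nat.add_le_add_left (R.len_s_le hk) _)

theorem exists_descent {J : Set I} {w : X ≃ₗ[ℤ] X} (hw : w ∈ R.weyl J) (h0 : 0 < R.len J w) :
    ∃ t ∈ J, ∃ u ∈ R.weyl J, w = u * R.s t ∧ R.len J u + 1 = R.len J w := by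
  obtain ⟨l, hl, rfl, hlw⟩ := R.exists_reduced_word hw
  rcases List.eq_nil_or_concat' l with rfl | ⟨l', t, rfl⟩
  · simp [len_one] at h0
  have hl' : ∀ k ∈ l', k ∈ J := fun k hk => hl k (by simp [hk])
  have ht : t ∈ J := hl t (by simp)
  have h1 := R.len_wordProd_le hl'
  have h2 := R.wordProd_mem_weyl hl'
  have h3 : R.wordProd (l' ++ [t]) = R.wordProd l' * R.s t := by
    rw [wordProd_append, wordProd_cons, wordProd_nil, mul_one]
  refine ⟨t, ht, _, h2, h3, ?_⟩
  have h4 := R.len_mul_le h2 (R.s_mem_weyl ht)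
  have h5 := R.len_s_le ht
  rw [h3] at hlw ⊢
  rw [List.length_append, List.length_singleton] at hlw
  omega

/-! ### Dihedral subgroups -/

theorem pair_coeff_eq {k t : I} (hkt : k ≠ t) {c d c' d' : ℤ}
    (h : c • R.α k + d • R.α t = c' • R.α k + d' • R.α t) : c = c' ∧ d = d' := by
  have h1 : LinearIndependent ℤ ![R.α k, R.α t] := by
    have h2 := R.indep_α.comp ![k, t] (by
      intro x y hxy
      fin_cases x <;> fin_cases y <;> simp_all)
    convert h2 using 1
    ext x
    fin_cases x <;> rfl
  have h3 := LinearIndependent.pair_iff.1 h1 (c - c') (d - d') (by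
    rw [sub_smul, sub_smul, sub_add_sub_comm, h, sub_self])
  omega

/-- If the product were at least 4, the α_k-coefficient of (s_k s_t)^n α_k would grow without bound,
so s_k s_t would have infinite order. -/
theorem a_mul_a_lt_of_finite {J : Set I} (hfin : (R.weyl J : Set (X ≃ₗ[ℤ] X)).Finite) {k t : I}
    (hk : k ∈ J) (ht : t ∈ J) (hkt : k ≠ t) : R.a k t * R.a t k < 4 := by
  by_contra! h4
  have ha := R.a_nonpos hkt
  -- The last inequality strengthens the induction: from -a_kt d < 2c the new coefficient is at
  -- least 3c + a_kt d > c, and the new value of -a_kt d is the sum of the old and new c.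
  have key : ∀ n : ℕ, ∃ c d : ℤ, ((R.s k * R.s t) ^ n) (R.α k) = c • R.α k + d • R.α t ∧
      (n : ℤ) + 1 ≤ c ∧ -R.a k t * d < 2 * c := by
    intro n
    induction n with
    | zero => exact ⟨1, 0, by simp, by simp, by simp⟩
    | succ n ih =>
      obtain ⟨c, d, h, hc, hd⟩ := ih
      refine ⟨-c - R.a k t * (-d - R.a t k * c), -d - R.a t k * c, ?_, ?_, ?_⟩
      · rw [pow_succ', LinearEquiv.mul_apply, h, LinearEquiv.mul_apply, DoubleRep.s_span',
          DoubleRep.s_span]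
      · push_cast
        nlinarith
      · nlinarith
  obtain ⟨N, hN, hpow⟩ : ∃ N : ℕ, 0 < N ∧ (R.s k * R.s t) ^ N = 1 := by
    have hmem : ∀ n : ℕ, (R.s k * R.s t) ^ n ∈ (R.weyl J : Set (X ≃ₗ[ℤ] X)) := fun n =>
      pow_mem (mul_mem (R.s_mem_weyl hk) (R.s_mem_weyl ht)) n
    by_contra! hne
    refine Set.infinite_of_injective_forall_mem ?_ hmem hfin
    exact injective_pow_iff_not_isOfFinOrder.2 fun h => by
      obtain ⟨N, hN, h⟩ := isOfFinOrder_iff_pow_eq_one.1 h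
      exact hne N hN h
  obtain ⟨c, d, h, hc, -⟩ := key N
  rw [hpow] at h
  have := R.pair_coeff_eq hkt (c := 1) (d := 0) (c' := c) (d' := d) (by simpa using h)
  omega

theorem altWord_append (k t : I) (m p : ℕ) : ∃ l : List I, (∀ x ∈ l, x = k ∨ x = t) ∧
    l.length = p ∧ DoubleRep.altWord k t (p + m) = l ++ DoubleRep.altWord k t m := by
  induction p with
  | zero => exact ⟨[], by simp, rfl, by simp⟩
  | succ p ih =>
    obtain ⟨l, h1, h2, h3⟩ := ih
    refine ⟨(if Even (p + m) then t else k) :: l, ?_, by simp [h2], ?_⟩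
    · intro x hx
      rcases List.mem_cons.1 hx with rfl | hx
      · split_ifs <;> simp
      · exact h1 x hx
    · rw [Nat.add_right_comm, DoubleRep.altWord, h3]; rfl

theorem altWord_succ_eq_append (k t : I) (m : ℕ) :
    DoubleRep.altWord t k (m + 1) = DoubleRep.altWord k t m ++ [k] := by
  induction m with
  | zero => simp [DoubleRep.altWord]
  | succ m ih =>
    rw [DoubleRep.altWord, ih, DoubleRep.altWord, List.cons_append]
    by_cases h : Even m <;> simp [h, Nat.even_add_one]

theorem length_altWord (k t : I) (m : ℕ) : (DoubleRep.altWord k t m).length = m := by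
  induction m with
  | zero => rfl
  | succ m ih => simp [DoubleRep.altWord, ih]

theorem mem_altWord {k t x : I} {m : ℕ} (hx : x ∈ DoubleRep.altWord k t m) : x = k ∨ x = t := by
  induction m with
  | zero => simp [DoubleRep.altWord] at hx
  | succ m ih =>
    rcases List.mem_cons.1 hx with rfl | hx
    · split_ifs <;> simp
    · exact ih hx

/-- The zero multiples put x in the form x + cα_k + dα_t on which `s_comb` and `s_comb'` rewrite. -/
theorem braid_of_apply {k t : I} {m : ℕ}
    (h : ∀ x, R.wordProd (DoubleRep.altWord k t m) (x + (0 : ℤ) • R.α k + (0 : ℤ) • R.α t) =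
      R.wordProd (DoubleRep.altWord t k m) (x + (0 : ℤ) • R.α k + (0 : ℤ) • R.α t)) :
    R.wordProd (DoubleRep.altWord k t m) = R.wordProd (DoubleRep.altWord t k m) := by
  ext x
  simpa using h x

theorem braid_two {k t : I} (h : R.a k t = 0) (h' : R.a t k = 0) :
    R.wordProd (DoubleRep.altWord k t 2) = R.wordProd (DoubleRep.altWord t k 2) := by
  refine R.braid_of_apply fun x => ?_
  simp +decide only [DoubleRep.altWord, wordProd_cons, wordProd_nil, mul_one,
    LinearEquiv.mul_apply, if_true, if_false, s_comb, s_comb', h, h']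
  module

theorem braid_three {k t : I} (h : R.a k t = -1) (h' : R.a t k = -1) :
    R.wordProd (DoubleRep.altWord k t 3) = R.wordProd (DoubleRep.altWord t k 3) := by
  refine R.braid_of_apply fun x => ?_
  simp +decide only [DoubleRep.altWord, wordProd_cons, wordProd_nil, mul_one,
    LinearEquiv.mul_apply, if_true, if_false, s_comb, s_comb', h, h']
  module

theorem braid_four {k t : I} (h : R.a k t = -1) (h' : R.a t k = -2) :
    R.wordProd (DoubleRep.altWord k t 4) = R.wordProd (DoubleRep.altWord t k 4) := by
  refine R.braid_of_apply fun x => ?_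
  simp +decide only [DoubleRep.altWord, wordProd_cons, wordProd_nil, mul_one,
    LinearEquiv.mul_apply, if_true, if_false, s_comb, s_comb', h, h']
  module

theorem braid_six {k t : I} (h : R.a k t = -1) (h' : R.a t k = -3) :
    R.wordProd (DoubleRep.altWord k t 6) = R.wordProd (DoubleRep.altWord t k 6) := by
  refine R.braid_of_apply fun x => ?_
  simp +decide only [DoubleRep.altWord, wordProd_cons, wordProd_nil, mul_one,
    LinearEquiv.mul_apply, if_true, if_false, s_comb, s_comb', h, h']
  module

/-! ### Positivity of T_w(E_k) -/

section double

variable {𝔽 : Type*} [Field 𝔽] {v : 𝔽} {A : Type*} [Ring A] [Algebra 𝔽 A]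

namespace DoubleRep

variable {R} (D : R.DoubleRep v A)

/-- The family of Lusztig symmetries of the parabolic subgroup `W_J`. -/
structure IsSymmFamily (J : Set I) (T : (X ≃ₗ[ℤ] X) → (A →ₐ[𝔽] A)) : Prop where
  simple : ∀ k ∈ J, D.IsSimpleSymm k (T (R.s k))
  reduced : ∀ l : List I, (∀ k ∈ l, k ∈ J) → R.len J (R.wordProd l) = l.length →
    T (R.wordProd l) = symmWord R T l

variable {D} {J : Set I} {T : (X ≃ₗ[ℤ] X) → (A →ₐ[𝔽] A)}

/-- Finiteness leaves only a_kt a_tk = 0, 1, 2, 3, with m = 2, 3, 4, 6. -/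
theorem IsSymmFamily.exists_braid (hT : D.IsSymmFamily J T)
    (hfin : (R.weyl J : Set (X ≃ₗ[ℤ] X)).Finite) {k t : I} (hk : k ∈ J) (ht : t ∈ J)
    (hkt : k ≠ t) : ∃ m, 0 < m ∧ R.wordProd (altWord k t m) = R.wordProd (altWord t k m) ∧
      AltPos D T k t m := by
  have h1 := R.a_mul_a_lt_of_finite hfin hk ht hkt
  have h2 := R.a_nonpos hkt
  have h3 := R.a_nonpos hkt.symm
  have h4 := R.eps_mul_a_comm k t
  have h5 := R.eps_pos k
  have h6 := R.eps_pos t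
  have hsk := hT.simple k hk
  have hst := hT.simple t ht
  by_cases h0 : R.a k t = 0
  · have h0' : R.a t k = 0 := by
      rw [h0, mul_zero] at h4
      rcases mul_eq_zero.1 h4.symm with h | h
      · omega
      · exact h
    exact ⟨2, by norm_num, R.braid_two h0 h0', altPos_of_orthogonal hkt hst h0'⟩
  by_cases h0' : R.a t k = 0
  · rw [h0', mul_zero] at h4
    rcases mul_eq_zero.1 h4 with h | h
    · omega
    · exact absurd h h0
  have h7 : -3 ≤ R.a k t := by nlinarith [show R.a k t ≤ -1 by omega, show R.a t k ≤ -1 by omega]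
  have h8 : -3 ≤ R.a t k := by nlinarith [show R.a k t ≤ -1 by omega, show R.a t k ≤ -1 by omega]
  generalize ha : R.a k t = a at *
  generalize hb : R.a t k = b at *
  interval_cases a <;> interval_cases b <;> try omega
  · exact ⟨6, by norm_num, (R.braid_six hb ha).symm, (altPos_long_three hkt.symm hst hsk hb ha).2⟩
  · exact ⟨4, by norm_num, (R.braid_four hb ha).symm, (altPos_long_two hkt.symm hst hsk hb ha).2⟩
  · exact ⟨6, by norm_num, R.braid_six ha hb, (altPos_long_three hkt hsk hst ha hb).1⟩
  · exact ⟨4, by norm_num, R.braid_four ha hb, (altPos_long_two hkt hsk hst ha hb).1⟩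
  · exact ⟨3, by norm_num, R.braid_three ha hb, altPos_long_one hkt hsk hst ha hb⟩

theorem IsSymmFamily.one_apply (hT : D.IsSymmFamily J T) (x : A) : T 1 x = x := by
  have h := hT.reduced [] (by simp) (by simpa using R.len_one J)
  rw [wordProd_nil] at h
  rw [h]; rfl

/-- `T` is multiplicative along length-additive products. -/
theorem IsSymmFamily.map_mul_wordProd (hT : D.IsSymmFamily J T) {w : X ≃ₗ[ℤ] X} (hw : w ∈ R.weyl J)
    {l : List I} (hl : ∀ k ∈ l, k ∈ J) (h : R.len J w + l.length ≤ R.len J (w * R.wordProd l))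
    (x : A) : T (w * R.wordProd l) x = T w (symmWord R T l x) := by
  obtain ⟨l', hl', rfl, h'⟩ := R.exists_reduced_word hw
  have hmem : ∀ k ∈ l' ++ l, k ∈ J := fun k hk => (List.mem_append.1 hk).elim (hl' k) (hl k)
  have hle := R.len_wordProd_le hmem
  rw [← wordProd_append, ← h', ← List.length_append] at h
  rw [← wordProd_append, hT.reduced _ hmem (le_antisymm hle h), hT.reduced _ hl' h'.symm,
    symmWord_append]

/-- If `ℓ(w sₖ) ≥ ℓ(w)` then `T_w(Eₖ)` lies in the positive part. -/
theorem IsSymmFamily.map_E_mem_posPart (hT : D.IsSymmFamily J T)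
    (hfin : (R.weyl J : Set (X ≃ₗ[ℤ] X)).Finite) {w : X ≃ₗ[ℤ] X} (hw : w ∈ R.weyl J) {k : I}
    (hk : k ∈ J) (hlen : ¬ R.len J (w * R.s k) < R.len J w) :
    T w (D.E k) ∈ D.posPart J (w (R.α k)) := by
  induction hn : R.len J w using Nat.strong_induction_on generalizing w k with
  | _ n ih =>
  rcases Nat.eq_zero_or_pos n with rfl | hpos
  · obtain ⟨l, hl, rfl, hlw⟩ := R.exists_reduced_word hw
    rw [hn] at hlw
    rw [List.length_eq_zero_iff.1 hlw, wordProd_nil, hT.one_apply]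
    exact E_mem_posPart hk
  obtain ⟨t, ht, u, hu, hwu, hun⟩ := R.exists_descent hw (by omega)
  have hkt : k ≠ t := by
    rintro rfl
    refine hlen ?_
    rw [hwu, mul_assoc, s_mul_self, mul_one, ← hwu]
    omega
  have halt : ∀ p, ∀ x ∈ altWord k t p, x ∈ J := fun p x hx => by
    rcases mem_altWord hx with rfl | rfl <;> assumption
  obtain ⟨u, p, hp, hu, hwu, hup, hmin⟩ : ∃ u p, 0 < p ∧ u ∈ R.weyl J ∧
      w = u * R.wordProd (altWord k t p) ∧ R.len J u + p = n ∧
      ∀ u' ∈ R.weyl J, w = u' * R.wordProd (altWord k t (p + 1)) → n ≤ R.len J u' + p := by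
    -- Split off from w a right alternating factor that cannot be lengthened while the lengths still
    -- add up; since p ≤ ℓ(w), this process stops.
    let P : ℕ → Prop := fun p => 0 < p ∧ ∃ u ∈ R.weyl J, w = u * R.wordProd (altWord k t p) ∧
      R.len J u + p ≤ n
    have hP : ∃ p, P p ∧ ¬ P (p + 1) := by
      by_contra! hcon
      have h1 : P 1 := ⟨one_pos, u, hu, by simpa [altWord, wordProd_cons] using hwu, by omega⟩
      have : ∀ p, P (p + 1) := fun p => by
        induction p with
        | zero => exact h1
        | succ p ih => exact hcon _ ih
      obtain ⟨-, u, -, -, h⟩ := this n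
      omega
    obtain ⟨p, ⟨hp, u, hu, hwu, hle⟩, hnot⟩ := hP
    have hge := R.len_mul_le hu (R.wordProd_mem_weyl (halt p))
    have hge' := R.len_wordProd_le (halt p)
    rw [← hwu] at hge
    rw [length_altWord] at hge'
    refine ⟨u, p, hp, hu, hwu, by omega, fun u' hu' hw' => ?_⟩
    by_contra! hlt
    exact hnot ⟨Nat.succ_pos p, u', hu', hw', by omega⟩
  -- Neither k nor t is a right descent of u: one is excluded because p cannot be increased, the
  -- other because u times its reflection would give a word for w that is too short. So induction
  -- applies to T_u on both E_k and E_t.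
  have hc : ¬ R.len J (u * R.s (if Even p then t else k)) < R.len J u := by
    intro hlt
    have hd : (if Even p then t else k) ∈ J := by split_ifs <;> assumption
    have := hmin _ (mul_mem hu (R.s_mem_weyl hd)) (by
      rw [altWord, wordProd_cons, mul_assoc, ← mul_assoc (R.s _) (R.s _), s_mul_self, one_mul, hwu])
    omega
  have hc' : ¬ R.len J (u * R.s (if Even p then k else t)) < R.len J u := by
    intro hlt
    have hd : (if Even p then k else t) ∈ J := by split_ifs <;> assumption
    obtain ⟨p, rfl⟩ := Nat.exists_eq_succ_of_ne_zero hp.ne'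
    have h1 : w = u * R.s (if Even (p + 1) then k else t) * R.wordProd (altWord k t p) := by
      rw [hwu, Nat.succ_eq_add_one, altWord, wordProd_cons, mul_assoc]
      simp only [Nat.even_add_one, ite_not]
    have h2 := R.len_mul_le (mul_mem hu (R.s_mem_weyl hd)) (R.wordProd_mem_weyl (halt p))
    have h3 := R.len_wordProd_le (halt p)
    rw [length_altWord] at h3
    rw [← h1] at h2
    omega
  have hdesc : ∀ x ∈ ({k, t} : Set I), T u (D.E x) ∈ D.posPart J (u (R.α x)) := by
    have hlt : R.len J u < n := by omega
    have e1 : ∀ x ∈ J, ¬ R.len J (u * R.s x) < R.len J u →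
      T u (D.E x) ∈ D.posPart J (u (R.α x)) := fun x hx hx' => ih _ hlt hu hx hx' rfl
    rintro x (rfl | rfl)
    · by_cases hev : Even p
      · exact e1 _ hk (by simpa [hev] using hc')
      · exact e1 _ hk (by simpa [hev] using hc)
    · by_cases hev : Even p
      · exact e1 _ ht (by simpa [hev] using hc)
      · exact e1 _ ht (by simpa [hev] using hc')
  obtain ⟨m, hm, hbraid, hpos⟩ := hT.exists_braid hfin hk ht hkt
  -- For p ≥ m the braid relation rewrites the alternating factor so that it ends in k, and then k
  -- would be a right descent of w.
  have hpm : p < m := by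
    by_contra! hle
    obtain ⟨q, rfl⟩ := Nat.exists_eq_add_of_le' hle
    obtain ⟨m, rfl⟩ := Nat.exists_eq_succ_of_ne_zero hm.ne'
    obtain ⟨l, h1, h2, h3⟩ := altWord_append k t (m + 1) q
    have hlJ : ∀ x ∈ l, x ∈ J := fun x hx => by rcases h1 x hx with rfl | rfl <;> assumption
    refine hlen ?_
    have e : w * R.s k = u * (R.wordProd l * R.wordProd (altWord k t m)) := by
      rw [hwu, Nat.succ_eq_add_one, h3, wordProd_append, hbraid, Nat.succ_eq_add_one,
        altWord_succ_eq_append, wordProd_append, wordProd_cons, wordProd_nil, mul_one]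
      simp only [mul_assoc, s_mul_self, mul_one]
    have h4 := R.len_wordProd_le (halt m)
    have h5 := R.len_wordProd_le hlJ
    have h6 := R.len_mul_le (R.wordProd_mem_weyl hlJ) (R.wordProd_mem_weyl (halt m))
    have h7 := R.len_mul_le hu (mul_mem (R.wordProd_mem_weyl hlJ) (R.wordProd_mem_weyl (halt m)))
    rw [length_altWord] at h4
    rw [e, hn]
    omega
  rw [hwu, hT.map_mul_wordProd hu (halt p) (by rw [length_altWord, ← hwu]; omega)]
  exact map_mem_posPart (T u) u hdesc (hpos p hpm)

end DoubleRep

end double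

end QRootDatum

end

noncomputable section

namespace QRootDatum

variable {I Y X : Type*} [AddCommGroup Y] [AddCommGroup X] (R : QRootDatum I Y X)

/-! ### Duality between roots and coroots -/

theorem linearEquiv_one_apply {X : Type*} [AddCommGroup X] (x : X) : (1 : X ≃ₗ[ℤ] X) x = x := rfl

theorem inv_apply_of_apply_eq {X : Type*} [AddCommGroup X] {w : X ≃ₗ[ℤ] X} {x y : X}
    (h : w x = y) : w⁻¹ y = x := by
  rw [← h, ← LinearEquiv.mul_apply, inv_mul_cancel, linearEquiv_one_apply]

/-- `y` is the coweight that corresponds to `x` under the symmetric form. -/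
def IsDual (x : X) (y : Y) : Prop := ∀ k, R.pair y (R.α k) = R.eps k * R.pair (R.h k) x

theorem isDual_α (t : I) : R.IsDual (R.α t) (R.eps t • R.h t) := fun k => by
  rw [map_nsmul, LinearMap.smul_apply, nsmul_eq_mul]
  exact R.eps_mul_a_comm t k

variable {R} in
theorem IsDual.s {x : X} {y : Y} (h : R.IsDual x y) (k : I) : R.IsDual (R.s k x) (R.sY k y) := by
  intro l
  have h1 := R.eps_mul_a_comm k l
  unfold a at h1
  rw [pair_sY, s_apply, s_apply]
  simp only [map_sub, map_smul, smul_eq_mul, h l, h k]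
  linear_combination (-R.pair (R.h k) x) * h1

/-- The action of a word on coweights. -/
def coword (l : List I) (y : Y) : Y := l.foldr (fun k y => R.sY k y) y

theorem pair_coword (l : List I) (y : Y) (x : X) :
    R.pair (R.coword l y) (R.wordProd l x) = R.pair y x := by
  induction l with
  | nil => rfl
  | cons k l ih =>
    rw [wordProd_cons, LinearEquiv.mul_apply]
    change R.pair (R.sY k (R.coword l y)) _ = _
    rw [pair_sY, ← LinearEquiv.mul_apply, s_mul_self, linearEquiv_one_apply, ih]

theorem isDual_coword {x : X} {y : Y} (h : R.IsDual x y) (l : List I) :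
    R.IsDual (R.wordProd l x) (R.coword l y) := by
  induction l with
  | nil => exact h
  | cons k l ih =>
    rw [wordProd_cons]
    exact ih.s k

/-- Weyl invariance of the symmetric form. No form is available on X, so the argument goes through
dual coweights. -/
theorem eps_pair_weyl {J : Set I} {w : X ≃ₗ[ℤ] X} (hw : w ∈ R.weyl J) (j t : I) :
    R.eps j * R.pair (R.h j) (w (R.α t)) = R.eps t * R.pair (R.h t) (w⁻¹ (R.α j)) := by
  obtain ⟨l, -, rfl⟩ := R.exists_word hw
  rw [← R.isDual_coword (R.isDual_α t) l j]
  have h := R.pair_coword l (R.eps t • R.h t) ((R.wordProd l)⁻¹ (R.α j))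
  rw [← LinearEquiv.mul_apply, mul_inv_cancel, linearEquiv_one_apply] at h
  rw [h, map_nsmul, LinearMap.smul_apply, nsmul_eq_mul]

/-- The simple roots are linearly independent, so a weight determines the letters of a monomial up
to order. -/
theorem perm_of_sum_eq {l l' : List I} (h : (l.map R.α).sum = (l'.map R.α).sum) : l.Perm l' := by
  classical
  have key : ∀ l : List I, (l.map R.α).sum = Finsupp.linearCombination ℤ R.α
      (l.map fun k => Finsupp.single k (1 : ℤ)).sum := by
    intro l
    induction l with
    | nil => simp
    | cons k l ih => simp [ih]
  have hcount : ∀ (l : List I) (x : I),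
      (l.map fun k => Finsupp.single k (1 : ℤ)).sum x = l.count x := by
    intro l x
    induction l with
    | nil => simp
    | cons k l ih =>
      by_cases hk : k = x
      · subst hk; simp [ih, add_comm]
      · simp [ih, hk]
  rw [key, key] at h
  have h1 := R.indep_α h
  rw [List.perm_iff_count]
  intro x
  have := DFunLike.congr_fun h1 x
  rw [hcount, hcount] at this
  exact_mod_cast this

theorem α_ne_neg (i k : I) : R.α i ≠ -R.α k := by
  intro h
  have := R.perm_of_sum_eq (l := [i, k]) (l' := []) (by simp [h])
  simp at this

/-! ### Symmetries applied to E_j for j outside J -/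

section double

variable {𝔽 : Type*} [Field 𝔽] {v : 𝔽} {A : Type*} [Ring A] [Algebra 𝔽 A]

namespace DoubleRep

variable {R} {D : R.DoubleRep v A} {J : Set I} {T : (X ≃ₗ[ℤ] X) → (A →ₐ[𝔽] A)}

theorem exists_smul_of_mem_posPart {k : I} {x : A} (hx : x ∈ D.posPart J (R.α k)) :
    ∃ c : 𝔽, x = c • D.E k := by
  have : D.posPart J (R.α k) ≤ Submodule.span 𝔽 {D.E k} := by
    refine Submodule.span_le.2 ?_
    rintro x ⟨l, -, h, rfl⟩
    have h1 := R.perm_of_sum_eq (l := l) (l' := [k]) (by simpa using h)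
    rw [List.perm_singleton.1 h1]
    simp [monE]
  obtain ⟨c, hc⟩ := Submodule.mem_span_singleton.1 (this hx)
  exact ⟨c, hc.symm⟩

theorem eq_zero_of_mem_posPart_neg {k : I} {x : A} (hx : x ∈ D.posPart J (-R.α k)) : x = 0 := by
  have : D.posPart J (-R.α k) ≤ ⊥ := by
    refine Submodule.span_le.2 ?_
    rintro x ⟨l, -, h, rfl⟩
    have h1 := R.perm_of_sum_eq (l := k :: l) (l' := []) (by simp [h])
    simp at h1
  simpa using this hx

theorem exists_smul_of_mem_midPart {j : I} {x : A} (hx : x ∈ D.midPart J j (R.α j)) :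
    ∃ c : 𝔽, x = c • D.E j := by
  have : D.midPart J j (R.α j) ≤ Submodule.span 𝔽 {D.E j} := by
    refine Submodule.span_le.2 ?_
    rintro x ⟨l, l', -, -, h, rfl⟩
    have h1 := R.perm_of_sum_eq (l := l ++ (j :: l')) (l' := [j]) (by simpa [add_assoc] using h)
    have h2 := h1.length_eq
    simp only [List.length_append, List.length_cons, List.length_nil] at h2
    have h3 : l = [] := List.length_eq_zero_iff.1 (by omega)
    have h4 : l' = [] := List.length_eq_zero_iff.1 (by omega)
    subst h3 h4
    simp [monE]
  obtain ⟨c, hc⟩ := Submodule.mem_span_singleton.1 (this hx)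
  exact ⟨c, hc.symm⟩

/-- What commutes with all `Eₖ`, `k ∈ J`, commutes with the positive part. -/
theorem commute_of_mem_posPart {μ : X} {x y : A} (hx : x ∈ D.posPart J μ)
    (h : ∀ k ∈ J, Commute (D.E k) y) : Commute x y := by
  induction hx using Submodule.span_induction with
  | mem x hx =>
    obtain ⟨l, hl, -, rfl⟩ := hx
    refine Commute.list_prod_left _ _ fun z hz => ?_
    obtain ⟨k, hk, rfl⟩ := List.mem_map.1 hz
    exact h k (hl k hk)
  | zero => exact Commute.zero_left _
  | add x z _ _ hx hz => exact hx.add_left hz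
  | smul c x _ hx => exact hx.smul_left c

theorem commute_F_of_mem_posPart {μ : X} {x : A} (hx : x ∈ D.posPart J μ) {j : I} (hj : j ∉ J) :
    Commute x (D.F j) :=
  commute_of_mem_posPart hx fun _ hk => D.E_F_comm (ne_of_mem_of_not_mem hk hj)

/-- Scalars that are exponential in the weight of a generator multiply to the exponential of the
total weight. -/
theorem qcomm_of_mem_posPart {μ : X} {x y : A} (hx : x ∈ D.posPart J μ) {z : Y}
    (h : ∀ k ∈ J, D.E k * y = v ^ R.pair z (R.α k) • (y * D.E k)) :
    x * y = v ^ R.pair z μ • (y * x) := by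
  induction hx using Submodule.span_induction with
  | mem x hx =>
    obtain ⟨l, hl, rfl, rfl⟩ := hx
    induction l with
    | nil => simp [monE]
    | cons k l ih =>
      have h1 := ih fun m hm => hl m (by simp [hm])
      have h2 := h k (hl k (by simp))
      change D.E k * D.monE l * y = _ • (y * (D.E k * D.monE l))
      rw [mul_assoc, h1, mul_smul_comm, ← mul_assoc, h2, smul_mul_assoc, smul_smul,
        ← zpow_add₀ D.v_ne_zero, mul_assoc, List.map_cons, List.sum_cons, map_add, add_comm]
  | zero => simp
  | add a b _ _ ha hb => rw [add_mul, ha, hb, mul_add, smul_add]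
  | smul c a _ ha => rw [smul_mul_assoc, ha, mul_smul_comm, smul_comm]

theorem map_qad (f : A →ₐ[𝔽] A) (q : 𝔽) (n : ℤ) (e x : A) (m : ℕ) :
    f (qad q n e x m) = qad q n (f e) (f x) m := by
  induction m with
  | zero => rfl
  | succ m ih => simp only [qad, map_sub, map_mul, map_smul, ih]

theorem qad_mem_midPart {j : I} {β γ : X} {x y : A} (hx : x ∈ D.posPart J γ)
    (hy : y ∈ D.midPart J j β) (q : 𝔽) (n : ℤ) (m : ℕ) :
    qad q n x y m ∈ D.midPart J j (β + m • γ) := by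
  induction m with
  | zero => simpa [qad] using hy
  | succ m ih =>
    have h1 := mul_mem_midPart_left hx ih
    have h2 := mul_mem_midPart_right hx ih
    rw [add_comm, add_assoc, ← succ_nsmul] at h1
    rw [add_assoc, ← succ_nsmul] at h2
    exact sub_mem h1 (Submodule.smul_mem _ _ h2)

/-- The recursive structure of `T_w(Eⱼ)`. -/
theorem IsSymmFamily.map_E_step (hT : D.IsSymmFamily J T) {j t : I} (hj : j ∉ J) (ht : t ∈ J)
    {u : X ≃ₗ[ℤ] X} (hu : u ∈ R.weyl J) (hlen : R.len J u + 1 = R.len J (u * R.s t)) {n : ℕ}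
    (hn : R.a t j = -n) :
    T (u * R.s t) (D.E j) = (qfac (R.qv v t) n)⁻¹ •
      qad (R.qv v t) n (T u (D.E t)) (T u (D.E j)) n := by
  have h1 := hT.map_mul_wordProd hu (l := [t]) (by simpa using ht)
    (by simp [wordProd_cons, hlen]) (D.E j)
  rw [wordProd_cons, wordProd_nil, mul_one] at h1
  rw [h1, symmWord_cons, symmWord_nil,
    (hT.simple t ht).map_E (ne_of_mem_of_not_mem ht hj).symm hn, map_smul,
    map_qad]

theorem exists_nat_a {j t : I} (h : t ≠ j) : ∃ n : ℕ, R.a t j = -n :=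
  ⟨(-R.a t j).toNat, by have := R.a_nonpos h; omega⟩

theorem s_α_of_a {j t : I} {n : ℕ} (hn : R.a t j = -n) : R.s t (R.α j) = R.α j + n • R.α t := by
  have : R.pair (R.h t) (R.α j) = -n := hn
  rw [s_apply, this]
  module

theorem IsSymmFamily.map_E_mem_midPart (hT : D.IsSymmFamily J T)
    (hfin : (R.weyl J : Set (X ≃ₗ[ℤ] X)).Finite) {j : I} (hj : j ∉ J) {w : X ≃ₗ[ℤ] X}
    (hw : w ∈ R.weyl J) : T w (D.E j) ∈ D.midPart J j (w (R.α j)) := by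
  induction hm : R.len J w generalizing w with
  | zero =>
    obtain ⟨l, hl, rfl, hlw⟩ := R.exists_reduced_word hw
    rw [hm] at hlw
    rw [List.length_eq_zero_iff.1 hlw, wordProd_nil, hT.one_apply]
    exact E_mem_midPart J j
  | succ m ih =>
    obtain ⟨t, ht, u, hu, rfl, hlen⟩ := R.exists_descent hw (by omega)
    obtain ⟨n, hn⟩ := exists_nat_a (R := R) (j := j) (t := t) (ne_of_mem_of_not_mem ht hj)
    have h1 := hT.map_E_mem_posPart hfin hu ht (by omega)
    have h2 := ih hu (by omega)
    rw [hT.map_E_step hj ht hu hlen hn, LinearEquiv.mul_apply, s_α_of_a hn, map_add, map_nsmul]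
    exact Submodule.smul_mem _ _ (qad_mem_midPart h1 h2 _ _ _)

/-- `[x, Fⱼ] = z K̃ⱼ` for some `z` in the positive part. -/
def HasHalfComm (D : R.DoubleRep v A) (J : Set I) (j : I) (β : X) (x : A) : Prop :=
  ∃ z ∈ D.posPart J (β - R.α j), x * D.F j - D.F j * x = z * D.Kt j

theorem HasHalfComm.smul {j : I} {β : X} {x : A} (hx : HasHalfComm D J j β x) (c : 𝔽) :
    HasHalfComm D J j β (c • x) := by
  obtain ⟨z, hz, h⟩ := hx
  refine ⟨c • z, Submodule.smul_mem _ _ hz, ?_⟩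
  rw [smul_mul_assoc, mul_smul_comm, ← smul_sub, h, smul_mul_assoc]

theorem qcomm_F_comm {x y f : A} (c : 𝔽) (h : Commute x f) :
    (x * y - c • (y * x)) * f - f * (x * y - c • (y * x)) =
      x * (y * f - f * y) - c • ((y * f - f * y) * x) := by
  have e : ∀ z : A, x * (f * z) = f * (x * z) := fun z => by rw [← mul_assoc, h.eq, mul_assoc]
  simp only [sub_mul, mul_sub, smul_sub, smul_mul_assoc, mul_smul_comm, mul_assoc, e, h.eq]
  abel

/-- F_j commutes with x because j ∉ J, and K̃_j moves past x at the cost of a scalar. -/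
theorem HasHalfComm.qcomm {j : I} (hj : j ∉ J) {β γ : X} {x y : A} (hy : HasHalfComm D J j β y)
    (hx : x ∈ D.posPart J γ) (c : 𝔽) : HasHalfComm D J j (β + γ) (x * y - c • (y * x)) := by
  obtain ⟨z, hz, h⟩ := hy
  have hK := (hasWt_of_mem_posPart hx).Kt_mul j
  refine ⟨x * z - (c * R.qv v j ^ R.pair (R.h j) γ) • (z * x),
    E_mul_sub_mem_posPart hx hz (by module) _, ?_⟩
  rw [qcomm_F_comm c (commute_F_of_mem_posPart hx hj), h, mul_assoc z, hK, sub_mul]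
  simp only [smul_mul_assoc, mul_smul_comm, smul_smul, mul_assoc]

theorem HasHalfComm.qad {j : I} (hj : j ∉ J) {β γ : X} {x y : A} (hy : HasHalfComm D J j β y)
    (hx : x ∈ D.posPart J γ) (q : 𝔽) (n : ℤ) (m : ℕ) :
    HasHalfComm D J j (β + m • γ) (qad q n x y m) := by
  induction m with
  | zero => simpa [_root_.qad] using hy
  | succ m ih =>
    have := ih.qcomm hj hx (q ^ (2 * (m : ℤ) - n))
    rwa [add_assoc, ← succ_nsmul] at this

/-- The first `q`-commutator with `Eⱼ` removes the `K̃'ⱼ` part. -/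
theorem hasHalfComm_qcomm_E {j : I} (hj : j ∉ J) {γ : X} {x : A} (hx : x ∈ D.posPart J γ) :
    HasHalfComm D J j (R.α j + γ)
      (x * D.E j - R.qv v j ^ R.pair (R.h j) γ • (D.E j * x)) := by
  have hq := (D.generic j).1
  have hEF : D.E j * D.F j - D.F j * D.E j =
    (R.qv v j - (R.qv v j)⁻¹)⁻¹ • (D.Kt j - D.Ktp j) := sub_eq_iff_eq_add'.2 (D.E_mul_F_same j)
  have hK := (hasWt_of_mem_posPart hx).Kt_mul j
  have hK' := (hasWt_of_mem_posPart hx).Ktp_mul j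
  set m := R.pair (R.h j) γ
  refine ⟨((R.qv v j - (R.qv v j)⁻¹)⁻¹ * (1 - R.qv v j ^ m * R.qv v j ^ m)) • x,
    Submodule.smul_mem _ _ (by simpa using hx), ?_⟩
  rw [qcomm_F_comm _ (commute_F_of_mem_posPart hx hj), hEF]
  simp only [smul_mul_assoc, mul_smul_comm, sub_mul, mul_sub, hK, hK', smul_sub, smul_smul]
  have e : R.qv v j ^ m * R.qv v j ^ (-m) = 1 := by rw [← zpow_add₀ hq]; simp
  have e2 : R.qv v j ^ m * ((R.qv v j - (R.qv v j)⁻¹)⁻¹ * R.qv v j ^ (-m)) =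
    (R.qv v j - (R.qv v j)⁻¹)⁻¹ := by linear_combination (R.qv v j - (R.qv v j)⁻¹)⁻¹ * e
  rw [e2]
  module

/-- Follow a reduced word of w. While the prefix fixes α_j, the image of E_j is a multiple of E_j.
At the first letter that moves α_j, the first q-commutator has exactly the twist that cancels K̃'_j.
All later q-commutators keep the form z K̃_j. -/
theorem IsSymmFamily.hasHalfComm (hT : D.IsSymmFamily J T)
    (hfin : (R.weyl J : Set (X ≃ₗ[ℤ] X)).Finite) {j : I} (hj : j ∉ J) {w : X ≃ₗ[ℤ] X}
    (hw : w ∈ R.weyl J) (hne : w (R.α j) ≠ R.α j) :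
    HasHalfComm D J j (w (R.α j)) (T w (D.E j)) := by
  induction hm : R.len J w generalizing w with
  | zero =>
    obtain ⟨l, hl, rfl, hlw⟩ := R.exists_reduced_word hw
    rw [hm] at hlw
    rw [List.length_eq_zero_iff.1 hlw] at hne
    exact absurd rfl hne
  | succ m ih =>
    obtain ⟨t, ht, u, hu, rfl, hlen⟩ := R.exists_descent hw (by omega)
    obtain ⟨n, hn⟩ := exists_nat_a (R := R) (j := j) (t := t) (ne_of_mem_of_not_mem ht hj)
    have h1 := hT.map_E_mem_posPart hfin hu ht (by omega)
    rw [LinearEquiv.mul_apply, s_α_of_a hn, map_add, map_nsmul] at hne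
    rw [hT.map_E_step hj ht hu hlen hn, LinearEquiv.mul_apply, s_α_of_a hn, map_add, map_nsmul]
    refine HasHalfComm.smul ?_ _
    by_cases huj : u (R.α j) = R.α j
    · obtain ⟨c, hc⟩ := exists_smul_of_mem_midPart (huj ▸ hT.map_E_mem_midPart hfin hj hu)
      obtain ⟨n, rfl⟩ : ∃ n', n = n' + 1 := by
        refine Nat.exists_eq_succ_of_ne_zero ?_
        rintro rfl
        simp [huj] at hne
      -- The twist in Lusztig's formula equals the one required by `hasHalfComm_qcomm_E`, by
      -- invariance of the form and u α_j = α_j.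
      have hpair : R.qv v t ^ (-((n + 1 : ℕ) : ℤ)) = R.qv v j ^ R.pair (R.h j) (u (R.α t)) := by
        rw [qv_zpow, qv_zpow, R.eps_pair_weyl hu, ← hn]
        rw [inv_apply_of_apply_eq huj]
        rfl
      have key : ∀ m : ℕ, HasHalfComm D J j (R.α j + (m + 1) • u (R.α t))
          (_root_.qad (R.qv v t) ((n + 1 : ℕ) : ℤ) (T u (D.E t)) (D.E j) (m + 1)) := by
        intro m
        induction m with
        | zero =>
          have := hasHalfComm_qcomm_E (D := D) hj h1
          rw [← hpair] at this
          simpa [_root_.qad] using this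
        | succ m ih =>
          have := ih.qcomm hj h1 (R.qv v t ^ (2 * ((m + 1 : ℕ) : ℤ) - ((n + 1 : ℕ) : ℤ)))
          rwa [add_assoc, ← succ_nsmul] at this
      have hlin : ∀ m : ℕ, _root_.qad (R.qv v t) ((n + 1 : ℕ) : ℤ) (T u (D.E t)) (c • D.E j) m =
          c • _root_.qad (R.qv v t) ((n + 1 : ℕ) : ℤ) (T u (D.E t)) (D.E j) m := by
        intro m
        induction m with
        | zero => rfl
        | succ m ih =>
          simp only [_root_.qad, ih, mul_smul_comm, smul_mul_assoc, smul_sub, smul_comm c]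
      rw [huj, hc, hlin]
      exact (key n).smul c
    · exact (ih hu huj (by omega)).qad hj h1 _ _ _

end DoubleRep

end double

end QRootDatum

end

/-! ### Admissible pairs and T_{w_•}(E_j) -/

noncomputable section

namespace QRootDatum

variable {I Y X : Type*} [AddCommGroup Y] [AddCommGroup X] {R : QRootDatum I Y X}

namespace AdmissiblePair

variable (P : R.AdmissiblePair)

theorem eps_τ (k : I) : R.eps (P.τ k) = R.eps k := by
  have h := R.eps_cast (P.τ k)
  rw [P.τ_form, ← R.eps_cast] at h
  omega

theorem τ_mem_black {k : I} (hk : k ∈ P.black) : P.τ k ∈ P.black := by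
  rw [← P.τ_black]
  exact ⟨k, hk, rfl⟩

theorem w0_α_τ {k : I} (hk : k ∈ P.black) : P.w0 (R.α (P.τ k)) = -R.α k := by
  have h := P.τ_w0 _ (P.τ_mem_black hk)
  rw [P.τ_invol] at h
  rw [h, neg_neg]

theorem eps_pair_w0 {k j : I} (hk : k ∈ P.black) :
    R.eps k * R.pair (R.h k) (P.w0 (R.α j)) = -(R.eps k * R.a (P.τ k) j) := by
  have h := inv_apply_of_apply_eq (P.w0_α_τ hk)
  rw [map_neg] at h
  rw [R.eps_pair_weyl P.longest.1, ← neg_neg (P.w0⁻¹ (R.α k)), h, map_neg, mul_neg,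
    ← P.eps_τ k, R.eps_mul_a_comm]
  rfl

variable {P} {i : I} (hτ : P.τ i = i) (hw : P.w0 (R.α i) = R.α i)

include hτ hw in
theorem notMem_black_of_fixed : i ∉ P.black := fun hi => by
  have h := P.τ_w0 i hi
  rw [hτ, hw] at h
  exact R.α_ne_neg i i h

-- Since w_• = -τ on the black roots and fixes α_i, a_ki = -a_(τk)i. Both entries are nonpositive,
-- so both vanish.
include hτ hw in
theorem a_eq_zero_of_fixed {k : I} (hk : k ∈ P.black) : R.a k i = 0 ∧ R.a i k = 0 := by
  have hi := notMem_black_of_fixed hτ hw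
  have h1 := P.eps_pair_w0 (j := i) hk
  rw [hw] at h1
  have h2 := R.a_nonpos (ne_of_mem_of_not_mem hk hi)
  have h3 := R.a_nonpos (ne_of_mem_of_not_mem (P.τ_mem_black hk) hi)
  have h4 := R.eps_pos k
  have h5 : R.a k i = -R.a (P.τ k) i := by
    have h6 : (R.eps k : ℤ) ≠ 0 := by omega
    exact mul_left_cancel₀ h6 (by rw [mul_neg]; exact h1)
  have h6 : R.a k i = 0 := by omega
  refine ⟨h6, ?_⟩
  have h7 := R.eps_mul_a_comm k i
  rw [h6, mul_zero] at h7
  exact (mul_eq_zero.1 h7.symm).resolve_left (by have := R.eps_pos i; omega)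

end AdmissiblePair

section double

variable {𝔽 : Type*} [Field 𝔽] {v : 𝔽} {A : Type*} [Ring A] [Algebra 𝔽 A]

namespace DoubleRep

variable {D : R.DoubleRep v A} {J : Set I} {T : (X ≃ₗ[ℤ] X) → (A →ₐ[𝔽] A)}

theorem zpow_ne_one (D : R.DoubleRep v A) {a : ℤ} (ha : a ≠ 0) : v ^ a ≠ 1 := by
  intro h
  refine D.v_pow_ne_one a.natAbs (by omega) ?_
  rcases Int.natAbs_eq a with h1 | h1
  · rw [h1, zpow_natCast] at h
    exact h
  · rw [h1, zpow_neg, inv_eq_one, zpow_natCast] at h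
    exact h

theorem IsSymmFamily.exists_coword (hT : D.IsSymmFamily J T) {w : X ≃ₗ[ℤ] X}
    (hw : w ∈ R.weyl J) : ∃ l : List I, R.wordProd l = w ∧
      (∀ y, T w (D.K y) = D.K (R.coword l y)) ∧ ∀ y, T w (D.Kp y) = D.Kp (R.coword l y) := by
  obtain ⟨l, hl, rfl, hlen⟩ := R.exists_reduced_word hw
  refine ⟨l, rfl, ?_⟩
  rw [hT.reduced l hl hlen.symm]
  clear hlen hw
  induction l with
  | nil => exact ⟨fun y => rfl, fun y => rfl⟩
  | cons k l ih =>
    obtain ⟨h1, h2⟩ := ih fun m hm => hl m (by simp [hm])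
    have hk := hT.simple k (hl k (by simp))
    constructor
    · intro y
      rw [symmWord_cons, h1, hk.K]; rfl
    · intro y
      rw [symmWord_cons, h2, hk.Kp]; rfl

/-- K_y and K'_y rescale E_m by inverse powers of v, which differ because v is not a root of unity.
-/
theorem E_eq_zero_of_K_eq_Kp {y : Y} {m : I} (h : D.K y = D.Kp y) (hm : R.pair y (R.α m) ≠ 0) :
    D.E m = 0 := by
  have h1 := D.K_E y m
  have h2 := D.Kp_E y m
  rw [← h, h1, ← sub_eq_zero, ← sub_smul] at h2
  have h3 : v ^ R.pair y (R.α m) - v ^ (-R.pair y (R.α m)) ≠ 0 := by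
    intro h4
    have h5 : v ^ (2 * R.pair y (R.α m)) = 1 := by
      rw [two_mul, zpow_add₀ D.v_ne_zero]
      nth_rewrite 1 [sub_eq_zero.1 h4]
      rw [← zpow_add₀ D.v_ne_zero]
      simp
    exact D.zpow_ne_one (by omega) h5
  have h4 := (smul_eq_zero_iff_right h3).1 h2
  calc D.E m = D.E m * D.K y * D.K (-y) := by
        rw [mul_assoc, ← D.K_add, add_neg_cancel, D.K_zero, mul_one]
    _ = 0 := by rw [h4, zero_mul]

/-- If T_w kills E_k, it kills [E_k, F_k], which forces K = K' at the image of ε_k h_k. This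
replaces the nondegeneracy of the algebra in later arguments. -/
theorem IsSymmFamily.E_eq_zero (hT : D.IsSymmFamily J T) {w : X ≃ₗ[ℤ] X} (hw : w ∈ R.weyl J)
    {k m : I} (h0 : T w (D.E k) = 0) (hm : R.pair (R.h k) (w⁻¹ (R.α m)) ≠ 0) : D.E m = 0 := by
  obtain ⟨l, rfl, hK, hKp⟩ := hT.exists_coword hw
  refine E_eq_zero_of_K_eq_Kp (D := D) (y := R.coword l (R.eps k • R.h k)) ?_ ?_
  · have h1 := congrArg (T (R.wordProd l)) (D.E_mul_F_same k)
    rw [map_add, map_mul, map_mul, h0, zero_mul, mul_zero, zero_add, map_smul, map_sub,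
      ← D.K_nsmul, ← D.Kp_nsmul, hK, hKp] at h1
    have hq := D.generic k
    have h2 : (R.qv v k - (R.qv v k)⁻¹)⁻¹ ≠ 0 := by
      refine inv_ne_zero fun h3 => ?_
      have h4 := hq.2 0
      rw [qn] at h4
      refine h4 ?_
      rw [h3, div_zero]
    exact sub_eq_zero.1 ((smul_eq_zero_iff_right h2).1 h1.symm)
  · have h := R.pair_coword l (R.eps k • R.h k) ((R.wordProd l)⁻¹ (R.α m))
    rw [← LinearEquiv.mul_apply, mul_inv_cancel, linearEquiv_one_apply] at h
    rw [h, map_nsmul, LinearMap.smul_apply, nsmul_eq_mul]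
    have := R.eps_pos k
    exact mul_ne_zero (by omega) hm

/-- Apply S to [E_j, F_k] = 0; as S(F_k) = -K̃_k⁻¹ E_k, this becomes a q-commutation relation. -/
theorem IsSimpleSymm.E_mul_map_E {k j : I} {S : A →ₐ[𝔽] A} (hS : D.IsSimpleSymm k S) (hjk : j ≠ k) :
    D.E k * S (D.E j) = R.qv v k ^ (-R.a k j) • (S (D.E j) * D.E k) := by
  have h1 := congrArg S (D.E_F_comm hjk).eq
  have hw : D.HasWt (R.s k (R.α j)) (S (D.E j)) := hS.hasWt (D.hasWt_E j)
  have hp : R.pair (R.h k) (R.s k (R.α j)) = -R.a k j := by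
    rw [s_apply, map_sub, map_smul, R.a_self, a, smul_eq_mul]
    ring
  have h2 := hw.K (R.eps k • -R.h k)
  rw [D.K_nsmul, map_nsmul, map_neg, LinearMap.smul_apply, LinearMap.neg_apply, hp, neg_neg,
    nsmul_eq_mul] at h2
  change D.KtInv k * _ = _ • (_ * D.KtInv k) at h2
  rw [map_mul, map_mul, hS.F_same, mul_neg, neg_mul, neg_inj, mul_assoc] at h1
  have h3 : D.Kt k * D.KtInv k = 1 := by
    rw [Kt_eq, KtInv, ← D.K_nsmul, ← D.K_add, smul_neg, add_neg_cancel, D.K_zero]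
  have h4 : D.KtInv k * (D.E k * S (D.E j)) =
      D.KtInv k * (R.qv v k ^ (-R.a k j) • (S (D.E j) * D.E k)) := by
    rw [← h1, mul_smul_comm, ← mul_assoc, ← mul_assoc, h2, smul_mul_assoc, smul_smul, qv_zpow,
      ← zpow_add₀ D.v_ne_zero, mul_neg, neg_add_cancel, zpow_zero, one_smul]
  calc _ = D.Kt k * (D.KtInv k * (D.E k * S (D.E j))) := by rw [← mul_assoc, h3, one_mul]
    _ = _ := by rw [h4, ← mul_assoc, h3, one_mul]

variable {P : R.AdmissiblePair}

/-- The elements `Eₖ`, `k ∈ I_•`, `q`-commute with `T_{w_•}(Eⱼ)`. -/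
theorem IsSymmFamily.E_mul_longest (hT : D.IsSymmFamily P.black T) {k j : I} (hk : k ∈ P.black)
    (hj : j ∉ P.black) :
    D.E k * T P.w0 (D.E j) =
      v ^ ((R.eps k : ℤ) * R.pair (R.h k) (P.w0 (R.α j))) • (T P.w0 (D.E j) * D.E k) := by
  have hw0 := P.longest.1
  have hτk := P.τ_mem_black hk
  have hs := R.s_mem_weyl hτk
  have hα := P.w0_α_τ hk
  by_cases hE : D.E k = 0
  · simp [hE]
  by_cases hlen : R.len P.black (P.w0 * R.s (P.τ k)) < R.len P.black P.w0
  · have hu := mul_mem hw0 hs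
    set u := P.w0 * R.s (P.τ k) with hudef
    have husu : u * R.s (P.τ k) = P.w0 := by rw [hudef, mul_assoc, s_mul_self, mul_one]
    have huα : u (R.α (P.τ k)) = R.α k := by
      rw [hudef, LinearEquiv.mul_apply, s_α_self, map_neg, hα, neg_neg]
    have hge := R.len_le_len_mul_s_add_one hw0 hτk
    obtain ⟨c, hc⟩ := exists_smul_of_mem_posPart
      (huα ▸ hT.map_E_mem_posPart P.finite_type hu hτk (by rw [husu]; omega))
    -- Here T_u(E_{τk}) = c E_k, so the rank-one relation for τk, transported by T_u, becomes the
    -- claim after cancelling c.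
    have hc0 : c ≠ 0 := by
      rintro rfl
      rw [zero_smul] at hc
      refine hE (hT.E_eq_zero hu hc ?_)
      rw [inv_apply_of_apply_eq huα, R.a_self]
      norm_num
    have h1 := hT.map_mul_wordProd hu (l := [P.τ k]) (by simpa using hτk) (by
      rw [wordProd_cons, wordProd_nil, mul_one, husu, List.length_singleton]; omega) (D.E j)
    rw [wordProd_cons, wordProd_nil, mul_one, husu, symmWord_cons, symmWord_nil] at h1
    have h2 := congrArg (T u) ((hT.simple _ hτk).E_mul_map_E (ne_of_mem_of_not_mem hτk hj).symm)
    rw [map_smul, map_mul, map_mul, ← h1, hc, smul_mul_assoc, mul_smul_comm, smul_comm] at h2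
    have h3 := smul_right_injective A hc0 h2
    rw [h3, P.eps_pair_w0 hk, qv_zpow, P.eps_τ, mul_neg]
  -- If s_{τk} were not a descent of w_•, then T_{w_•}(E_{τk}) would be in the positive part of
  -- weight -α_k, hence zero, and so would E_k.
  · exfalso
    have h0 := eq_zero_of_mem_posPart_neg
      (hα ▸ hT.map_E_mem_posPart P.finite_type hw0 hτk hlen)
    refine hE (hT.E_eq_zero hw0 h0 ?_)
    have h := inv_apply_of_apply_eq hα
    rw [map_neg] at h
    rw [← neg_neg (P.w0⁻¹ (R.α k)), h, map_neg, R.a_self]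
    norm_num

/-- Elements of weight `w_•(αⱼ) - αⱼ` of the positive part commute with
`T_{w_•}(Eⱼ) K̃'ⱼ`. -/
theorem IsSymmFamily.commute_longest (hT : D.IsSymmFamily P.black T) {j : I} (hj : j ∉ P.black)
    {z : A} (hz : z ∈ D.posPart P.black (P.w0 (R.α j) - R.α j)) :
    Commute z (T P.w0 (D.E j) * D.Ktp j) := by
  obtain ⟨l, -, hl⟩ := R.exists_word P.longest.1
  have hdual := R.isDual_coword (R.isDual_α j) l
  set y0 := R.coword l (R.eps j • R.h j) with hy0
  rw [hl] at hdual
  have h1 : z * T P.w0 (D.E j) = _ := qcomm_of_mem_posPart (D := D) hz (z := y0) fun k hk => by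
    rw [hT.E_mul_longest hk hj, hdual k]
  have h2 := (hasWt_of_mem_posPart hz).Ktp_mul j
  have h3 : z * D.Ktp j = R.qv v j ^ R.pair (R.h j) (P.w0 (R.α j) - R.α j) • (D.Ktp j * z) := by
    rw [h2, smul_smul, ← zpow_add₀ (D.generic j).1, add_neg_cancel, zpow_zero, one_smul]
  -- In terms of the form this is (w_•α_j + α_j, w_•α_j - α_j) = 0: w_• preserves the length of α_j.
  have h4 : R.pair y0 (P.w0 (R.α j) - R.α j) +
      R.eps j * R.pair (R.h j) (P.w0 (R.α j) - R.α j) = 0 := by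
    have h5 := R.pair_coword l (R.eps j • R.h j) (R.α j)
    rw [hl, ← hy0, map_nsmul, LinearMap.smul_apply, nsmul_eq_mul] at h5
    rw [map_sub, map_sub, h5, hdual j]
    ring
  rw [Commute, SemiconjBy, ← mul_assoc, h1, smul_mul_assoc, mul_assoc, h3, mul_smul_comm, smul_smul,
    qv_zpow, ← zpow_add₀ D.v_ne_zero, h4, zpow_zero, one_smul, mul_assoc]

theorem commute_fixed {i : I} (hτ : P.τ i = i) (hw : P.w0 (R.α i) = R.α i) {μ : X} {z : A}
    (hz : z ∈ D.posPart P.black μ) (c : 𝔽) : Commute z (D.F i + c • D.E i * D.Ktp i) := by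
  have hi := AdmissiblePair.notMem_black_of_fixed hτ hw
  refine commute_of_mem_posPart hz fun k hk => ?_
  obtain ⟨h1, h2⟩ := AdmissiblePair.a_eq_zero_of_fixed hτ hw hk
  have hki : k ≠ i := ne_of_mem_of_not_mem hk hi
  refine (D.E_F_comm hki).add_right (((D.E_comm hki h1).smul_right c).mul_right ?_)
  have h3 := (D.hasWt_E k).Ktp_mul i
  change _ = R.qv v i ^ (-R.a i k) • _ at h3
  rw [h2, neg_zero, zpow_zero, one_smul] at h3
  exact h3.symm

/-- The commutation relation of the two summands of `Bⱼ`, when `w_• j ≠ j`. -/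
theorem F_mul_eq_of_hasHalfComm {j : I} {x z : A}
    (hx : x * D.F j - D.F j * x = z * D.Kt j) :
    D.F j * (x * D.Ktp j) = R.qv v j ^ (-2 : ℤ) • ((x * D.Ktp j) * D.F j) +
      -(z * (D.Kt j * D.Ktp j)) := by
  have h1 := (D.hasWt_F j).Ktp_mul j
  rw [map_neg, R.a_self, neg_neg] at h1
  rw [mul_assoc x, h1, mul_smul_comm, smul_smul, ← zpow_add₀ (D.generic j).1]
  norm_num
  rw [← mul_assoc z, ← hx, sub_mul]
  simp only [mul_assoc]
  abel

end DoubleRep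

end double

end QRootDatum

end

/-! ### Transfer of Serre relations and split ıdivided powers -/

noncomputable section

section Transfer

variable {𝔽 A : Type*} [Field 𝔽] [Ring A] [Algebra 𝔽 A]

open Finset

/-- Each u_r is built from b and the central κ. -/
theorem DividedRec.commute_seq {q : 𝔽} (hq : QGeneric q) {b κ w : A} {θ : ℕ → 𝔽} {u : ℕ → A}
    (h : DividedRec q b κ θ u) (h0 : u 0 = 1) (hκ : ∀ y : A, Commute κ y) (hw : Commute w b)
    (r : ℕ) : Commute w (u r) := by
  induction r using Nat.strong_induction_on with
  | _ r ih =>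
    cases r with
    | zero => rw [h0]; exact Commute.one_right w
    | succ r =>
      have h1 : u (r + 1) = (qn q (r + 1))⁻¹ • (b * u r - (θ r * qn q r) • (κ * u (r - 1))) := by
        rw [h.step r, add_sub_cancel_right, smul_smul, inv_mul_cancel₀ (hq.2 r), one_smul]
      rw [h1]
      refine Commute.smul_right (Commute.sub_right (hw.mul_right (ih r (by omega)))
        (Commute.smul_right ((hκ w).symm.mul_right (ih (r - 1) (by omega))) _)) _

theorem serreSum_add (u v : ℕ → A) (N : ℕ) (x y : A) :
    serreSum u v N (x + y) = serreSum u v N x + serreSum u v N y := by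
  simp only [serreSum, mul_add, add_mul, sum_add_distrib]

theorem serreSum_smul (u v : ℕ → A) (N : ℕ) (c : 𝔽) (x : A) :
    serreSum u v N (c • x) = c • serreSum u v N x := by
  simp only [serreSum, mul_smul_comm, smul_mul_assoc, smul_sum]

theorem serreSum_mul_left (u v : ℕ → A) (N : ℕ) {w : A} (hw : ∀ r, Commute w (u r)) (x : A) :
    serreSum u v N (w * x) = w * serreSum u v N x := by
  rw [serreSum, serreSum, mul_sum]
  refine sum_congr rfl fun rs _ => ?_
  have h : Commute w ((-1) ^ rs.1 * u rs.1) :=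
    ((Commute.neg_one_right w).pow_right _).mul_right (hw _)
  rw [← mul_assoc, ← h.eq]
  simp only [mul_assoc]

/-- The parity coefficient: `1` if `r` has parity `p`, and `0` otherwise. -/
def parityCoeff (𝔽 : Type*) [Field 𝔽] (p : ZMod 2) (r : ℕ) : 𝔽 := if (r : ZMod 2) = p then 1 else 0

theorem zmod_two_add_one_eq_iff (a p : ZMod 2) : a + 1 = p ↔ a ≠ p := by
  revert a p; decide

theorem parityCoeff_succ (p : ZMod 2) (r : ℕ) :
    parityCoeff 𝔽 p (r + 1) = 1 - parityCoeff 𝔽 p r := by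
  unfold parityCoeff
  rw [Nat.cast_succ]
  by_cases h : (r : ZMod 2) = p
  · rw [if_neg fun h' => (zmod_two_add_one_eq_iff _ _).1 h' h, if_pos h, sub_self]
  · rw [if_pos ((zmod_two_add_one_eq_iff _ _).2 h), if_neg h, sub_zero]

theorem parityCoeff_mul (p : ZMod 2) (r : ℕ) :
    parityCoeff 𝔽 p r * (1 - parityCoeff 𝔽 p r) = 0 := by
  unfold parityCoeff
  split_ifs <;> simp

/-- The parity shift by n a_ij in the Serre sum is exactly what makes the coefficients on the two
sides complementary. -/
theorem parityCoeff_add (p : ZMod 2) {r s N : ℕ} (h : r + s = 1 + N) :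
    parityCoeff 𝔽 (p + (N : ZMod 2)) s = 1 - parityCoeff 𝔽 p r := by
  have h' : (r : ZMod 2) + s = 1 + N := by exact_mod_cast congrArg (Nat.cast (R := ZMod 2)) h
  rw [← parityCoeff_succ, parityCoeff, parityCoeff]
  congr 1
  rw [Nat.cast_succ]
  generalize (r : ZMod 2) = r at *
  generalize (s : ZMod 2) = s at *
  generalize (N : ZMod 2) = N at *
  revert r s N p
  decide

theorem natCast_zmod_two_add_two_mul (n k m : ℕ) :
    (((n + 2 * k) * m : ℕ) : ZMod 2) = ((n * m : ℕ) : ZMod 2) := by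
  have h2 : (2 : ZMod 2) = 0 := rfl
  push_cast
  rw [h2]
  ring

/-- The higher Serre relations of degree `n` persist from `n` to `n + 2k`. -/
theorem serreSum_shift {q : 𝔽} (hq : QGeneric q) {b κ : A} {u : ZMod 2 → ℕ → A}
    (hu : ∀ p, DividedRec q b κ (parityCoeff 𝔽 p) (u p)) (hκ : ∀ y : A, Commute κ y)
    (p : ZMod 2) (m n k : ℕ) {x : A}
    (hx : serreSum (u p) (u (p + ((n * m : ℕ) : ZMod 2))) (1 + n * m) x = 0) :
    serreSum (u p) (u (p + (((n + 2 * k) * m : ℕ) : ZMod 2))) (1 + (n + 2 * k) * m) x = 0 := by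
  rw [natCast_zmod_two_add_two_mul,
    show 1 + (n + 2 * k) * m = 1 + n * m + 2 * (k * m) by ring]
  generalize k * m = l
  induction l with
  | zero => exact hx
  | succ l ih =>
    refine serreSum_eq_zero_add_two hq (hu p) (hu _) hκ (parityCoeff_succ p) (parityCoeff_mul p)
      (parityCoeff_succ _) (parityCoeff_mul _) (1 + n * m + 2 * l) (fun r s hrs => ?_) ih
    have h2 : (2 : ZMod 2) = 0 := rfl
    have e : ((n * m : ℕ) : ZMod 2) = ((n * m + 2 * l : ℕ) : ZMod 2) := by
      push_cast
      rw [h2]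
      ring
    rw [e]
    exact parityCoeff_add p (by omega)

/-- The two forms of the higher Serre relations are equivalent for two sequences that agree up to
scalars and lower terms. -/
theorem serreSum_pow_iff {q : 𝔽} (hq : QGeneric q) {b κ : A} {u : ZMod 2 → ℕ → A}
    (hu : ∀ p, DividedRec q b κ (parityCoeff 𝔽 p) (u p)) (hu0 : ∀ p, u p 0 = 1)
    (hκ : ∀ y : A, Commute κ y) (p : ZMod 2) (m : ℕ) {C : Subalgebra 𝔽 A}
    (hC : ∀ w ∈ C, Commute w b) {y : A} {D : ℕ → A}
    (hD : ∀ n, ∃ c : 𝔽, c ≠ 0 ∧ D n - c • y ^ n ∈ lowerSpan C y n) :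
    (∀ n, serreSum (u p) (u (p + ((n * m : ℕ) : ZMod 2))) (1 + n * m) (y ^ n) = 0) ↔
      ∀ n, serreSum (u p) (u (p + ((n * m : ℕ) : ZMod 2))) (1 + n * m) (D n) = 0 := by
  have key : ∀ n, (∀ n' < n,
      serreSum (u p) (u (p + ((n' * m : ℕ) : ZMod 2))) (1 + n' * m) (y ^ n') = 0) →
      ∀ z ∈ lowerSpan C y n,
        serreSum (u p) (u (p + ((n * m : ℕ) : ZMod 2))) (1 + n * m) z = 0 := by
    intro n hn z hz
    induction hz using Submodule.span_induction with
    | mem z hz =>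
      obtain ⟨w, hw, l, k, rfl, rfl⟩ := hz
      -- Pull w out of the sum; the remaining sum applied to y^l vanishes in degree l, hence also in
      -- degree l + 2(k+1).
      rw [serreSum_mul_left _ _ _ fun r => (hu p).commute_seq hq (hu0 p) hκ (hC w hw) r,
        serreSum_shift hq hu hκ p m l (k + 1) (hn l (by omega)), mul_zero]
    | zero => simp [serreSum]
    | add a b _ _ ha hb => rw [serreSum_add, ha, hb, add_zero]
    | smul c a _ ha => rw [serreSum_smul, ha, smul_zero]
  constructor
  · intro h n
    obtain ⟨c, -, hc⟩ := hD n
    rw [← sub_add_cancel (D n) (c • y ^ n), serreSum_add, key n (fun l _ => h l) _ hc,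
      serreSum_smul, h n, smul_zero, add_zero]
  -- In this direction the power relations in lower degree are not given, so strong induction
  -- supplies them.
  · intro h n
    induction n using Nat.strong_induction_on with
    | _ n ih =>
      obtain ⟨c, hc0, hc⟩ := hD n
      have h1 := h n
      rw [← sub_add_cancel (D n) (c • y ^ n), serreSum_add, key n ih _ hc, serreSum_smul,
        zero_add] at h1
      exact (smul_eq_zero_iff_right hc0).1 h1

/-! ### The divided powers in the split case -/

/-- The factor `b² - q [c]² κ`. -/
def splitFactor (q : 𝔽) (b κ : A) (c : ℤ) : A := b ^ 2 - (q * qn q c ^ 2) • κ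

/-- The numerators of the `ı`-divided powers of parity `t` in the split case. -/
def splitNum (q : 𝔽) (b κ : A) (t : ZMod 2) (m : ℕ) : A :=
  if t = 1 then
    if Odd m then
      b * ((List.range (m / 2)).map fun l : ℕ => splitFactor q b κ (2 * ((l : ℤ) + 1) - 1)).prod
    else ((List.range (m / 2)).map fun l : ℕ => splitFactor q b κ (2 * ((l : ℤ) + 1) - 1)).prod
  else
    if Odd m then
      b * ((List.range (m / 2)).map fun l : ℕ => splitFactor q b κ (2 * ((l : ℤ) + 1))).prod
    else ((List.range (m / 2)).map fun l : ℕ => splitFactor q b κ (2 * ((l : ℤ) + 1) - 2)).prod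

theorem commute_splitFactor (q : 𝔽) {b κ : A} (hκ : ∀ y : A, Commute κ y) (c : ℤ) :
    Commute b (splitFactor q b κ c) :=
  ((Commute.refl b).pow_right 2).sub_right ((hκ b).symm.smul_right _)

theorem commute_splitProd (q : 𝔽) {b κ : A} (hκ : ∀ y : A, Commute κ y) (f : ℕ → ℤ) (k : ℕ) :
    Commute b ((List.range k).map fun l => splitFactor q b κ (f l)).prod := by
  refine Commute.list_prod_right _ _ fun z hz => ?_
  obtain ⟨l, -, rfl⟩ := List.mem_map.1 hz
  exact commute_splitFactor q hκ _

/-- If r does not have parity t, the next numerator is just b times the current one. If it does,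
passing from r - 1 to r + 1 multiplies by b² - q[r]²κ, which produces the correction. -/
theorem splitNum_step {q : 𝔽} {b κ : A} (hκ : ∀ y : A, Commute κ y) (t : ZMod 2) (r : ℕ) :
    b * splitNum q b κ t r = splitNum q b κ t (r + 1) +
      (parityCoeff 𝔽 t r * qn q r ^ 2) • (q • κ * splitNum q b κ t (r - 1)) := by
  have e0 : ∀ x : ℤ, 2 * (x + 1 + 1) - 2 = 2 * (x + 1) := fun x => by ring
  have hc := commute_splitProd q hκ (b := b)
  have hfac : ∀ (P : A) (c : ℤ), Commute b P →
      b * (b * P) = P * splitFactor q b κ c + (qn q c ^ 2) • (q • κ * P) := by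
    intro P c hP
    rw [splitFactor, mul_sub, mul_smul_comm, ← (hκ P).eq, smul_mul_assoc, smul_smul,
      ← (hP.pow_left 2).eq, pow_two, mul_assoc, mul_comm q]
    abel
  rcases Nat.even_or_odd' r with ⟨k, rfl | rfl⟩
  · have h1 : ¬ Odd (2 * k) := by simp
    have h2 : Odd (2 * k + 1) := by simp
    have h3 : (2 * k + 1) / 2 = k := by omega
    have h4 : 2 * k / 2 = k := by omega
    have h5 : ((2 * k : ℕ) : ZMod 2) = 0 := by
      push_cast; rw [show (2 : ZMod 2) = 0 from rfl, zero_mul]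
    by_cases ht : t = 1
    · subst ht
      simp [splitNum, parityCoeff, h1, h2, h3, h4, h5]
    · have ht0 : t = 0 := by revert t; decide
      subst ht0
      cases k with
      | zero => simp [splitNum]
      | succ k =>
        have h6 : (2 * (k + 1) - 1) / 2 = k := by omega
        have h7 : Odd (2 * (k + 1) - 1) := ⟨k, by omega⟩
        simp only [splitNum, parityCoeff, h1, h2, h3, h4, h5, h6, h7, if_true, if_false,
          zero_ne_one, one_mul]
        -- For even parity the factor l = 0 contains [0] and is just b².
        have e : ((List.range (k + 1)).map fun l : ℕ =>
            splitFactor q b κ (2 * ((l : ℤ) + 1) - 2)).prod =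
            b * (b * ((List.range k).map fun l : ℕ =>
              splitFactor q b κ (2 * ((l : ℤ) + 1))).prod) := by
          rw [List.prod_range_succ']
          simp [splitFactor, pow_two, mul_assoc, e0]
        rw [e, List.prod_range_succ]
        have e2 := hfac _ (2 * ((k : ℤ) + 1)) (hc (fun l => 2 * ((l : ℤ) + 1)) k)
        rw [e2, mul_add]
        push_cast
        rw [mul_smul_comm, ← mul_assoc b (q • κ), ((hκ b).symm.smul_right q).eq, mul_assoc (q • κ)]
  · have h1 : Odd (2 * k + 1) := by simp
    have h2 : ¬ Odd (2 * k + 1 + 1) := by simp [Nat.odd_add_one]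
    have h3 : (2 * k + 1) / 2 = k := by omega
    have h4 : (2 * k + 1 + 1) / 2 = k + 1 := by omega
    have h5 : ((2 * k + 1 : ℕ) : ZMod 2) = 1 := by
      push_cast; rw [show (2 : ZMod 2) = 0 from rfl, zero_mul, zero_add]
    have h6 : 2 * k / 2 = k := by omega
    have h7 : ¬ Odd (2 * k) := by simp
    by_cases ht : t = 1
    · subst ht
      simp only [splitNum, parityCoeff, h1, h2, h3, h4, h5, if_true, if_false, one_mul,
        Nat.add_sub_cancel, h6, h7]
      rw [List.prod_range_succ]
      have e2 := hfac _ (2 * ((k : ℤ) + 1) - 1) (hc (fun l => 2 * ((l : ℤ) + 1) - 1) k)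
      rw [e2]
      congr 4
      push_cast
      ring
    · have ht0 : t = 0 := by revert t; decide
      subst ht0
      simp only [splitNum, parityCoeff, h1, h2, h3, h4, h5, if_true, if_false, zero_ne_one,
        one_ne_zero, zero_mul, zero_smul, add_zero]
      rw [List.prod_range_succ']
      simp [splitFactor, pow_two, mul_assoc, e0]

theorem dividedRec_split {q : 𝔽} (hq : QGeneric q) {b κ : A} (hκ : ∀ y : A, Commute κ y)
    (t : ZMod 2) : DividedRec q b (q • κ) (parityCoeff 𝔽 t)
      (fun m => (qfac q m)⁻¹ • splitNum q b κ t m) where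
  step r := by
    rw [mul_smul_comm, splitNum_step hκ, smul_add, qfac_succ, mul_inv, smul_smul, smul_smul,
      mul_comm (qn q _), mul_assoc, inv_mul_cancel₀ (hq.2 r), mul_one]
    congr 1
    cases r with
    | zero => simp
    | succ r =>
      have h1 := hq.2 r
      have h2 := hq.qfac_ne_zero r
      rw [mul_smul_comm, smul_smul, Nat.add_sub_cancel, qfac_succ]
      congr 1
      push_cast
      field_simp
  comm r := by
    refine Commute.smul_right ?_ _
    unfold splitNum
    split_ifs
    · exact (Commute.refl b).mul_right (commute_splitProd q hκ _ _)
    · exact commute_splitProd q hκ _ _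
    · exact (Commute.refl b).mul_right (commute_splitProd q hκ _ _)
    · exact commute_splitProd q hκ _ _

theorem splitNum_zero (q : 𝔽) (b κ : A) (t : ZMod 2) : splitNum q b κ t 0 = 1 := by
  simp [splitNum]

end Transfer

end

/-! ### Leading terms of ıdivided powers and the double as a `DoubleRep` -/

noncomputable section

section Ladder

variable {𝔽 A : Type*} [Field 𝔽] [Ring A] [Algebra 𝔽 A]

theorem exists_smul_sub_mem_lowerSpan_of_dividedRec {q : 𝔽} (hq : QGeneric q) {b κ : A}
    {θ : ℕ → 𝔽} {u : ℕ → A} (hu : DividedRec q b κ θ u) (hu0 : u 0 = 1) (C : Subalgebra 𝔽 A)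
    (hC : ∀ w ∈ C, Commute b w) (hκ : κ ∈ C) (n : ℕ) :
    ∃ c : 𝔽, c ≠ 0 ∧ u n - c • b ^ n ∈ lowerSpan C b n := by
  refine ⟨_, inv_ne_zero (hq.qfac_ne_zero n), ladder_sub_mem_lowerSpan hq C hC (D := u)
    (w := fun r => (θ r * qn q r) • κ) hu0 (fun r => C.smul_mem hκ _) (by simp) (fun r => ?_) n⟩
  rw [hu.step r, smul_mul_assoc]

/-- The scalars c₀ and c k are arbitrary: every correction term has degree n - 2k with k ≥ 1 and
coefficient in C, so it cannot affect the leading term. -/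
theorem exists_smul_sub_mem_lowerSpan_binomSeq {q : 𝔽} (hq : QGeneric q) {f y w z : A}
    (h : f * y = q ^ (-2 : ℤ) • (y * f) + w) (hwy : Commute w y) (C : Subalgebra 𝔽 A)
    (hC : ∀ w ∈ C, Commute (f + y) w) (hw : w ∈ C) (hz : z ∈ C) (c₀ : 𝔽) (c : ℕ → 𝔽) (n : ℕ) :
    ∃ d : 𝔽, d ≠ 0 ∧ (binomSeq q y f n + c₀ • ∑ k ∈ Finset.Icc 1 (n / 2),
      c k • (dpow q z k * binomSeq q y f (n - 2 * k))) - d • (f + y) ^ n ∈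
        lowerSpan C (f + y) n := by
  have hlad : ∀ n, binomSeq q y f n - (qfac q n)⁻¹ • (f + y) ^ n ∈ lowerSpan C (f + y) n :=
    ladder_sub_mem_lowerSpan hq C hC (D := binomSeq q y f)
      (w := fun n => (if n = 0 then 0 else q ^ (1 - (n : ℤ))) • w) (by simp [binomSeq])
      (fun n => C.smul_mem hw _) (by simp) (add_mul_binomSeq hq h hwy)
  refine ⟨_, inv_ne_zero (hq.qfac_ne_zero n), ?_⟩
  rw [add_sub_right_comm]
  refine add_mem (hlad n) (Submodule.smul_mem _ _ (Submodule.sum_mem _ fun k hk => ?_))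
  refine Submodule.smul_mem _ _ ?_
  obtain ⟨hk1, hk2⟩ := Finset.mem_Icc.1 hk
  obtain ⟨k, rfl⟩ := Nat.exists_eq_succ_of_ne_zero (show k ≠ 0 by omega)
  have h1 := mul_mem_lowerSpan_of_sub_mem C (f + y)
    (C.smul_mem (C.pow_mem hz (k + 1)) (qfac q (k + 1))⁻¹) (hlad (n - 2 * (k + 1))) k
  rwa [Nat.sub_add_cancel (by omega)] at h1

end Ladder

namespace QRootDatum

variable {I Y X : Type*} [AddCommGroup Y] [AddCommGroup X] {R : QRootDatum I Y X}

namespace DoubleRep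

variable {𝔽 : Type*} [Field 𝔽] {v : 𝔽} {A : Type*} [Ring A] [Algebra 𝔽 A] {D : R.DoubleRep v A}

/-- Skew derivations map `U⁺_J Eⱼ U⁺_J` to `U⁺_J`, for `j ∉ J`. -/
theorem skewDer_mem_posPart {J : Set I} {j : I} (hj : j ∉ J) {U : Subalgebra 𝔽 A}
    (hU : ∀ k, D.E k ∈ U) (r : U →ₗ[𝔽] U) (χ : List I → 𝔽) (h1 : r 1 = 0)
    (hs : r ⟨D.E j, hU j⟩ = 1) (hd : ∀ k, k ≠ j → r ⟨D.E k, hU k⟩ = 0)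
    (hm : ∀ (l : List I) (x x' : U), (x' : A) = D.monE l →
      r (x * x') = x * r x' + χ l • (r x * x')) {β : X} {x : A} (hx : x ∈ D.midPart J j β) :
    ∃ y : U, (y : A) = x ∧ (r y : A) ∈ D.posPart J (β - R.α j) := by
  let m : List I → U := fun l => (l.map fun k => (⟨D.E k, hU k⟩ : U)).prod
  have hmE : ∀ l, (m l : A) = D.monE l := by
    intro l
    induction l with
    | nil => rfl
    | cons k l ih =>
      change ((⟨D.E k, hU k⟩ * m l : U) : A) = _
      rw [Subalgebra.coe_mul, ih]; rfl
  have hm0 : ∀ l : List I, (∀ k ∈ l, k ∈ J) → r (m l) = 0 := by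
    intro l
    induction l with
    | nil => exact fun _ => h1
    | cons k l ih =>
      intro hl
      change r (⟨D.E k, hU k⟩ * m l) = 0
      rw [hm l _ _ (hmE l), ih fun x hx => hl x (by simp [hx]),
        hd k (ne_of_mem_of_not_mem (hl k (by simp)) hj), mul_zero, zero_mul, smul_zero, add_zero]
  -- For a monomial with E_j occurring once, r removes E_j, multiplies by a scalar, and kills all
  -- other letters. The image of a preimage carries the lift to U on which r is evaluated.
  have key : D.midPart J j β ≤
      ((D.posPart J (β - R.α j)).comap (U.val.toLinearMap ∘ₗ r)).map U.val.toLinearMap := by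
    refine Submodule.span_le.2 ?_
    rintro x ⟨l, l', hl, hl', rfl, rfl⟩
    refine ⟨m l * (⟨D.E j, hU j⟩ * m l'), ?_, ?_⟩
    · have e1 : r (⟨D.E j, hU j⟩ * m l') = χ l' • m l' := by
        rw [hm l' _ _ (hmE l'), hm0 l' hl', hs, mul_zero, zero_add, one_mul]
      have e2 : ((⟨D.E j, hU j⟩ * m l' : U) : A) = D.monE (j :: l') := by
        rw [Subalgebra.coe_mul, hmE]; rfl
      have e3 : r (m l * (⟨D.E j, hU j⟩ * m l')) = χ l' • (m l * m l') := by
        rw [hm (j :: l') _ _ e2, e1, hm0 l hl, zero_mul, smul_zero, add_zero, mul_smul_comm]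
      change ((r (m l * (⟨D.E j, hU j⟩ * m l')) : U) : A) ∈
        D.posPart J ((l.map R.α).sum + R.α j + (l'.map R.α).sum - R.α j)
      rw [e3, Subalgebra.coe_smul, Subalgebra.coe_mul, hmE, hmE, ← monE_append]
      refine Submodule.smul_mem _ _ (Submodule.subset_span ⟨l ++ l', fun k hk => ?_, ?_, rfl⟩)
      · exact (List.mem_append.1 hk).elim (hl k) (hl' k)
      · rw [List.map_append, List.sum_append]; abel
    · change ((m l * (⟨D.E j, hU j⟩ * m l') : U) : A) = _
      rw [Subalgebra.coe_mul, Subalgebra.coe_mul, hmE, hmE, mul_assoc]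
  obtain ⟨y, hy, hyx⟩ := key hx
  exact ⟨y, hyx, hy⟩

end DoubleRep

section double

variable (R) (𝕜 : Type*) [Field 𝕜]

/-! ### Relations of the Drinfeld double -/

theorem ratFuncX_pow_ne_one {n : ℕ} (hn : n ≠ 0) : (RatFunc.X : RatFunc 𝕜) ^ n ≠ 1 := by
  intro h
  have h1 : algebraMap (Polynomial 𝕜) (RatFunc 𝕜) (Polynomial.X ^ n) =
      algebraMap (Polynomial 𝕜) (RatFunc 𝕜) 1 := by
    rw [map_pow, RatFunc.algebraMap_X, h, map_one]
  have h2 := RatFunc.algebraMap_injective 𝕜 h1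
  have h3 := congrArg Polynomial.natDegree h2
  simp at h3
  exact hn h3

variable {𝕜} in
theorem mk_rel {x y : Free 𝕜 I Y} (h : R.Rel 𝕜 x y) :
    RingQuot.mkAlgHom (RatFunc 𝕜) (R.Rel 𝕜) x = RingQuot.mkAlgHom (RatFunc 𝕜) (R.Rel 𝕜) y :=
  RingQuot.mkAlgHom_rel _ h

theorem K_zero : R.K 𝕜 0 = 1 := by
  have := R.mk_rel (𝕜 := 𝕜) Rel.K_zero
  simp only [map_one] at this
  exact this

theorem Kp_zero : R.Kp 𝕜 0 = 1 := by
  have := R.mk_rel (𝕜 := 𝕜) Rel.Kp_zero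
  simp only [map_one] at this
  exact this

theorem K_add (x y : Y) : R.K 𝕜 (x + y) = R.K 𝕜 x * R.K 𝕜 y := by
  have := R.mk_rel (𝕜 := 𝕜) (Rel.K_add x y)
  simp only [map_mul] at this
  exact this

theorem Kp_add (x y : Y) : R.Kp 𝕜 (x + y) = R.Kp 𝕜 x * R.Kp 𝕜 y := by
  have := R.mk_rel (𝕜 := 𝕜) (Rel.Kp_add x y)
  simp only [map_mul] at this
  exact this

theorem K_comm (x y : Y) : Commute (R.K 𝕜 x) (R.K 𝕜 y) := by
  have := R.mk_rel (𝕜 := 𝕜) (Rel.K_K x y)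
  simp only [map_mul] at this
  exact this

theorem K_Kp_comm (x y : Y) : Commute (R.K 𝕜 x) (R.Kp 𝕜 y) := by
  have := R.mk_rel (𝕜 := 𝕜) (Rel.K_Kp x y)
  simp only [map_mul] at this
  exact this

theorem Kp_comm (x y : Y) : Commute (R.Kp 𝕜 x) (R.Kp 𝕜 y) := by
  have := R.mk_rel (𝕜 := 𝕜) (Rel.Kp_Kp x y)
  simp only [map_mul] at this
  exact this

theorem K_E (y : Y) (i : I) : R.K 𝕜 y * R.E 𝕜 i =
    (RatFunc.X : RatFunc 𝕜) ^ R.pair y (R.α i) • (R.E 𝕜 i * R.K 𝕜 y) := by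
  have := R.mk_rel (𝕜 := 𝕜) (Rel.K_E y i)
  simp only [map_mul, map_smul] at this
  exact this

theorem K_F (y : Y) (i : I) : R.K 𝕜 y * R.F 𝕜 i =
    (RatFunc.X : RatFunc 𝕜) ^ (-R.pair y (R.α i)) • (R.F 𝕜 i * R.K 𝕜 y) := by
  have := R.mk_rel (𝕜 := 𝕜) (Rel.K_F y i)
  simp only [map_mul, map_smul] at this
  exact this

theorem Kp_E (y : Y) (i : I) : R.Kp 𝕜 y * R.E 𝕜 i =
    (RatFunc.X : RatFunc 𝕜) ^ (-R.pair y (R.α i)) • (R.E 𝕜 i * R.Kp 𝕜 y) := by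
  have := R.mk_rel (𝕜 := 𝕜) (Rel.Kp_E y i)
  simp only [map_mul, map_smul] at this
  exact this

theorem Kp_F (y : Y) (i : I) : R.Kp 𝕜 y * R.F 𝕜 i =
    (RatFunc.X : RatFunc 𝕜) ^ R.pair y (R.α i) • (R.F 𝕜 i * R.Kp 𝕜 y) := by
  have := R.mk_rel (𝕜 := 𝕜) (Rel.Kp_F y i)
  simp only [map_mul, map_smul] at this
  exact this

theorem E_mul_F_same (k : I) : R.E 𝕜 k * R.F 𝕜 k = R.F 𝕜 k * R.E 𝕜 k +
    (R.qi 𝕜 k - (R.qi 𝕜 k)⁻¹)⁻¹ • (R.Kt 𝕜 k - R.Ktp 𝕜 k) := by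
  have := R.mk_rel (𝕜 := 𝕜) (Rel.E_F_same k)
  simp only [map_sub, map_mul, map_smul, map_pow] at this
  exact sub_eq_iff_eq_add'.1 this

theorem E_F_comm {k l : I} (h : k ≠ l) : Commute (R.E 𝕜 k) (R.F 𝕜 l) := by
  have := R.mk_rel (𝕜 := 𝕜) (Rel.E_F_diff k l h)
  simp only [map_sub, map_mul, map_zero] at this
  exact sub_eq_zero.1 this

theorem E_comm_of_a_eq_zero {k l : I} (h : k ≠ l) (ha : R.a k l = 0) :
    Commute (R.E 𝕜 k) (R.E 𝕜 l) := by
  have := R.mk_rel (𝕜 := 𝕜) (Rel.serre_E k l h)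
  rw [serrePoly, ha] at this
  have h1 : R.qint 𝕜 k 1 = 1 :=
    (R.qv_generic RatFunc.X_ne_zero (fun _ hn => ratFuncX_pow_ne_one 𝕜 hn) k).qn_one
  simp [Finset.Nat.antidiagonal_succ, qbinom, qfact, h1] at this
  have h2 : R.E 𝕜 l * R.E 𝕜 k + -(R.E 𝕜 k * R.E 𝕜 l) = 0 := this
  rw [← sub_eq_add_neg, sub_eq_zero] at h2
  exact h2.symm

/-- An algebra element that commutes with all generators is central. -/
theorem commute_of_gen (z : R.Double 𝕜) (hE : ∀ i, Commute z (R.E 𝕜 i))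
    (hF : ∀ i, Commute z (R.F 𝕜 i)) (hK : ∀ y, Commute z (R.K 𝕜 y))
    (hKp : ∀ y, Commute z (R.Kp 𝕜 y)) (x : R.Double 𝕜) : Commute z x := by
  obtain ⟨x, rfl⟩ := RingQuot.mkAlgHom_surjective (RatFunc 𝕜) (R.Rel 𝕜) x
  induction x using FreeAlgebra.induction with
  | grade0 r => rw [AlgHom.commutes]; exact (Algebra.commutes r z).symm
  | grade1 g =>
    cases g with
    | E i => exact hE i
    | F i => exact hF i
    | K y => exact hK y
    | Kp y => exact hKp y
  | mul a b ha hb => rw [map_mul]; exact ha.mul_right hb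
  | add a b ha hb => rw [map_add]; exact ha.add_right hb

/-- The Drinfeld double as an algebra with the relations of the Drinfeld double. -/
def doubleRep : R.DoubleRep (RatFunc.X : RatFunc 𝕜) (R.Double 𝕜) where
  v_ne_zero := RatFunc.X_ne_zero
  v_pow_ne_one _ hn := ratFuncX_pow_ne_one 𝕜 hn
  E := R.E 𝕜
  F := R.F 𝕜
  K := R.K 𝕜
  Kp := R.Kp 𝕜
  K_zero := R.K_zero 𝕜
  Kp_zero := R.Kp_zero 𝕜
  K_add := R.K_add 𝕜
  Kp_add := R.Kp_add 𝕜
  K_comm := R.K_comm 𝕜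
  K_Kp_comm := R.K_Kp_comm 𝕜
  Kp_comm := R.Kp_comm 𝕜
  K_E := R.K_E 𝕜
  K_F := R.K_F 𝕜
  Kp_E := R.Kp_E 𝕜
  Kp_F := R.Kp_F 𝕜
  E_mul_F_same := R.E_mul_F_same 𝕜
  E_F_comm := R.E_F_comm 𝕜
  E_comm := R.E_comm_of_a_eq_zero 𝕜
  commute_of_gen := R.commute_of_gen 𝕜

variable {R 𝕜}

theorem IsSymmFamily.doubleRep {J : Set I}
    {T : (X ≃ₗ[ℤ] X) → (R.Double 𝕜 →ₐ[RatFunc 𝕜] R.Double 𝕜)} (hT : R.IsSymmFamily 𝕜 J T) :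
    (R.doubleRep 𝕜).IsSymmFamily J T where
  simple k hk :=
    { K := (hT.simple k hk).K
      Kp := (hT.simple k hk).Kp
      E_same := (hT.simple k hk).E_same
      F_same := (hT.simple k hk).F_same
      E_diff := (hT.simple k hk).E_diff }
  reduced l hl h := hT.reduced l hl h

theorem skewDer_mem {J : Set I} {j : I} (hj : j ∉ J) {β : X} {x : R.Double 𝕜}
    (hx : x ∈ (R.doubleRep 𝕜).midPart J j β) :
    R.skewDer 𝕜 j x ∈ (R.doubleRep 𝕜).posPart J (β - R.α j) := by
  rw [skewDer]
  split_ifs with h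
  · have hr := h.1.choose_spec
    have hU : ∀ k, (R.doubleRep 𝕜).E k ∈ R.UPlus 𝕜 := fun k =>
      Algebra.subset_adjoin ⟨k, rfl⟩
    obtain ⟨y, hy, hry⟩ := DoubleRep.skewDer_mem_posPart hj hU h.1.choose
      (fun l => (RatFunc.X : RatFunc 𝕜) ^ ((l : Multiset I).map (R.form j)).sum) hr.one
      (hr.same _ rfl) (fun k hk => hr.diff k hk _ rfl)
      (fun l x x' hx' => hr.mul l x x' (Submodule.subset_span ⟨l, rfl, hx'⟩)) hx
    obtain rfl : y = ⟨x, h.2⟩ := Subtype.ext hy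
    exact hry
  · exact zero_mem _

end double

end QRootDatum

end

/-! ### Leading terms of B_j^(n) in the Drinfeld double -/

noncomputable section

namespace QRootDatum

variable {I Y X : Type*} [AddCommGroup Y] [AddCommGroup X] {R : QRootDatum I Y X}

namespace AdmissiblePair

variable {𝕜 : Type*} [Field 𝕜] (P : R.AdmissiblePair)

/-- The existence of the symmetries is not needed: the default value 0 has all properties used
below. -/
theorem lusztigSymm_eq_or (𝕜 : Type*) [Field 𝕜] :
    (∃ T, (R.doubleRep 𝕜).IsSymmFamily P.black T ∧
      ∀ w x, R.lusztigSymm 𝕜 P.black w x = T w x) ∨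
      ∀ w x, R.lusztigSymm 𝕜 P.black w x = 0 := by
  by_cases h : ∃ T, R.IsSymmFamily 𝕜 P.black T
  · refine Or.inl ⟨h.choose, h.choose_spec.doubleRep, fun w x => ?_⟩
    rw [lusztigSymm, dif_pos h]
  · refine Or.inr fun w x => ?_
    rw [lusztigSymm, dif_neg h]

variable {P}

theorem lusztigSymm_mem_midPart {j : I} (hj : j ∉ P.black) :
    R.lusztigSymm 𝕜 P.black P.w0 (R.E 𝕜 j) ∈
      (R.doubleRep 𝕜).midPart P.black j (P.w0 (R.α j)) := by
  rcases P.lusztigSymm_eq_or 𝕜 with ⟨T, hT, h⟩ | h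
  · rw [h]
    exact hT.map_E_mem_midPart P.finite_type hj P.longest.1
  · rw [h]
    exact zero_mem _

theorem exists_lusztigSymm_comm {j : I} (hj : j ∉ P.black) (hne : P.w0 (R.α j) ≠ R.α j) :
    ∃ z ∈ (R.doubleRep 𝕜).posPart P.black (P.w0 (R.α j) - R.α j),
      R.lusztigSymm 𝕜 P.black P.w0 (R.E 𝕜 j) * (R.doubleRep 𝕜).F j -
        (R.doubleRep 𝕜).F j * R.lusztigSymm 𝕜 P.black P.w0 (R.E 𝕜 j) =
          z * (R.doubleRep 𝕜).Kt j := by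
  rcases P.lusztigSymm_eq_or 𝕜 with ⟨T, hT, h⟩ | h
  · rw [h]
    exact hT.hasHalfComm P.finite_type hj P.longest.1 hne
  · rw [h]
    exact ⟨0, zero_mem _, by rw [zero_mul, mul_zero, zero_mul, sub_zero]⟩

theorem commute_lusztigSymm {j : I} (hj : j ∉ P.black) {z : R.Double 𝕜}
    (hz : z ∈ (R.doubleRep 𝕜).posPart P.black (P.w0 (R.α j) - R.α j)) :
    Commute z (R.lusztigSymm 𝕜 P.black P.w0 (R.E 𝕜 j) * (R.doubleRep 𝕜).Ktp j) := by
  rcases P.lusztigSymm_eq_or 𝕜 with ⟨T, hT, h⟩ | h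
  · rw [h]
    exact hT.commute_longest hj hz
  · rw [h, zero_mul]
    exact Commute.zero_right z

section fixed

variable {i : I} (hτ : P.τ i = i) (hw : P.w0 (R.α i) = R.α i)

include hτ in
theorem B_eq_of_notMem (hi : i ∉ P.black) : P.B 𝕜 i =
    (R.doubleRep 𝕜).F i + R.lusztigSymm 𝕜 P.black P.w0 (R.E 𝕜 i) * (R.doubleRep 𝕜).Ktp i := by
  rw [B, if_neg hi, TE, hτ]; rfl

-- As w_• fixes α_i, T_{w_•}(E_i) is a multiple of E_i, so B_i involves only E_i, F_i and K̃'_i.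
include hτ hw in
theorem commute_B_fixed {μ : X} {z : R.Double 𝕜}
    (hz : z ∈ (R.doubleRep 𝕜).posPart P.black μ) : Commute z (P.B 𝕜 i) := by
  have hi := notMem_black_of_fixed hτ hw
  rw [B_eq_of_notMem hτ hi]
  have h := lusztigSymm_mem_midPart (𝕜 := 𝕜) hi
  rw [hw] at h
  obtain ⟨c, hc⟩ := DoubleRep.exists_smul_of_mem_midPart h
  rw [hc]
  exact DoubleRep.commute_fixed hτ hw hz c

include hτ in
theorem kt_central (x : R.Double 𝕜) : Commute (P.kt 𝕜 i) x := by
  rw [kt, hτ]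
  exact (R.doubleRep 𝕜).Kt_mul_Ktp_central i x

theorem idpSplit_eq (t : ZMod 2) (m : ℕ) : P.idpSplit 𝕜 i t m =
    (qfac (R.qv (RatFunc.X : RatFunc 𝕜) i) m)⁻¹ •
      splitNum (R.qv (RatFunc.X : RatFunc 𝕜) i) (P.B 𝕜 i) (P.kt 𝕜 i) t m := by
  -- The index in `idpSplit` is an integer, so its `List.range` is coerced to a list of integers by
  -- a monadic bind, here turned into a `map`.
  have h : ∀ (l : List ℕ), (do let a ← l; pure (a : ℤ)) = l.map (fun a : ℕ => (a : ℤ)) :=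
    fun l => List.flatMap_pure_eq_map _ l
  simp only [idpSplit, splitNum, h, List.map_map]
  rfl

include hτ in
theorem dividedRec_idpSplit (t : ZMod 2) : DividedRec (R.qv RatFunc.X i) (P.B 𝕜 i)
    (R.qv (RatFunc.X : RatFunc 𝕜) i • P.kt 𝕜 i) (parityCoeff (RatFunc 𝕜) t) (P.idpSplit 𝕜 i t) := by
  have h := dividedRec_split ((R.doubleRep 𝕜).generic i) (b := P.B 𝕜 i)
    (kt_central (𝕜 := 𝕜) hτ) t
  have e : P.idpSplit 𝕜 i t = fun m => (qfac (R.qv (RatFunc.X : RatFunc 𝕜) i) m)⁻¹ •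
    splitNum (R.qv (RatFunc.X : RatFunc 𝕜) i) (P.B 𝕜 i) (P.kt 𝕜 i) t m :=
      funext fun m => idpSplit_eq t m
  rw [e]
  exact h

theorem idpSplit_zero (t : ZMod 2) : P.idpSplit 𝕜 i t 0 = 1 := by
  rw [idpSplit_eq, splitNum_zero, qfac_zero, inv_one, one_smul]

-- The centralizer of both B_i and B_j serves as coefficient algebra: commuting with B_j makes the
-- recursion triangular, commuting with B_i lets coefficients leave the Serre sum.
include hτ hw in
theorem exists_idp_sub_mem_lowerSpan (j : I) (t : ZMod 2) (n : ℕ) :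
    ∃ c : RatFunc 𝕜, c ≠ 0 ∧ P.idp 𝕜 j t n - c • P.B 𝕜 j ^ n ∈
      lowerSpan (Subalgebra.centralizer (RatFunc 𝕜) {P.B 𝕜 i, P.B 𝕜 j}) (P.B 𝕜 j) n := by
  have hq := (R.doubleRep 𝕜).generic j
  set C := Subalgebra.centralizer (RatFunc 𝕜) {P.B 𝕜 i, P.B 𝕜 j} with hC
  have hmem : ∀ w : R.Double 𝕜, Commute (P.B 𝕜 i) w → Commute (P.B 𝕜 j) w → w ∈ C := by
    intro w h1 h2
    rw [hC, Subalgebra.mem_centralizer_iff]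
    rintro y (rfl | rfl)
    · exact h1.eq
    · exact h2.eq
  have hCj : ∀ w ∈ C, Commute (P.B 𝕜 j) w := fun w hw =>
    Subalgebra.mem_centralizer_iff (RatFunc 𝕜) |>.1 hw _ (by simp)
  rw [idp]
  split_ifs with h1 h2
  · refine ⟨(qfac (R.qv RatFunc.X j) n)⁻¹, inv_ne_zero (hq.qfac_ne_zero n), ?_⟩
    have e : R.dp 𝕜 j (P.B 𝕜 j) n = (qfac (R.qv RatFunc.X j) n)⁻¹ • P.B 𝕜 j ^ n := rfl
    rw [e, sub_self]
    exact zero_mem _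
  · push Not at h1
    have hκ : R.qv (RatFunc.X : RatFunc 𝕜) j • P.kt 𝕜 j ∈ C :=
      C.smul_mem (hmem _ (kt_central h1.2 _).symm (kt_central h1.2 _).symm) _
    exact exists_smul_sub_mem_lowerSpan_of_dividedRec hq (dividedRec_idpSplit h1.2 t)
      (idpSplit_zero t) C hCj hκ n
  · push Not at h1
    obtain ⟨hj, hτj⟩ := h1
    obtain ⟨z, hz, hcomm⟩ := exists_lusztigSymm_comm (𝕜 := 𝕜) hj h2
    have hB := B_eq_of_notMem (𝕜 := 𝕜) hτj hj
    -- Both the commutator term z K̃_j K̃'_j and Z_j K̃_j K̃'_j are elements of weight w_•α_j - α_j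
    -- times this central element, so one membership proof covers both.
    have hcen := (R.doubleRep 𝕜).Kt_mul_Ktp_central j
    have hzC : ∀ z ∈ (R.doubleRep 𝕜).posPart P.black (P.w0 (R.α j) - R.α j),
        z * ((R.doubleRep 𝕜).Kt j * (R.doubleRep 𝕜).Ktp j) ∈ C := by
      intro z hz
      refine C.mul_mem (hmem z (commute_B_fixed hτ hw hz).symm ?_)
        (hmem _ (hcen _).symm (hcen _).symm)
      rw [hB]
      exact ((DoubleRep.commute_F_of_mem_posPart hz hj).add_right
        (commute_lusztigSymm hj hz)).symm
    have hZ : P.Z 𝕜 j ∈ (R.doubleRep 𝕜).posPart P.black (P.w0 (R.α j) - R.α j) :=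
      Submodule.smul_mem _ _ (skewDer_mem hj (lusztigSymm_mem_midPart hj))
    have hrel := DoubleRep.F_mul_eq_of_hasHalfComm hcomm
    have hwC := C.neg_mem (hzC z hz)
    have hwy : Commute (-(z * ((R.doubleRep 𝕜).Kt j * (R.doubleRep 𝕜).Ktp j)))
        (R.lusztigSymm 𝕜 P.black P.w0 (R.E 𝕜 j) * (R.doubleRep 𝕜).Ktp j) :=
      ((commute_lusztigSymm hj hz).mul_left (hcen _)).neg_left
    have hfin := exists_smul_sub_mem_lowerSpan_binomSeq hq hrel hwy C (by rwa [← hB]) hwC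
      (hzC _ hZ) ((RatFunc.X : RatFunc 𝕜) / (RatFunc.X - RatFunc.X⁻¹))
      (fun k => R.qi 𝕜 j ^ (k * (k + 1) / 2)) n
    rw [← hB] at hfin
    rw [← mul_assoc] at hfin
    exact hfin

end fixed

end AdmissiblePair

end QRootDatum

end

theorem proposition5p8 {𝕜 I Y X : Type*} [Field 𝕜] [CharZero 𝕜] [Finite I]
    [AddCommGroup Y] [AddCommGroup X] (R : QRootDatum I Y X) (A : R.AdmissiblePair)
    (i j : I) (hij : i ≠ j) (hτ : A.τ i = i) (hw : A.w0 (R.α i) = R.α i) (p t : ZMod 2) :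
    (∀ n : ℕ, ∑ rs ∈ Finset.HasAntidiagonal.antidiagonal (1 - (n : ℤ) * R.a i j).toNat,
        (-1 : R.Double 𝕜) ^ rs.1 * A.idp 𝕜 i p rs.1 * A.B 𝕜 j ^ n *
          A.idp 𝕜 i (p + (((n : ℤ) * R.a i j : ℤ) : ZMod 2)) rs.2 = 0) ↔
    (∀ n : ℕ, ∑ rs ∈ Finset.HasAntidiagonal.antidiagonal (1 - (n : ℤ) * R.a i j).toNat,
        (-1 : R.Double 𝕜) ^ rs.1 * A.idp 𝕜 i p rs.1 * A.idp 𝕜 j t n *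
          A.idp 𝕜 i (p + (((n : ℤ) * R.a i j : ℤ) : ZMod 2)) rs.2 = 0) := by
  obtain ⟨m, hm⟩ := QRootDatum.DoubleRep.exists_nat_a (R := R) hij
  have hi := QRootDatum.AdmissiblePair.notMem_black_of_fixed hτ hw
  have hidp : ∀ t, A.idp 𝕜 i t = A.idpSplit 𝕜 i t := fun t => funext fun n => by
    rw [QRootDatum.AdmissiblePair.idp, if_neg (by simp [hi, hτ]), if_pos hw]
  have hN : ∀ n : ℕ, (1 - (n : ℤ) * R.a i j).toNat = 1 + n * m := fun n => by
    rw [hm, show (1 : ℤ) - n * -m = ((1 + n * m : ℕ) : ℤ) by push_cast; ring, Int.toNat_natCast]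
  have hpar : ∀ n : ℕ, (((n : ℤ) * R.a i j : ℤ) : ZMod 2) = ((n * m : ℕ) : ZMod 2) := fun n => by
    rw [hm]
    push_cast
    rw [mul_neg, ZMod.neg_eq_self_mod_two]
  simp only [hN, hpar, hidp]
  exact serreSum_pow_iff ((R.doubleRep 𝕜).generic i)
    (QRootDatum.AdmissiblePair.dividedRec_idpSplit hτ) QRootDatum.AdmissiblePair.idpSplit_zero
    (fun y => (QRootDatum.AdmissiblePair.kt_central hτ y).smul_left _) p m
    (fun w hw => (Subalgebra.mem_centralizer_iff (RatFunc 𝕜) |>.1 hw _ (by simp)).symm)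
    (QRootDatum.AdmissiblePair.exists_idp_sub_mem_lowerSpan hτ hw j t)
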